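/- **Setting.** Let $k=2^m$ ($m\ge 0$). There are $N=k2^k$ committees $(\rho,\gamma)$ with row $\rho\in\{0,1\}^k$ and column $\gamma\in\mathbb Z/k$, forming a wrapped butterfly: a committee in column $\gamma$ is joined to exactly two committees of column $\gamma+1$, the one in the same row and the one whose row differs in exactly the bit $\gamma+1$. Write $\log$ for the natural logarithm. **The sampling procedure.** Every committee $C$ generates $L$ tokens $t$ with $t.\mathrm{src}=C$; the numbers $t.\mathrm{rand}\in\{1,2,\dots\}$ are independent and geometric with parameter $1/2$. * Round $1$: $t.\mathrm{dst}$ is set to one of the two neighbours of $t.\mathrm{src}$ in the next column, uniformly and independently for all tokens. * Rounds $r=2,\dots,1+\log_2 k$: for each committee $C$ let $F_C$ be the set of remaining tokens with $\mathrm{dst}=C$ and $\mathrm{rand}\ge r$, and $S_C$ the set of remaining tokens with $\mathrm{src}=C$ and $\mathrm{rand}=r-1$. Independently for each $C$, a uniformly random maximum matching between $F_C$ and $S_C$ is chosen. If $f\in F_C$ is matched with $s\in S_C$, then $f.\mathrm{dst}$ becomes $s.\mathrm{dst}$. Unmatched tokens of $F_C$, and all tokens of $S_C$, are discarded. * Last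 round: for each surviving token, the column of $t.\mathrm{dst}$ is replaced by an independent uniformly random column (the row is kept). **Nodes and messages.** Nodes have distinct IDs of $\beta$ bits. In round $r$ the committee $C$ has a set $\mathrm{CML}_r(C)$ of member nodes. The overlay is *robust* (with constants $s_1,s_2$) if, for all rounds of the execution, $s_1\log n\le|\mathrm{CML}_r(C)|\le s_2\log n$ for all $C$, $\mathrm{CML}_r(C)\cap \mathrm{CML}_{r+1}(C)\ne\emptyset$, and $\mathrm{CML}_r(C)\cap \mathrm{CML}_r(D)=\emptyset$ for $C\neq D$; otherwise the members may change arbitrarily. In each round, for each token $t$ that survives the round, all members of the committee where $t$ is before the round (its source in round 1, its destination later) send a copy of $t$ (addresses and member lists of source and new destination, $t.\mathrm{rand}$, and an index of $t$) to all nodes in the lists that they hold of the members of the source and of the new destination of $t$; a list that is used in round $r$ may be out of date, i.e. be the list of any round $r'\le r$. A receiver that is currently in the addressed committee responds with the current member list of that committee. The execution *conforms to the model with bound $B$* if in each round (i) the members of a committee $C$ send copies only to committees whose member lists they know, namely $C$, its neighbours in the butterfly, the sources and destinations of the tokens stored at $C$ (those with source or destination $C$ after the previous round), and in the last round the committees in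 the row of $C$ (the members of a row are assumed to know each other's lists then); (ii) every node sends at most $B$ and receives at most $B$ messages; (iii) at most $B$ bits are sent from any node to any other node. **Theorem.** Fix positive constants $c_1,c_2,a_1,a_2,\alpha_0,p_0,s_1,s_2,b_0$ and $q\in\mathbb N$. 0. (Conformity.) There are $K>0$ and $d\in\mathbb N$ such that for every $c>0$ there is $n_0$ such that for all $n\ge n_0$ and all $m,L,\beta,\alpha$ with $c_1\frac n{\log n}\le N\le c_2\frac n{\log n}$, $\alpha_0\le\alpha\le p_0\log^q n$, $a_1\alpha\log^3n\le L\le a_2\alpha\log^3 n$ and $\beta\le b_0\log n$: the number $2+\log_2 k$ of rounds is at most $K\log\log n$, and with probability at least $1-n^{-c}$, for all robust choices of the member sets and all choices of the lists that are used, the execution conforms to the model with bound $K\log^d n$. 1. (Uniformity.) For all $m,L$ and every token $t$ that survives with positive probability: conditioned on its survival, the final destination of $t$ is uniform over the $N$ committees. 2. (Number of samples.) There is $\kappa>0$ such that for every $c>0$ there is $n_0$ such that for all $n\ge n_0$ and all $m,L,\alpha$ with $c_1\frac n{\log n}\le N\le c_2\frac n{\log n}$, $\alpha\ge\alpha_0$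 and $a_1\alpha\log^3n\le L\le a_2\alpha\log^3 n$, with probability at least $1-n^{-c}$ every committee is the source of at least $\kappa\alpha\log n$ surviving tokens and the final destination of at least $\kappa\alpha\log n$ surviving tokens. -/

import Mathlib

open scoped ENNReal

namespace Spartan

/-! ### Probability helpers -/

/-- The geometric distribution with parameter `1/2` on `{1, 2, 3, …}`: `j` has mass `2⁻ʲ`. -/
noncomputable def geomHalf : PMF ℕ :=
  ⟨fun j => if j = 0 then 0 else (2⁻¹ : ℝ≥0∞) ^ j, by
    have h : (∑' j : ℕ, if j = 0 then (0 : ℝ≥0∞) else (2⁻¹ : ℝ≥0∞) ^ j) = 1 := by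
      rw [tsum_eq_zero_add' ENNReal.summable]
      simp [ENNReal.tsum_geometric_add_one, ENNReal.one_sub_inv_two, ENNReal.inv_mul_cancel]
    exact h ▸ ENNReal.summable.hasSum⟩

/-- The law of independent samples `f i ∼ p`, one for each `i` in a finite type. -/
noncomputable def iidPMF (ι : Type*) [Fintype ι] (p : PMF ℕ) : PMF (ι → ℕ) :=
  ⟨fun f => ∏ i, p (f i), by
    classical
    have h : (∑' f : ι → ℕ, ∏ i, p (f i)) = 1 := by
      have h1 : ∀ f : ι → ℕ,
          (MeasureTheory.Measure.pi fun _ : ι => p.toMeasure) {f} = ∏ i, p (f i) := by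
        intro f
        rw [MeasureTheory.Measure.pi_singleton]
        exact Finset.prod_congr rfl fun i _ =>
          PMF.toMeasure_apply_singleton p (f i) (MeasurableSet.singleton _)
      simp_rw [← h1]
      have h2 := (MeasureTheory.Measure.pi fun _ : ι => p.toMeasure).tsum_indicator_apply_singleton
        Set.univ MeasurableSet.univ
      simpa using h2
    exact h ▸ ENNReal.summable.hasSum⟩

/-- The probability of the event `E` when the outcome has law `p`. -/
noncomputable def prob {Ω : Type*} (p : PMF Ω) (E : Set Ω) : ℝ :=
  (p.toOuterMeasure E).toReal

/-! ### The wrapped butterfly of committees -/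

/-- A committee of the wrapped butterfly with `k` columns and `2 ^ k` rows, as a pair
(row, column); a row is given by its binary representation. -/
abbrev Committee (k : ℕ) : Type := (Fin k → Bool) × Fin k

/-- The logical edges from a column `c` to the column `c + 1 (mod k)`: the two rows either
coincide or differ at exactly the bit `c + 1 (mod k)`. -/
def LogicalEdge {k : ℕ} [NeZero k] (C D : Committee k) : Prop :=
  D.2 = C.2 + 1 ∧ (D.1 = C.1 ∨ ∀ j, D.1 j ≠ C.1 j ↔ j = C.2 + 1)

/-- The two neighbours of `C` in the next column: the one in the same row (`b = false`), and
the one across the edge that flips a bit (`b = true`). -/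
def next {k : ℕ} [NeZero k] (C : Committee k) (b : Bool) : Committee k :=
  (if b then Function.update C.1 (C.2 + 1) (!(C.1 (C.2 + 1))) else C.1, C.2 + 1)

theorem logicalEdge_iff {k : ℕ} [NeZero k] (C D : Committee k) :
    LogicalEdge C D ↔ ∃ b, D = next C b := by
  obtain ⟨r, c⟩ := C
  obtain ⟨r', c'⟩ := D
  simp only [LogicalEdge, next, Bool.exists_bool, Prod.mk.injEq]
  constructor
  · rintro ⟨rfl, h | h⟩
    · exact Or.inl ⟨by simpa using h, rfl⟩
    · refine Or.inr ⟨?_, rfl⟩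
      funext j
      by_cases hj : j = c + 1
      · have := (h j).2 hj
        subst hj
        simp only [if_true, Function.update_self]
        revert this
        cases r' (c + 1) <;> cases r (c + 1) <;> simp
      · have : ¬ (r' j ≠ r j) := fun h' => hj ((h j).1 h')
        simpa [Function.update_of_ne hj] using this
  · rintro (⟨h, rfl⟩ | ⟨h, rfl⟩)
    · exact ⟨rfl, Or.inl (by simpa using h)⟩
    · refine ⟨rfl, Or.inr fun j => ?_⟩
      subst h
      by_cases hj : j = c + 1
      · subst hj; simp
      · simp [hj]

/-- The number `N = k 2 ^ k` of committees for `k = 2 ^ m`. -/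
def numCommittees (m : ℕ) : ℕ := 2 ^ m * 2 ^ (2 ^ m)

theorem card_committee (m : ℕ) : Fintype.card (Committee (2 ^ m)) = numCommittees m := by
  simp [numCommittees, mul_comm]

/-! ### Tokens and the sampling procedure, for `k = 2 ^ m` columns -/

/-- Every committee generates `L` tokens; `(C, i)` is the `i`-th token of the committee `C`. -/
abbrev Token (m L : ℕ) : Type := Committee (2 ^ m) × Fin L

/-- The source committee of a token. -/
abbrev Token.src {m L : ℕ} (t : Token m L) : Committee (2 ^ m) := t.1

/-- The current destination of every token; `none` means that the token has been discarded. -/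
abbrev State (m L : ℕ) : Type := Token m L → Option (Committee (2 ^ m))

/-- The set `F` of the committee `C` in round `r`: the tokens that have not been discarded,
whose destination is `C` and whose random number is at least `r`. -/
def setF {m L : ℕ} (rand : Token m L → ℕ) (r : ℕ) (x : State m L) (C : Committee (2 ^ m)) :
    Finset (Token m L) :=
  Finset.univ.filter fun t => x t = some C ∧ r ≤ rand t

/-- The set `S` of the committee `C` in round `r`: the tokens that have not been discarded,
whose source is `C` and whose random number is `r - 1`. -/
def setS {m L : ℕ} (rand : Token m L → ℕ) (r : ℕ) (x : State m L) (C : Committee (2 ^ m)) :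
    Finset (Token m L) :=
  Finset.univ.filter fun t => x t ≠ none ∧ t.src = C ∧ rand t + 1 = r

/-- `M` matches elements of `F` with distinct elements of `S` (`M f = some s` means that `f` is
matched with `s`), and as many of them as possible. -/
def IsMaxMatching {α : Type*} [Fintype α] (F S : Finset α) (M : α → Option α) : Prop :=
  (∀ f s, M f = some s → f ∈ F ∧ s ∈ S) ∧
  (∀ f f' s, M f = some s → M f' = some s → f = f') ∧
  (Finset.univ.filter fun f => (M f).isSome).card = min F.card S.card

open Classical in
/-- The finite set of all maximum matchings between `F` and `S`. -/
noncomputable def maxMatchings {α : Type*} [Fintype α] (F S : Finset α) :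
    Finset (α → Option α) :=
  Finset.univ.filter fun M => IsMaxMatching F S M

theorem maxMatchings_nonempty {α : Type*} [Fintype α] (F S : Finset α) :
    (maxMatchings F S).Nonempty := by
  classical
  obtain ⟨F', hF, hFc⟩ := Finset.exists_subset_card_eq (min_le_left F.card S.card)
  obtain ⟨S', hS, hSc⟩ := Finset.exists_subset_card_eq (min_le_right F.card S.card)
  let e : F' ≃ S' := Finset.equivOfCardEq (hFc.trans hSc.symm)
  refine ⟨fun f => if h : f ∈ F' then some (e ⟨f, h⟩ : α) else none, ?_⟩
  simp only [maxMatchings, Finset.mem_filter, Finset.mem_univ, true_and]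
  refine ⟨?_, ?_, ?_⟩
  · intro f s h
    by_cases hf : f ∈ F'
    · simp only [hf, dite_true, Option.some.injEq] at h
      exact ⟨hF hf, h ▸ hS (e ⟨f, hf⟩).2⟩
    · simp [hf] at h
  · intro f f' s h h'
    by_cases hf : f ∈ F'
    · by_cases hf' : f' ∈ F'
      · simp only [hf, hf', dite_true, Option.some.injEq] at h h'
        have := e.injective (Subtype.ext (h.trans h'.symm))
        exact congrArg Subtype.val this
      · simp [hf'] at h'
    · simp [hf] at h
  · rw [← hFc]
    congr 1
    ext f
    by_cases hf : f ∈ F' <;> simp [hf]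

/-- The choices of all committees in round `r` of the loop: one maximum matching between its
sets `F` and `S` for each committee. -/
noncomputable def roundMatchings {m L : ℕ} (rand : Token m L → ℕ) (r : ℕ) (x : State m L) :
    Finset (Committee (2 ^ m) → Token m L → Option (Token m L)) :=
  Fintype.piFinset fun C => maxMatchings (setF rand r x C) (setS rand r x C)

/-- The tokens before round 1: each of them is at its source. -/
def initState (m L : ℕ) : State m L := fun t => some t.src

/-- Round 1: the destination of each token becomes one of the two neighbours of its source in
the next column, uniformly and independently at random. -/
noncomputable def firstRound (m L : ℕ) : PMF (State m L) :=
  (PMF.uniformOfFintype (Token m L → Bool)).map fun b t => some (next t.src (b t))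

/-- Round `r` of the loop: every committee matches its sets `F` and `S`, uniformly at random and
independently of the other committees; the destination of a matched `f ∈ F` becomes the
destination of its partner `s ∈ S`. All unmatched tokens of `F` and `S` and all tokens of `S`
are discarded. -/
noncomputable def loopRound {m L : ℕ} (rand : Token m L → ℕ) (r : ℕ) (x : State m L) :
    PMF (State m L) :=
  (PMF.uniformOfFinset (roundMatchings rand r x)
      (Fintype.piFinset_nonempty.2 fun _ => maxMatchings_nonempty _ _)).map
    fun M f => (x f).bind fun C => (M C f).bind x

/-- The last round: every surviving token moves to a uniformly and independently chosen
committee in the row of its destination. -/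
noncomputable def lastRound {m L : ℕ} (x : State m L) : PMF (State m L) :=
  (PMF.uniformOfFintype (Token m L → Fin (2 ^ m))).map
    fun c t => (x t).map fun C => (C.1, c t)

/-- The number of rounds: round 1, the rounds `2, …, 1 + log₂ k = 1 + m` of the loop, and the
last round, in which the columns are chosen. -/
def numRounds (m : ℕ) : ℕ := m + 2

/-- What happens in round `r`. -/
noncomputable def oneRound {m L : ℕ} (rand : Token m L → ℕ) (r : ℕ) (x : State m L) :
    PMF (State m L) :=
  if r = 1 then firstRound m L
  else if r ≤ m + 1 then loopRound rand r x
  else lastRound x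

/-- The law of the history of the tokens (a history maps `r` to the state after round `r`)
up to round `r`, given their random numbers. -/
noncomputable def runRounds {m L : ℕ} (rand : Token m L → ℕ) : ℕ → PMF (ℕ → State m L)
  | 0 => PMF.pure fun _ => initState m L
  | r + 1 => (runRounds rand r).bind fun h =>
      (oneRound rand (r + 1) (h r)).map fun x => Function.update h (r + 1) x

/-- An outcome of the procedure: the random numbers of the tokens, and the state `hist r` of the
tokens after each round `r ≤ numRounds m` (`hist 0` is the initial state). -/
structure Outcome (m L : ℕ) where
  rand : Token m L → ℕ
  hist : ℕ → State m L

/-- The sampling procedure: the random numbers are independent and geometric with parameter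
`1/2`; then all the rounds are executed. -/
noncomputable def sampling (m L : ℕ) : PMF (Outcome m L) :=
  (iidPMF (Token m L) geomHalf).bind fun rand =>
    (runRounds rand (numRounds m)).map fun h => ⟨rand, h⟩

/-- The final destination of a token, `none` if it has been discarded. -/
def Outcome.finalDst {m L : ℕ} (o : Outcome m L) (t : Token m L) : Option (Committee (2 ^ m)) :=
  o.hist (numRounds m) t

/-- The number of surviving tokens with source `C`. -/
def Outcome.numFrom {m L : ℕ} (o : Outcome m L) (C : Committee (2 ^ m)) : ℕ :=
  (Finset.univ.filter fun t : Token m L => o.finalDst t ≠ none ∧ t.src = C).card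

/-- The number of surviving tokens with final destination `C`. -/
def Outcome.numTo {m L : ℕ} (o : Outcome m L) (C : Committee (2 ^ m)) : ℕ :=
  (Finset.univ.filter fun t : Token m L => o.finalDst t = some C).card

/-! ### The network nodes and their messages -/

/-- The nodes, given by their unique IDs of `β` bits. -/
abbrev Node (β : ℕ) : Type := Fin (2 ^ β)

/-- `mem r C` is the set `CML_r(C)` of the members of the committee `C` in round `r`. The overlay
is robust up to round `T`: every committee has between `s₁ log n` and `s₂ log n` members, and in
any two consecutive rounds a common one; no node is in two committees at once. Apart from this
the members may change arbitrarily from round to round. -/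
structure Robust {k β : ℕ} (n : ℕ) (s₁ s₂ : ℝ) (T : ℕ) (mem : ℕ → Committee k → Finset (Node β)) :
    Prop where
  card_ge : ∀ r ≤ T, ∀ C, s₁ * Real.log n ≤ ((mem r C).card : ℝ)
  card_le : ∀ r ≤ T, ∀ C, ((mem r C).card : ℝ) ≤ s₂ * Real.log n
  overlap : ∀ r < T, ∀ C, (mem r C ∩ mem (r + 1) C).Nonempty
  disjoint : ∀ r ≤ T, ∀ C D, C ≠ D → Disjoint (mem r C) (mem r D)

/-- In round `r` the committee `C` handles the token `t`, and has to store the updated copy of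
`t` at the committee `D`: before the round `t` is at `C`, it survives the round, and `D` is the
source or the new destination of `t`. -/
def Outcome.Delivers {m L : ℕ} (o : Outcome m L) (r : ℕ) (C : Committee (2 ^ m)) (t : Token m L)
    (D : Committee (2 ^ m)) : Prop :=
  o.hist (r - 1) t = some C ∧ ∃ E, o.hist r t = some E ∧ (D = t.src ∨ D = E)

/-- The committees whose member lists are known to the members of `C` during round `r`: `C`, its
neighbours in the butterfly, the sources and destinations of all tokens that are stored at `C`
after round `r - 1` (those with source or destination `C`), and, in the last round, the
committees in the row of `C`. -/
def Outcome.Knows {m L : ℕ} (o : Outcome m L) (r : ℕ) (C D : Committee (2 ^ m)) : Prop :=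
  D = C ∨ LogicalEdge C D ∨ LogicalEdge D C ∨
  (∃ t E, o.hist (r - 1) t = some E ∧ (t.src = C ∨ E = C) ∧ (D = t.src ∨ D = E)) ∨
  (r = numRounds m ∧ D.1 = C.1)

/-- The message `⟨u, v, t, D⟩`: the node `u` sends a copy of the token `t` to the node `v`,
which `u` takes to be a member of the committee `D`. -/
abbrev Message (m L β : ℕ) : Type := Node β × Node β × Token m L × Committee (2 ^ m)

section Messages

variable {m L β : ℕ} (o : Outcome m L) (mem : ℕ → Committee (2 ^ m) → Finset (Node β))
  (view : ℕ → Node β → Committee (2 ^ m) → ℕ)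

/-- The list of the members of `D` that the node `u` uses in round `r`. It may be out of date:
it is the list of the members in the round `view r u D`. -/
def list (r : ℕ) (u : Node β) (D : Committee (2 ^ m)) : Finset (Node β) :=
  mem (view r u D) D

open Classical in
/-- The copies of tokens that are sent in round `r`: for each token `t` that a committee `C`
handles, every member of `C` sends the updated `t` to all nodes in its lists of the members of
the source and of the new destination of `t`. -/
noncomputable def copies (r : ℕ) : Finset (Message m L β) :=
  Finset.univ.filter fun ⟨u, v, t, D⟩ =>
    ∃ C, u ∈ mem r C ∧ o.Delivers r C t D ∧ v ∈ list mem view r u D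

/-- The copies `⟨u, v, t, D⟩` of round `r` to which `v` responds (second half of the handshake),
with a message from `v` to `u` that contains the current list of the members of `D`: those for
which `v` is indeed a member of `D`. -/
noncomputable def answered (r : ℕ) : Finset (Message m L β) :=
  (copies o mem view r).filter fun ⟨_, v, _, D⟩ => v ∈ mem r D

/-- The number of messages (copies and responses) that the node `u` sends in round `r`. -/
noncomputable def numSent (r : ℕ) (u : Node β) : ℕ :=
  ((copies o mem view r).filter fun x => x.1 = u).card +
  ((answered o mem view r).filter fun x => x.2.1 = u).card

/-- The number of messages (copies and responses) that are sent to the node `u` in round `r`. -/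
noncomputable def numReceived (r : ℕ) (u : Node β) : ℕ :=
  ((copies o mem view r).filter fun x => x.2.1 = u).card +
  ((answered o mem view r).filter fun x => x.1 = u).card

/-- The number of bits needed to write down a list of nodes together with the row and the column
of a committee. -/
def listBits (A : Finset (Node β)) : ℕ := (2 ^ m + m) + β * A.card

/-- The length of a copy of `t` sent by `u` in round `r`: the fields `src` and `dst` (addresses
and member lists of the committees), the field `rand`, and the index of `t` among the tokens with
the same source. -/
def copyBits (r : ℕ) (u : Node β) (t : Token m L) : ℕ :=
  listBits (m := m) (list mem view r u t.src) +
  (o.hist r t).elim 0 (fun E => listBits (m := m) (list mem view r u E)) +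
  (o.rand t).size + L.size

/-- The number of bits that `u` sends to `v` in round `r`. -/
noncomputable def numBits (r : ℕ) (u v : Node β) : ℕ :=
  (∑ x ∈ (copies o mem view r).filter (fun x => x.1 = u ∧ x.2.1 = v),
    copyBits o mem view r u x.2.2.1) +
  ∑ x ∈ (answered o mem view r).filter (fun x => x.2.1 = u ∧ x.1 = v),
    listBits (m := m) (mem r x.2.2.2)

/-- The execution respects the communication model with the bound `B`: in each round
* nodes send messages only to nodes whose IDs they know (or, for responses, from which they have
  just received a message);
* every node sends and receives at most `B` messages, hence communicates with at most `B` others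
  in each direction;
* at most `B` bits are sent from any node to any other node.
(No overlay edges are formed, so the limits on the degrees are not affected.) -/
structure Conforms (B : ℝ) : Prop where
  knows : ∀ r, 1 ≤ r → r ≤ numRounds m → ∀ C t D, o.Delivers r C t D → o.Knows r C D
  sent_le : ∀ r, 1 ≤ r → r ≤ numRounds m → ∀ u, (numSent o mem view r u : ℝ) ≤ B
  received_le : ∀ r, 1 ≤ r → r ≤ numRounds m → ∀ u, (numReceived o mem view r u : ℝ) ≤ B
  bits_le : ∀ r, 1 ≤ r → r ≤ numRounds m → ∀ u v, (numBits o mem view r u v : ℝ) ≤ B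

end Messages

end Spartan

/-!
The three assertions rest on different ideas.

*Conformity.* Given the random numbers of the tokens, the bounds on messages and bits hold for every
history that can occur. In a round of the loop, the tokens that end up with the destination `D`
inherit it from distinct tokens with that destination, so that the number of tokens with
destination `D` never exceeds its maximum `2 * L` after the first round; the last round only
redistributes tokens within a row, which costs a factor `2 ^ m` (`IsHistory.card_dst_le`). As a
node is in one committee per round, it sends at most two copies of each of these tokens to every
entry of a member list; the copies that it receives cost a further factor for the number of rounds,
because the lists may be out of date (`conforms_of_isHistory`). In the loop, the new destination of
a token is known from its partner in the matching (`knows_of_delivers`). Chance enters only through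
the bits needed to write down a random number; their number is `O(log n)` unless some random number
exceeds `n` (`exists_rand_gt_le`).

*Uniformity.* Relative to the column `γ` of the source of a token `t`, the surviving token has made
a walk of `2 ^ m` steps, one turn of the butterfly, and the bit `i` of its row has been decided in
exactly one of them. The shear flips the bit `i` in all columns behind this step, counted from `γ`.
It is an automorphism of one turn of the butterfly that exchanges the two edges at which the bit `i`
is decided. It is not an automorphism of the wrapped butterfly, but a token that starts in the
column `γ + j` and has walked `s` steps matters for `t` only if `j + s ≤ 2 ^ m`. So there is a
coupling of two copies of the procedure in which the second is the sheared image of the first as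
far as such tokens are concerned (`Sheared`, `Sheared.coupled_loopRound`), and in which the final
destinations of `t` differ exactly in the bit `i` (`coupled_finalLaw_row`). The last round makes the
column uniform (`coupled_finalLaw_column`), and these symmetries act transitively on the committees.

*Number of samples.* As the geometric law is memoryless, the comparison of the random numbers with
`r` can be decided by fresh fair coins just before round `r + 1`. This makes the truncated random
numbers and the state a Markov chain (`jointLaw_succ`). Suppose that after round `r` every committee
is the source, and the destination, of between `l` and `u` tokens. The coins split each of these
sets into two almost equal halves, so the sets that are matched next have sizes between about
`l / 2` and `u / 2`, and a token survives the matching with probability at least about `l / u`. A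
uniformly random maximum matching selects exchangeably from both of its sides, and sampling without
replacement has smaller exponential moments than independent sampling (`sum_pow_selected_le`). Hence
the numbers of surviving tokens are concentrated from below, while they are at most the sizes of the
halves from above (`jointStep_good`).

A round therefore halves `u`, squares the ratio `u / l`, and costs a factor `1 + O(ε)`, where `ε` is
the deviation allowed in the tail bounds. The error of round `r` is raised to the power
`2 ^ (m - r)` by the later rounds, so `ε` is taken proportional to `2 ^ (r - m) * (3 / 4) ^ r`
(`dev`); the total ratio then stays bounded (`logRatio_le`). The exponent `ε ^ 2 * L / 2 ^ r` of the
tail bounds is of the order `(L / 4 ^ m) * (9 / 8) ^ r`. Since `2 ^ m = O(log n)` and `L` is at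
least of the order `log n ^ 3`, this is a multiple of `log n`, by a factor that can be made as large
as desired (`exists_schedule`). The loop leaves of the order of `α * log n ^ 2` tokens per
committee, so a factor `log n` remains to absorb all constants.
-/

namespace Spartan

/-! ### Products of discrete laws -/

theorem tsum_fin_pi_prod {α : Type*} : ∀ (n : ℕ) (g : Fin n → α → ℝ≥0∞),
    ∑' f : Fin n → α, ∏ i, g i (f i) = ∏ i, ∑' a, g i a
  | 0, g => by simp [tsum_fintype]
  | n + 1, g => by
    rw [← (Fin.consEquiv fun _ => α).tsum_eq, ENNReal.tsum_prod']
    simp only [Fin.prod_univ_succ, Fin.consEquiv, Equiv.coe_fn_mk, Fin.cons_zero, Fin.cons_succ,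
      ENNReal.tsum_mul_left, ENNReal.tsum_mul_right]
    rw [tsum_fin_pi_prod n fun i => g i.succ]

theorem tsum_pi_prod {ι α : Type*} [Fintype ι] (g : ι → α → ℝ≥0∞) :
    ∑' f : ι → α, ∏ i, g i (f i) = ∏ i, ∑' a, g i a := by
  let e := Fintype.equivFin ι
  rw [← (Equiv.arrowCongr e.symm (Equiv.refl α)).tsum_eq,
    ← e.symm.prod_comp fun i => ∑' a, g i a, ← tsum_fin_pi_prod]
  refine tsum_congr fun f => ?_
  rw [← e.symm.prod_comp]
  simp [Equiv.arrowCongr]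

/-- The law of independent samples `f i ∼ p i`, one for each `i` in a finite type. -/
noncomputable def piPMF {ι α : Type*} [Fintype ι] (p : ι → PMF α) : PMF (ι → α) :=
  ⟨fun f => ∏ i, p i (f i), by
    have h : (∑' f : ι → α, ∏ i, p i (f i)) = 1 := by
      rw [tsum_pi_prod fun i a => p i a]
      simp [PMF.tsum_coe]
    exact h ▸ ENNReal.summable.hasSum⟩

section Pi

variable {ι α β : Type*} [Fintype ι]

theorem piPMF_apply (p : ι → PMF α) (f : ι → α) : piPMF p f = ∏ i, p i (f i) := rfl

theorem iidPMF_eq_piPMF (p : PMF ℕ) : iidPMF ι p = piPMF fun _ => p := rfl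

theorem tsum_piPMF_mul_prod (p : ι → PMF α) (g : ι → α → ℝ≥0∞) :
    ∑' f, piPMF p f * ∏ i, g i (f i) = ∏ i, ∑' a, p i a * g i a := by
  rw [← tsum_pi_prod]
  simp only [piPMF_apply, Finset.prod_mul_distrib]

theorem piPMF_bind (p : ι → PMF α) (q : ι → α → PMF β) :
    ((piPMF p).bind fun f => piPMF fun i => q i (f i)) = piPMF fun i => (p i).bind (q i) := by
  ext g
  simp only [PMF.bind_apply, piPMF_apply]
  rw [← tsum_pi_prod]
  simp only [Finset.prod_mul_distrib]

theorem piPMF_pure (a : ι → α) : (piPMF fun i => PMF.pure (a i)) = PMF.pure a := by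
  classical
  ext f
  simp only [piPMF_apply, PMF.pure_apply]
  rw [Finset.prod_ite_zero]
  simp [funext_iff]

theorem piPMF_map (p : ι → PMF α) (φ : ι → α → β) :
    ((piPMF p).map fun f i => φ i (f i)) = piPMF fun i => (p i).map (φ i) := by
  have := piPMF_bind p fun i a => PMF.pure (φ i a)
  simp only [piPMF_pure] at this
  exact this

theorem mem_support_piPMF (p : ι → PMF α) (f : ι → α) :
    f ∈ (piPMF p).support ↔ ∀ i, f i ∈ (p i).support := by
  simp [PMF.mem_support_iff, piPMF_apply, Finset.prod_eq_zero_iff]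

theorem uniformOfFinset_piFinset [DecidableEq ι] (A : ι → Finset α) (h : ∀ i, (A i).Nonempty) :
    PMF.uniformOfFinset (Fintype.piFinset A) (Fintype.piFinset_nonempty.2 h) =
      piPMF fun i => PMF.uniformOfFinset (A i) (h i) := by
  classical
  ext f
  simp only [piPMF_apply, PMF.uniformOfFinset_apply, Fintype.mem_piFinset, Finset.prod_ite_zero,
    Finset.mem_univ, true_imp_iff, Fintype.card_piFinset]
  split_ifs with hf
  · rw [Nat.cast_prod, ENNReal.prod_inv_distrib]
    intro i _ j _ _
    exact Or.inr (ENNReal.natCast_ne_top _)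
  · rfl

theorem uniformOfFintype_pi [DecidableEq ι] [Fintype α] [Nonempty α] :
    PMF.uniformOfFintype (ι → α) = piPMF fun _ : ι => PMF.uniformOfFintype α := by
  ext f
  simp only [piPMF_apply, PMF.uniformOfFintype_apply, Fintype.card_fun, Nat.cast_pow,
    Finset.prod_const, Finset.card_univ, ENNReal.inv_pow]

theorem piPMF_reindex {ι ι' α : Type*} [Fintype ι] [Fintype ι'] (e : ι ≃ ι') (q : ι' → PMF α) :
    ((piPMF fun i => q (e i)).map fun f i => f (e.symm i)) = piPMF q := by
  classical
  ext f
  rw [PMF.map_apply, tsum_eq_single fun i => f (e i)]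
  · simp only [Equiv.apply_symm_apply, if_true, piPMF_apply]
    exact e.prod_comp fun i => q i (f i)
  · intro g hg
    rw [if_neg]
    rintro rfl
    exact hg (by simp)

end Pi

/-! ### Couplings -/

/-- The laws `p` and `q` have a coupling that is supported on the relation `R`. -/
def Coupled {α β : Type*} (R : α → β → Prop) (p : PMF α) (q : PMF β) : Prop :=
  ∃ c : PMF (α × β), c.map Prod.fst = p ∧ c.map Prod.snd = q ∧ ∀ z ∈ c.support, R z.1 z.2

theorem bind_congr_support {α β : Type*} (p : PMF α) {f g : α → PMF β}
    (h : ∀ a ∈ p.support, f a = g a) : p.bind f = p.bind g := by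
  ext b
  simp only [PMF.bind_apply]
  refine tsum_congr fun a => ?_
  by_cases ha : a ∈ p.support
  · rw [h a ha]
  · simp [(PMF.apply_eq_zero_iff p a).2 ha]

namespace Coupled

variable {α β α' β' : Type*} {R : α → β → Prop} {R' : α' → β' → Prop} {p : PMF α} {q : PMF β}

theorem mono {Q : α → β → Prop} (h : Coupled R p q) (hRQ : ∀ a b, R a b → Q a b) :
    Coupled Q p q :=
  let ⟨c, h1, h2, h3⟩ := h
  ⟨c, h1, h2, fun z hz => hRQ _ _ (h3 z hz)⟩

theorem bind {f : α → PMF α'} {g : β → PMF β'} (h : Coupled R p q)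
    (hfg : ∀ a b, R a b → Coupled R' (f a) (g b)) : Coupled R' (p.bind f) (q.bind g) := by
  classical
  obtain ⟨c, rfl, rfl, h3⟩ := h
  choose d hd1 hd2 hd3 using hfg
  obtain ⟨z₀, hz₀⟩ := c.support_nonempty
  -- off the support of `c`, where `R` may fail, any of the chosen couplings serves as a filler
  refine ⟨c.bind fun z => if h : R z.1 z.2 then d z.1 z.2 h else d _ _ (h3 z₀ hz₀), ?_, ?_, ?_⟩
  · rw [PMF.map_bind, PMF.bind_map]
    refine bind_congr_support _ fun z hz => ?_
    simp [h3 z hz, hd1]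
  · rw [PMF.map_bind, PMF.bind_map]
    refine bind_congr_support _ fun z hz => ?_
    simp [h3 z hz, hd2]
  · intro z hz
    rw [PMF.mem_support_bind_iff] at hz
    obtain ⟨w, hw, hz⟩ := hz
    rw [dif_pos (h3 w hw)] at hz
    exact hd3 _ _ _ z hz

theorem pure {a : α} {b : β} (h : R a b) : Coupled R (PMF.pure a) (PMF.pure b) :=
  ⟨PMF.pure (a, b), by simp [PMF.pure_map], by simp [PMF.pure_map], by simpa using h⟩

theorem map {f : α → α'} {g : β → β'} (h : Coupled (fun a b => R' (f a) (g b)) p q) :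
    Coupled R' (p.map f) (q.map g) :=
  h.bind fun _ _ hab => Coupled.pure hab

theorem trivial (p : PMF α) (q : PMF β) : Coupled (fun _ _ => True) p q := by
  refine ⟨p.bind fun a => q.map fun b => (a, b), ?_, ?_, fun _ _ => True.intro⟩
  · simp [PMF.map_bind, PMF.map_comp, Function.comp_def]
    simp [PMF.map, Function.comp_def]
  · simp [PMF.map_bind, PMF.map_comp, Function.comp_def]
    exact PMF.map_id q

theorem of_equiv (e : α ≃ β) (h : ∀ a, q (e a) = p a) : Coupled (fun a b => b = e a) p q := by
  refine ⟨p.map fun a => (a, e a), ?_, ?_, ?_⟩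
  · rw [PMF.map_comp]
    exact PMF.map_id p
  · classical
    rw [PMF.map_comp]
    ext b
    rw [PMF.map_apply, tsum_eq_single (e.symm b)]
    · simp [← h]
    · intro a ha
      rw [if_neg]
      rintro rfl
      simp at ha
  · intro z hz
    simp only [PMF.support_map, Set.mem_image] at hz
    obtain ⟨a, -, rfl⟩ := hz
    rfl

theorem uniformOfFinset {s : Finset α} {t : Finset β} (hs : s.Nonempty) (ht : t.Nonempty)
    (e : α ≃ β) (h : ∀ a, e a ∈ t ↔ a ∈ s) :
    Coupled (fun a b => a ∈ s ∧ b = e a) (PMF.uniformOfFinset s hs) (PMF.uniformOfFinset t ht) := by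
  have hc : s.card = t.card := Finset.card_equiv e fun a => (h a).symm
  obtain ⟨c, h1, h2, h3⟩ := of_equiv (p := PMF.uniformOfFinset s hs)
    (q := PMF.uniformOfFinset t ht) e fun a => by
      classical simp [PMF.uniformOfFinset_apply, h, hc]
  refine ⟨c, h1, h2, fun z hz => ⟨?_, h3 z hz⟩⟩
  rw [← PMF.mem_support_uniformOfFinset_iff hs, ← h1, PMF.mem_support_map_iff]
  exact ⟨z, hz, rfl⟩

theorem uniformOfFintype [Fintype α] [Fintype β] [Nonempty α] [Nonempty β] (e : α ≃ β) :
    Coupled (fun a b => b = e a) (PMF.uniformOfFintype α) (PMF.uniformOfFintype β) :=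
  of_equiv e fun _ => by simp [Fintype.card_congr e]

theorem pi {ι : Type*} [Fintype ι] {R : ι → α → β → Prop} {p : ι → PMF α} {q : ι → PMF β}
    (h : ∀ i, Coupled (R i) (p i) (q i)) :
    Coupled (fun f g => ∀ i, R i (f i) (g i)) (piPMF p) (piPMF q) := by
  choose c h1 h2 h3 using h
  refine ⟨(piPMF c).map fun f => (fun i => (f i).1, fun i => (f i).2), ?_, ?_, ?_⟩
  · rw [PMF.map_comp]
    exact (piPMF_map c fun _ => Prod.fst).trans (by simp only [h1])
  · rw [PMF.map_comp]
    exact (piPMF_map c fun _ => Prod.snd).trans (by simp only [h2])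
  · intro z hz
    rw [PMF.mem_support_map_iff] at hz
    obtain ⟨f, hf, rfl⟩ := hz
    exact fun i => h3 i _ ((mem_support_piPMF c f).1 hf i)

theorem and_mem_support (h : Coupled R p q) :
    Coupled (fun a b => a ∈ p.support ∧ b ∈ q.support ∧ R a b) p q := by
  obtain ⟨c, h1, h2, h3⟩ := h
  refine ⟨c, h1, h2, fun z hz => ⟨?_, ?_, h3 z hz⟩⟩
  · rw [← h1, PMF.mem_support_map_iff]
    exact ⟨z, hz, rfl⟩
  · rw [← h2, PMF.mem_support_map_iff]
    exact ⟨z, hz, rfl⟩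

theorem pi_equiv {ι ι' : Type*} [Fintype ι] [Fintype ι'] (e : ι ≃ ι') {R : ι → α → β → Prop}
    {p : ι → PMF α} {q : ι' → PMF β} (h : ∀ i, Coupled (R i) (p i) (q (e i))) :
    Coupled (fun f g => ∀ i, R i (f i) (g (e i))) (piPMF p) (piPMF q) := by
  rw [← piPMF_reindex e q, ← PMF.map_id (piPMF p)]
  exact Coupled.map ((Coupled.pi h).mono fun f g hfg i => by simpa using hfg i)

theorem toOuterMeasure_eq {E : Set α} {E' : Set β} (h : Coupled R p q)
    (hE : ∀ a b, R a b → (a ∈ E ↔ b ∈ E')) : p.toOuterMeasure E = q.toOuterMeasure E' := by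
  obtain ⟨c, rfl, rfl, h3⟩ := h
  rw [PMF.toOuterMeasure_map_apply, PMF.toOuterMeasure_map_apply]
  refine PMF.toOuterMeasure_apply_eq_of_inter_support_eq _ ?_
  ext z
  simp only [Set.mem_inter_iff, Set.mem_preimage]
  exact ⟨fun ⟨h, hz⟩ => ⟨(hE _ _ (h3 z hz)).1 h, hz⟩, fun ⟨h, hz⟩ => ⟨(hE _ _ (h3 z hz)).2 h, hz⟩⟩

end Coupled

/-! ### Probabilities of events under a mixture -/

section Events

variable {α β : Type*}

theorem toOuterMeasure_le_one (p : PMF α) (E : Set α) : p.toOuterMeasure E ≤ 1 := by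
  rw [PMF.toOuterMeasure_apply, ← p.tsum_coe]
  exact ENNReal.tsum_le_tsum fun a => Set.indicator_le_self' (fun _ _ => zero_le) a

/-- An event is unlikely under a mixture if it is unlikely under the components in `G`, and if the
mixing law hardly ever leaves `G`. -/
theorem toOuterMeasure_bind_le (p : PMF α) (f : α → PMF β) (G : Set α) (E : Set β) {δ : ℝ≥0∞}
    (h : ∀ a ∈ G, (f a).toOuterMeasure E ≤ δ) :
    (p.bind f).toOuterMeasure E ≤ p.toOuterMeasure Gᶜ + δ := by
  classical
  rw [PMF.toOuterMeasure_bind_apply, PMF.toOuterMeasure_apply]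
  calc ∑' a, p a * (f a).toOuterMeasure E
      ≤ ∑' a, (Gᶜ.indicator p a + p a * δ) := by
        refine ENNReal.tsum_le_tsum fun a => ?_
        by_cases ha : a ∈ G
        · simpa [ha] using mul_le_mul_right (h a ha) (p a)
        · simp only [Set.mem_compl_iff, ha, not_false_eq_true, Set.indicator_of_mem]
          exact (mul_le_of_le_one_right zero_le (toOuterMeasure_le_one _ _)).trans
            le_self_add
    _ = _ := by rw [ENNReal.tsum_add, ENNReal.tsum_mul_right, PMF.tsum_coe, one_mul]

theorem one_sub_le_prob (p : PMF α) (E : Set α) {δ : ℝ} (hδ : 0 ≤ δ)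
    (h : p.toOuterMeasure Eᶜ ≤ ENNReal.ofReal δ) : 1 - δ ≤ prob p E := by
  have h1 : (1 : ℝ≥0∞) ≤ p.toOuterMeasure E + p.toOuterMeasure Eᶜ := by
    rw [← (PMF.toOuterMeasure_apply_eq_one_iff (p := p) (s := Set.univ)).2 (Set.subset_univ _),
      ← Set.union_compl_self E]
    exact MeasureTheory.measure_union_le _ _
  have ht : p.toOuterMeasure E ≠ ∞ := ne_top_of_le_ne_top ENNReal.one_ne_top
    (toOuterMeasure_le_one p E)
  have h2 := ENNReal.toReal_mono (ENNReal.add_ne_top.2 ⟨ht, ENNReal.ofReal_ne_top⟩)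
    (h1.trans (add_le_add_right h _))
  rw [ENNReal.toReal_add ht ENNReal.ofReal_ne_top, ENNReal.toReal_ofReal hδ] at h2
  simp only [ENNReal.toReal_one] at h2
  unfold prob
  linarith

theorem measure_exists_le {α ι : Type*} [Fintype ι] (p : PMF α) (P : ι → α → Prop) {δ : ℝ≥0∞}
    (h : ∀ i, p.toOuterMeasure {a | P i a} ≤ δ) :
    p.toOuterMeasure {a | ∃ i, P i a} ≤ Fintype.card ι * δ := by
  rw [Set.ofPred_exists]
  refine (MeasureTheory.measure_iUnion_fintype_le _ _).trans
    ((Finset.sum_le_sum fun i _ => h i).trans ?_)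
  simp

theorem toOuterMeasure_union_le {α : Type*} (p : PMF α) {E E₁ E₂ : Set α} (h : E ⊆ E₁ ∪ E₂)
    {δ₁ δ₂ : ℝ≥0∞} (h1 : p.toOuterMeasure E₁ ≤ δ₁) (h2 : p.toOuterMeasure E₂ ≤ δ₂) :
    p.toOuterMeasure E ≤ δ₁ + δ₂ :=
  (MeasureTheory.measure_mono h).trans
    ((MeasureTheory.measure_union_le _ _).trans (add_le_add h1 h2))

end Events

/-! ### Exponential moments and tail bounds -/

/-- The exponential moment at `s` of `X` under the law `p` is at most that of a Poisson variable
with mean `μ`. -/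
def SubPoisson {α : Type*} (s : ℝ) (p : PMF α) (X : α → ℝ) (μ : ℝ) : Prop :=
  ∑' a, p a * ENNReal.ofReal (Real.exp (s * X a)) ≤
    ENNReal.ofReal (Real.exp ((Real.exp s - 1) * μ))

theorem exp_neg_le_quadratic {x : ℝ} (hx : 0 ≤ x) : Real.exp (-x) ≤ 1 - x + x ^ 2 / 2 := by
  rw [Real.exp_neg]
  have h := Real.quadratic_le_exp_of_nonneg hx
  refine (inv_anti₀ (by positivity) h).trans ?_
  rw [inv_le_iff_one_le_mul₀ (by positivity)]
  nlinarith [sq_nonneg (x ^ 2)]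

namespace SubPoisson

variable {α : Type*} {s : ℝ} {p : PMF α} {X : α → ℝ} {μ : ℝ}

theorem pi {ι : Type*} [Fintype ι] {p : ι → PMF α} {X : ι → α → ℝ} {μ : ι → ℝ}
    (h : ∀ i, SubPoisson s (p i) (X i) (μ i)) :
    SubPoisson s (piPMF p) (fun f => ∑ i, X i (f i)) (∑ i, μ i) := by
  unfold SubPoisson
  simp only [Finset.mul_sum, Real.exp_sum]
  simp_rw [ENNReal.ofReal_prod_of_nonneg fun i _ => (Real.exp_pos _).le]
  rw [tsum_piPMF_mul_prod p fun i a => ENNReal.ofReal (Real.exp (s * X i a))]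
  exact Finset.prod_le_prod' fun i _ => h i

theorem zero : SubPoisson s p (fun _ => 0) 0 := by
  simp [SubPoisson]

theorem markov (h : SubPoisson s p X μ) (t : ℝ) :
    p.toOuterMeasure {a | t ≤ s * X a} ≤
      ENNReal.ofReal (Real.exp ((Real.exp s - 1) * μ - t)) := by
  have h1 : p.toOuterMeasure {a | t ≤ s * X a} ≤
      ENNReal.ofReal (Real.exp (-t)) * ∑' a, p a * ENNReal.ofReal (Real.exp (s * X a)) := by
    rw [PMF.toOuterMeasure_apply, ← ENNReal.tsum_mul_left]
    refine ENNReal.tsum_le_tsum fun a => ?_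
    refine Set.indicator_le' (f := p) (g := fun a =>
      ENNReal.ofReal (Real.exp (-t)) * (p a * ENNReal.ofReal (Real.exp (s * X a)))) ?_ ?_ a
    · intro a ha
      rw [mul_left_comm, ← ENNReal.ofReal_mul (Real.exp_pos _).le, ← Real.exp_add]
      refine le_mul_of_one_le_right' ?_
      rw [← ENNReal.ofReal_one]
      refine ENNReal.ofReal_le_ofReal (Real.one_le_exp ?_)
      have : t ≤ s * X a := ha
      linarith
    · exact fun _ _ => bot_le
  refine h1.trans ((mul_le_mul_right h _).trans ?_)
  rw [← ENNReal.ofReal_mul (Real.exp_pos _).le, ← Real.exp_add]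
  exact le_of_eq (by ring_nf)

theorem lower_tail {ε ν : ℝ} (h : SubPoisson (-ε) p X μ) (hε : 0 ≤ ε) (hν : 0 ≤ ν) (hμ : ν ≤ μ) :
    p.toOuterMeasure {a | X a < (1 - ε) * ν} ≤ ENNReal.ofReal (Real.exp (-(ε ^ 2 * ν / 2))) := by
  refine (MeasureTheory.measure_mono (t := {a | -ε * ((1 - ε) * ν) ≤ -ε * X a})
    fun a ha => ?_).trans ((h.markov _).trans (ENNReal.ofReal_le_ofReal (Real.exp_le_exp.2 ?_)))
  · have : X a < (1 - ε) * ν := ha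
    exact mul_le_mul_of_nonpos_left this.le (by linarith)
  · have h1 := exp_neg_le_quadratic hε
    have h2 : Real.exp (-ε) ≤ 1 := Real.exp_le_one_iff.2 (by linarith)
    nlinarith [mul_le_mul_of_nonneg_left hμ (by linarith : 0 ≤ 1 - Real.exp (-ε))]

/-- The parameter `ε / 2` of the exponential moment is not optimal, but needs only a quadratic bound
of the exponential function on `[0, 1]`. -/
theorem upper_tail {ε ν : ℝ} (h : SubPoisson (ε / 2) p X μ) (hε : 0 ≤ ε) (hε' : ε ≤ 2)
    (hν : 0 ≤ ν) (hμ : μ ≤ ν) :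
    p.toOuterMeasure {a | (1 + ε) * ν < X a} ≤ ENNReal.ofReal (Real.exp (-(ε ^ 2 * ν / 4))) := by
  refine (MeasureTheory.measure_mono (t := {a | ε / 2 * ((1 + ε) * ν) ≤ ε / 2 * X a})
    fun a ha => ?_).trans
    ((h.markov _).trans (ENNReal.ofReal_le_ofReal (Real.exp_le_exp.2 ?_)))
  · have : (1 + ε) * ν < X a := ha
    exact mul_le_mul_of_nonneg_left this.le (by linarith)
  · have h1 := (abs_le.1 (Real.abs_exp_sub_one_sub_id_le (x := ε / 2)
      (by rw [abs_of_nonneg] <;> linarith))).2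
    have h2 : 1 ≤ Real.exp (ε / 2) := Real.one_le_exp (by linarith)
    nlinarith [mul_le_mul_of_nonneg_left hμ (by linarith : 0 ≤ Real.exp (ε / 2) - 1)]

end SubPoisson

theorem subPoisson_uniform {Ω : Type*} [Fintype Ω] [DecidableEq Ω] [Nonempty Ω] (s : ℝ) (β : Ω) :
    SubPoisson s (PMF.uniformOfFintype Ω) (fun c => if c = β then 1 else 0)
      (1 / Fintype.card Ω) := by
  have hc : (0 : ℝ) < Fintype.card Ω := by exact_mod_cast Fintype.card_pos
  unfold SubPoisson
  rw [tsum_fintype]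
  have h1 : ∀ c : Ω, PMF.uniformOfFintype Ω c *
      ENNReal.ofReal (Real.exp (s * if c = β then 1 else 0)) =
      ENNReal.ofReal ((1 / Fintype.card Ω) * Real.exp (s * if c = β then 1 else 0)) := by
    intro c
    rw [ENNReal.ofReal_mul (by positivity), PMF.uniformOfFintype_apply, one_div,
      ENNReal.ofReal_inv_of_pos hc, ENNReal.ofReal_natCast]
  simp_rw [h1]
  rw [← ENNReal.ofReal_sum_of_nonneg fun _ _ => by positivity]
  refine ENNReal.ofReal_le_ofReal ?_
  rw [← Finset.mul_sum]
  have h2 : ∀ c : Ω, Real.exp (s * if c = β then 1 else 0) =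
      1 + if c = β then Real.exp s - 1 else 0 := by
    intro c
    split_ifs <;> simp
  simp_rw [h2]
  rw [Finset.sum_add_distrib]
  simp only [Finset.sum_const, Finset.card_univ, nsmul_eq_mul, mul_one, Finset.sum_ite_eq',
    Finset.mem_univ, if_true]
  have h3 := Real.add_one_le_exp ((Real.exp s - 1) * (1 / Fintype.card Ω))
  refine le_trans (le_of_eq ?_) h3
  field_simp
  ring

section Coins

variable {T Ω : Type*} [Fintype T] [DecidableEq T] [Fintype Ω] [Nonempty Ω] [DecidableEq Ω]

theorem subPoisson_coins (s : ℝ) (A : Finset T) (β : T → Ω) :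
    SubPoisson s (PMF.uniformOfFintype (T → Ω))
      (fun c => ((A.filter fun t => c t = β t).card : ℝ)) (A.card / Fintype.card Ω) := by
  classical
  rw [uniformOfFintype_pi]
  have h := SubPoisson.pi (s := s) (p := fun _ : T => PMF.uniformOfFintype Ω)
    (X := fun t c => if t ∈ A then (if c = β t then 1 else 0) else 0)
    (μ := fun t => if t ∈ A then 1 / (Fintype.card Ω : ℝ) else 0) fun t => by
      by_cases ht : t ∈ A
      · simpa only [ht, if_true] using subPoisson_uniform s (β t)
      · simpa only [ht, if_false] using SubPoisson.zero
  convert h using 1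
  · funext c
    rw [Finset.sum_ite_mem, Finset.univ_inter, Finset.sum_boole]
  · rw [Finset.sum_ite_mem, Finset.univ_inter, Finset.sum_const, nsmul_eq_mul]
    ring

theorem coins_lower_tail (A : Finset T) (β : T → Ω) {ε ν : ℝ} (hε : 0 ≤ ε) (hν : 0 ≤ ν)
    (h : ν * Fintype.card Ω ≤ A.card) :
    (PMF.uniformOfFintype (T → Ω)).toOuterMeasure
      {c | ((A.filter fun t => c t = β t).card : ℝ) < (1 - ε) * ν} ≤
      ENNReal.ofReal (Real.exp (-(ε ^ 2 * ν / 2))) := by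
  have hc : (0 : ℝ) < Fintype.card Ω := by exact_mod_cast Fintype.card_pos
  exact (subPoisson_coins (-ε) A β).lower_tail hε hν ((le_div_iff₀ hc).2 h)

theorem coins_upper_tail (A : Finset T) (β : T → Ω) {ε ν : ℝ} (hε : 0 ≤ ε) (hε' : ε ≤ 2)
    (hν : 0 ≤ ν) (h : (A.card : ℝ) ≤ ν * Fintype.card Ω) :
    (PMF.uniformOfFintype (T → Ω)).toOuterMeasure
      {c | (1 + ε) * ν < ((A.filter fun t => c t = β t).card : ℝ)} ≤
      ENNReal.ofReal (Real.exp (-(ε ^ 2 * ν / 4))) := by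
  have hc : (0 : ℝ) < Fintype.card Ω := by exact_mod_cast Fintype.card_pos
  exact (subPoisson_coins (ε / 2) A β).upper_tail hε hε' hν ((div_le_iff₀ hc).2 h)

end Coins

/-! ### Exchangeable selections and random maximum matchings -/

section Exchangeable

variable {Ω τ : Type*} [DecidableEq τ] {s : Finset Ω} {sel : Ω → Finset τ} {F : Finset τ} {κ : ℕ}

/-- For an exchangeable choice of `κ` elements of `F`, the events that the elements of `B` are not
chosen are negatively correlated: once `B` has been avoided, all other elements are equally likely
to be among the `κ` chosen ones, and there are at most `F.card` of them. -/
theorem card_avoid_le (hsub : ∀ M ∈ s, sel M ⊆ F) (hcard : ∀ M ∈ s, (sel M).card = κ)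
    (hsym : ∀ B : Finset τ, ∀ i ∈ F \ B, ∀ j ∈ F \ B,
      (s.filter fun M => Disjoint B (sel M) ∧ i ∈ sel M).card =
      (s.filter fun M => Disjoint B (sel M) ∧ j ∈ sel M).card)
    {q : ℝ} (hq0 : 0 ≤ q) (hq1 : q ≤ 1) (hq : q * F.card ≤ κ) (B : Finset τ) (hB : B ⊆ F) :
    ((s.filter fun M => Disjoint B (sel M)).card : ℝ) ≤ (1 - q) ^ B.card * s.card := by
  induction B using Finset.induction_on with
  | empty => simp
  | insert i B hi ih =>
    have hiF : i ∈ F \ B := Finset.mem_sdiff.2 ⟨hB (Finset.mem_insert_self _ _), hi⟩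
    have hBF : B ⊆ F := (Finset.subset_insert _ _).trans hB
    specialize ih hBF
    set N := s.filter fun M => Disjoint B (sel M) with hN
    set ni := s.filter fun M => Disjoint B (sel M) ∧ i ∈ sel M with hni
    have hsplit : (s.filter fun M => Disjoint (insert i B) (sel M)).card + ni.card = N.card := by
      rw [hN, ← Finset.card_filter_add_card_filter_not (s := s.filter fun M => Disjoint B (sel M))
        (fun M => i ∉ sel M), Finset.filter_filter, Finset.filter_filter]
      congr 2
      · ext M; simp [Finset.disjoint_insert_left]; tauto
      · ext M; simp [hni]
    have hdc : ∑ j ∈ F \ B, (s.filter fun M => Disjoint B (sel M) ∧ j ∈ sel M).card =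
        κ * N.card := by
      simp_rw [← Finset.filter_filter, Finset.card_filter (fun M => _ ∈ sel M)]
      rw [Finset.sum_comm, Finset.sum_const_nat (m := κ), mul_comm]
      intro M hM
      obtain ⟨hM, hd⟩ := Finset.mem_filter.1 hM
      rw [← Finset.card_filter, ← hcard M hM]
      congr 1
      ext j
      simp only [Finset.mem_filter, Finset.mem_sdiff]
      exact ⟨fun h => h.2, fun h => ⟨⟨hsub M hM h, Finset.disjoint_right.1 hd h⟩, h⟩⟩
    rw [Finset.sum_const_nat (m := ni.card) fun j hj => hsym B j hj i hiF] at hdc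
    have hpos : 0 < (F \ B).card := Finset.card_pos.2 ⟨i, hiF⟩
    have hle : (F \ B).card ≤ F.card := Finset.card_le_card Finset.sdiff_subset
    have h1 : q * N.card ≤ ni.card := by
      have hpos' : (0 : ℝ) < (F \ B).card := by exact_mod_cast hpos
      have hle' : ((F \ B).card : ℝ) ≤ F.card := by exact_mod_cast hle
      have hdc' : ((F \ B).card : ℝ) * ni.card = κ * N.card := by exact_mod_cast hdc
      have h2 : q * (F \ B).card ≤ κ := (mul_le_mul_of_nonneg_left hle' hq0).trans hq
      have h3 : q * (F \ B).card * N.card ≤ κ * N.card :=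
        mul_le_mul_of_nonneg_right h2 (Nat.cast_nonneg _)
      rw [← hdc'] at h3
      refine le_of_mul_le_mul_left ?_ hpos'
      linarith
    have hsplit' : ((s.filter fun M => Disjoint (insert i B) (sel M)).card : ℝ) + ni.card =
        N.card := by exact_mod_cast hsplit
    rw [Finset.card_insert_of_notMem hi, pow_succ]
    nlinarith [mul_le_mul_of_nonneg_left ih (by linarith : 0 ≤ 1 - q)]

/-- The exponential moments of sampling without replacement are at most those of sampling with
replacement. The power is expanded over the subsets of the elements of `A` that are not chosen,
so that all coefficients are nonnegative. -/
theorem sum_pow_selected_le (hsub : ∀ M ∈ s, sel M ⊆ F) (hcard : ∀ M ∈ s, (sel M).card = κ)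
    (hsym : ∀ B : Finset τ, ∀ i ∈ F \ B, ∀ j ∈ F \ B,
      (s.filter fun M => Disjoint B (sel M) ∧ i ∈ sel M).card =
      (s.filter fun M => Disjoint B (sel M) ∧ j ∈ sel M).card)
    {q : ℝ} (hq0 : 0 ≤ q) (hq1 : q ≤ 1) (hq : q * F.card ≤ κ) {A : Finset τ} (hA : A ⊆ F)
    {y : ℝ} (hy0 : 0 < y) (hy1 : y ≤ 1) :
    ∑ M ∈ s, y ^ (A ∩ sel M).card ≤ s.card * (1 - q + q * y) ^ A.card := by
  have hz : 0 ≤ y⁻¹ - 1 := sub_nonneg.2 ((one_le_inv₀ hy0).2 hy1)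
  have h1 : ∀ M ∈ s, y ^ (A ∩ sel M).card = y ^ A.card *
      ∑ B ∈ A.powerset, if Disjoint B (sel M) then (y⁻¹ - 1) ^ B.card else 0 := by
    intro M _
    have h2 : ∑ B ∈ A.powerset, (if Disjoint B (sel M) then (y⁻¹ - 1) ^ B.card else 0) =
        ∑ B ∈ (A \ sel M).powerset, (y⁻¹ - 1) ^ B.card * 1 ^ ((A \ sel M).card - B.card) := by
      rw [← Finset.sum_filter]
      refine Finset.sum_congr ?_ fun B _ => by simp
      ext B
      simp only [Finset.mem_filter, Finset.mem_powerset, Finset.subset_sdiff]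
    rw [h2, Finset.sum_pow_mul_eq_add_pow, sub_add_cancel,
      ← Finset.card_sdiff_add_card_inter A (sel M), pow_add, inv_pow, mul_right_comm,
      mul_inv_cancel₀ (pow_ne_zero _ hy0.ne'), one_mul]
  rw [Finset.sum_congr rfl h1, ← Finset.mul_sum, Finset.sum_comm]
  have h3 : ∑ B ∈ A.powerset, ∑ M ∈ s, (if Disjoint B (sel M) then (y⁻¹ - 1) ^ B.card else 0) ≤
      ∑ B ∈ A.powerset, s.card *
        (((y⁻¹ - 1) * (1 - q)) ^ B.card * 1 ^ (A.card - B.card)) := by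
    refine Finset.sum_le_sum fun B hB => ?_
    rw [← Finset.sum_filter, Finset.sum_const, nsmul_eq_mul]
    have h := card_avoid_le hsub hcard hsym hq0 hq1 hq B ((Finset.mem_powerset.1 hB).trans hA)
    refine (mul_le_mul_of_nonneg_right h (pow_nonneg hz _)).trans (le_of_eq ?_)
    rw [mul_pow, one_pow]
    ring
  rw [← Finset.mul_sum, Finset.sum_pow_mul_eq_add_pow] at h3
  refine (mul_le_mul_of_nonneg_left h3 (pow_nonneg hy0.le _)).trans (le_of_eq ?_)
  rw [mul_left_comm, ← mul_pow]
  congr 2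
  field_simp
  ring

theorem subPoisson_selected (hs : s.Nonempty) (hsub : ∀ M ∈ s, sel M ⊆ F)
    (hcard : ∀ M ∈ s, (sel M).card = κ)
    (hsym : ∀ B : Finset τ, ∀ i ∈ F \ B, ∀ j ∈ F \ B,
      (s.filter fun M => Disjoint B (sel M) ∧ i ∈ sel M).card =
      (s.filter fun M => Disjoint B (sel M) ∧ j ∈ sel M).card)
    {q : ℝ} (hq0 : 0 ≤ q) (hq1 : q ≤ 1) (hq : q * F.card ≤ κ) {A : Finset τ} (hA : A ⊆ F)
    {ε : ℝ} (hε : 0 ≤ ε) :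
    SubPoisson (-ε) (PMF.uniformOfFinset s hs) (fun M => ((A ∩ sel M).card : ℝ))
      (q * A.card) := by
  classical
  have hc : (0 : ℝ) < s.card := by exact_mod_cast Finset.card_pos.2 hs
  unfold SubPoisson
  rw [tsum_eq_sum (s := s) fun M hM => by simp [PMF.uniformOfFinset_apply, hM]]
  have h1 : ∀ M ∈ s, PMF.uniformOfFinset s hs M *
      ENNReal.ofReal (Real.exp (-ε * (A ∩ sel M).card)) =
      ENNReal.ofReal ((1 / s.card) * Real.exp (-ε) ^ (A ∩ sel M).card) := by
    intro M hM
    rw [ENNReal.ofReal_mul (by positivity), PMF.uniformOfFinset_apply, if_pos hM, one_div,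
      ENNReal.ofReal_inv_of_pos hc, ENNReal.ofReal_natCast, ← Real.exp_nat_mul, mul_comm (-ε)]
  rw [Finset.sum_congr rfl h1, ← ENNReal.ofReal_sum_of_nonneg fun _ _ => by positivity]
  refine ENNReal.ofReal_le_ofReal ?_
  have hy1 : Real.exp (-ε) ≤ 1 := Real.exp_le_one_iff.2 (by linarith)
  have h2 := sum_pow_selected_le hsub hcard hsym hq0 hq1 hq hA (Real.exp_pos (-ε)) hy1
  rw [← Finset.mul_sum, one_div, inv_mul_le_iff₀ hc]
  refine h2.trans (mul_le_mul_of_nonneg_left ?_ hc.le)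
  have h3 := Real.add_one_le_exp ((Real.exp (-ε) - 1) * q)
  have h4 : 0 ≤ 1 - q + q * Real.exp (-ε) := by
    have := mul_nonneg hq0 (Real.exp_pos (-ε)).le
    linarith
  calc (1 - q + q * Real.exp (-ε)) ^ A.card
      ≤ Real.exp ((Real.exp (-ε) - 1) * q) ^ A.card := pow_le_pow_left₀ h4 (by linarith) _
    _ = _ := by rw [← Real.exp_nat_mul]; ring_nf

end Exchangeable

section Matchings

variable {τ : Type*} [Fintype τ] {F S : Finset τ} {M : τ → Option τ}

theorem mem_maxMatchings : M ∈ maxMatchings F S ↔ IsMaxMatching F S M := by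
  simp [maxMatchings]

/-- The matched elements of `F`. -/
def matchedF (M : τ → Option τ) : Finset τ := Finset.univ.filter fun f => (M f).isSome

/-- The matched elements of `S`. -/
def matchedS [DecidableEq τ] (M : τ → Option τ) : Finset τ :=
  Finset.univ.filter fun s => ∃ f, M f = some s

theorem card_matchedS [DecidableEq τ] (h : IsMaxMatching F S M) :
    (matchedS M).card = min F.card S.card := by
  rw [← h.2.2]
  symm
  refine Finset.card_bij (fun f hf => (M f).get (Finset.mem_filter.1 hf).2) ?_ ?_ ?_
  · intro f hf
    exact Finset.mem_filter.2 ⟨Finset.mem_univ _, f, by simp⟩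
  · intro f hf f' hf' hff
    exact h.2.1 f f' ((M f).get (Finset.mem_filter.1 hf).2) (by simp) (by simp [hff])
  · intro s hs
    obtain ⟨f, hf⟩ := (Finset.mem_filter.1 hs).2
    exact ⟨f, by simp [hf], by simp [hf]⟩

/-- Conjugation of a partial map by a permutation maps maximum matchings to maximum matchings. -/
theorem IsMaxMatching.conj {τ' : Type*} [Fintype τ'] (e e' : τ ≃ τ')
    {F' S' : Finset τ'} (hF : ∀ f, e f ∈ F' ↔ f ∈ F) (hS : ∀ s, e' s ∈ S' ↔ s ∈ S)
    (h : IsMaxMatching F S M) : IsMaxMatching F' S' fun f => (M (e.symm f)).map e' := by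
  refine ⟨?_, ?_, ?_⟩
  · intro f s hfs
    obtain ⟨s', hs', rfl⟩ := Option.map_eq_some_iff.1 hfs
    have := h.1 _ _ hs'
    exact ⟨by simpa using (hF _).2 this.1, (hS _).2 this.2⟩
  · intro f f' s hf hf'
    obtain ⟨s', hs', rfl⟩ := Option.map_eq_some_iff.1 hf
    obtain ⟨s'', hs'', h2⟩ := Option.map_eq_some_iff.1 hf'
    obtain rfl := e'.injective h2
    exact e.symm.injective (h.2.1 _ _ _ hs' hs'')
  · rw [← Finset.card_equiv e fun f => (hF f).symm, ← Finset.card_equiv e' fun f => (hS f).symm,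
      ← h.2.2]
    exact (Finset.card_equiv e fun f => by simp).symm

theorem swap_mem_iff {τ : Type*} [DecidableEq τ] {F : Finset τ} {i j : τ} (hi : i ∈ F)
    (hj : j ∈ F) (f : τ) :
    Equiv.swap i j f ∈ F ↔ f ∈ F := by
  rcases eq_or_ne f i with rfl | h
  · simp [hi, hj]
  rcases eq_or_ne f j with rfl | h'
  · simp [hi, hj]
  · rw [Equiv.swap_apply_of_ne_of_ne h h']

/-- Transpositions of elements of `F` permute the maximum matchings, so the matched elements of `F`
are an exchangeable selection. -/
theorem subPoisson_matchedF [DecidableEq τ] {A : Finset τ} (hA : A ⊆ F) {q : ℝ}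
    (hq0 : 0 ≤ q) (hq1 : q ≤ 1) (hq : q * F.card ≤ (min F.card S.card : ℕ)) {ε : ℝ} (hε : 0 ≤ ε) :
    SubPoisson (-ε) (PMF.uniformOfFinset (maxMatchings F S) (maxMatchings_nonempty F S))
      (fun M => ((A ∩ matchedF M).card : ℝ)) (q * A.card) := by
  refine subPoisson_selected (F := F) (κ := min F.card S.card) _ ?_ ?_ ?_ hq0 hq1 hq hA hε
  · intro M hM f hf
    obtain ⟨s, hs⟩ := Option.isSome_iff_exists.1 (Finset.mem_filter.1 hf).2
    exact ((mem_maxMatchings.1 hM).1 f s hs).1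
  · exact fun M hM => (mem_maxMatchings.1 hM).2.2
  · intro B i hi j hj
    rw [Finset.mem_sdiff] at hi hj
    refine Finset.card_bij' (fun M _ f => M (Equiv.swap i j f)) (fun M _ f => M (Equiv.swap i j f))
      ?_ ?_ (by simp) (by simp)
    all_goals
      intro M hM
      simp only [Finset.mem_filter, mem_maxMatchings] at hM ⊢
      have hm := hM.1.conj (Equiv.swap i j) (Equiv.refl _) (swap_mem_iff hi.1 hj.1)
        fun _ => Iff.rfl
      refine ⟨by simpa using hm, ?_, ?_⟩
      · rw [Finset.disjoint_left]
        intro b hb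
        have h1 : b ≠ i := by rintro rfl; exact hi.2 hb
        have h2 : b ≠ j := by rintro rfl; exact hj.2 hb
        have := Finset.disjoint_left.1 hM.2.1 hb
        simpa [matchedF, Equiv.swap_apply_of_ne_of_ne h1 h2] using this
      · simpa [matchedF] using hM.2.2

/-- The counterpart of `subPoisson_matchedF` for the other side of the matching. -/
theorem subPoisson_matchedS [DecidableEq τ] {A : Finset τ} (hA : A ⊆ S) {q : ℝ}
    (hq0 : 0 ≤ q) (hq1 : q ≤ 1) (hq : q * S.card ≤ (min F.card S.card : ℕ)) {ε : ℝ} (hε : 0 ≤ ε) :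
    SubPoisson (-ε) (PMF.uniformOfFinset (maxMatchings F S) (maxMatchings_nonempty F S))
      (fun M => ((A ∩ matchedS M).card : ℝ)) (q * A.card) := by
  refine subPoisson_selected (F := S) (κ := min F.card S.card) _ ?_ ?_ ?_ hq0 hq1 hq hA hε
  · intro M hM s hs
    obtain ⟨f, hf⟩ := (Finset.mem_filter.1 hs).2
    exact ((mem_maxMatchings.1 hM).1 f s hf).2
  · exact fun M hM => card_matchedS (mem_maxMatchings.1 hM)
  · intro B i hi j hj
    rw [Finset.mem_sdiff] at hi hj
    have key : ∀ (M : τ → Option τ) (b : τ),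
        b ∈ matchedS (fun f => (M f).map (Equiv.swap i j)) ↔ Equiv.swap i j b ∈ matchedS M := by
      intro M b
      simp only [matchedS, Finset.mem_filter, Finset.mem_univ, true_and, Option.map_eq_some_iff]
      exact exists_congr fun f => ⟨fun ⟨a, ha, hb⟩ => by simp [ha, ← hb], fun h => ⟨_, h, by simp⟩⟩
    refine Finset.card_bij' (fun M _ f => (M f).map (Equiv.swap i j))
      (fun M _ f => (M f).map (Equiv.swap i j))
      ?_ ?_ (by simp [Function.comp_def]) (by simp [Function.comp_def])
    all_goals
      intro M hM
      simp only [Finset.mem_filter, mem_maxMatchings] at hM ⊢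
      have hm := hM.1.conj (Equiv.refl _) (Equiv.swap i j) (fun _ => Iff.rfl)
        (swap_mem_iff hi.1 hj.1)
      refine ⟨by simpa using hm, ?_, ?_⟩
      · rw [Finset.disjoint_left]
        intro b hb
        have h1 : b ≠ i := by rintro rfl; exact hi.2 hb
        have h2 : b ≠ j := by rintro rfl; exact hj.2 hb
        rw [key, Equiv.swap_apply_of_ne_of_ne h1 h2]
        exact Finset.disjoint_left.1 hM.2.1 hb
      · rw [key]
        simpa using hM.2.2

end Matchings

/-! ### The states and histories that can occur -/

section Histories

variable {m L : ℕ}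

/-- The outcome of a round of the loop, given the matchings that are chosen. -/
def applyMatchings (x : State m L) (M : Committee (2 ^ m) → Token m L → Option (Token m L)) :
    State m L :=
  fun f => (x f).bind fun C => (M C f).bind x

theorem mem_roundMatchings {rand : Token m L → ℕ} {r : ℕ} {x : State m L}
    {M : Committee (2 ^ m) → Token m L → Option (Token m L)} :
    M ∈ roundMatchings rand r x ↔
      ∀ C, IsMaxMatching (setF rand r x C) (setS rand r x C) (M C) := by
  simp [roundMatchings, mem_maxMatchings]

theorem loopRound_eq (rand : Token m L → ℕ) (r : ℕ) (x : State m L) :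
    loopRound rand r x =
      (piPMF fun C => PMF.uniformOfFinset (maxMatchings (setF rand r x C) (setS rand r x C))
        (maxMatchings_nonempty _ _)).map (applyMatchings x) :=
  congrArg (PMF.map (applyMatchings x)) (uniformOfFinset_piFinset _ _)

theorem mem_support_loopRound {rand : Token m L → ℕ} {r : ℕ} {x y : State m L} :
    y ∈ (loopRound rand r x).support ↔
      ∃ M ∈ roundMatchings rand r x, applyMatchings x M = y := by
  rw [loopRound_eq, PMF.mem_support_map_iff]
  simp only [mem_support_piPMF, PMF.mem_support_uniformOfFinset_iff, mem_roundMatchings,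
    mem_maxMatchings]

theorem mem_support_firstRound {y : State m L} (hy : y ∈ (firstRound m L).support) :
    ∃ b : Token m L → Bool, y = fun t => some (next t.src (b t)) := by
  simp only [firstRound, PMF.support_map, Set.mem_image] at hy
  obtain ⟨b, -, rfl⟩ := hy
  exact ⟨b, rfl⟩

theorem mem_support_lastRound {x y : State m L} (hy : y ∈ (lastRound x).support) :
    ∃ c : Token m L → Fin (2 ^ m), y = fun t => (x t).map fun C => (C.1, c t) := by
  simp only [lastRound, PMF.support_map, Set.mem_image] at hy
  obtain ⟨c, -, rfl⟩ := hy
  exact ⟨c, rfl⟩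

theorem mem_setF {rand : Token m L → ℕ} {r : ℕ} {x : State m L} {C : Committee (2 ^ m)}
    {t : Token m L} : t ∈ setF rand r x C ↔ x t = some C ∧ r ≤ rand t := by
  simp [setF]

theorem mem_setS {rand : Token m L → ℕ} {r : ℕ} {x : State m L} {C : Committee (2 ^ m)}
    {t : Token m L} : t ∈ setS rand r x C ↔ x t ≠ none ∧ t.src = C ∧ rand t + 1 = r := by
  simp [setS]

theorem applyMatchings_eq_some {x : State m L} {f : Token m L} {D : Committee (2 ^ m)}
    {M : Committee (2 ^ m) → Token m L → Option (Token m L)} :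
    applyMatchings x M f = some D ↔ ∃ C s, x f = some C ∧ M C f = some s ∧ x s = some D := by
  simp [applyMatchings, Option.bind_eq_some_iff]

theorem applyMatchings_ne_none {rand : Token m L → ℕ} {r : ℕ} {x : State m L} {f : Token m L}
    {M : Committee (2 ^ m) → Token m L → Option (Token m L)}
    (hM : M ∈ roundMatchings rand r x) :
    applyMatchings x M f ≠ none ↔ ∃ C s, x f = some C ∧ M C f = some s := by
  rw [Option.ne_none_iff_exists']
  simp only [applyMatchings_eq_some]
  constructor
  · rintro ⟨D, C, s, h1, h2, -⟩
    exact ⟨C, s, h1, h2⟩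
  · rintro ⟨C, s, h1, h2⟩
    obtain ⟨D, hD⟩ := Option.ne_none_iff_exists'.1
      (mem_setS.1 ((mem_roundMatchings.1 hM C).1 f s h2).2).1
    exact ⟨D, C, s, h1, h2, hD⟩

/-- `h` is a history that can occur in the rounds up to `R`. -/
structure IsHistory (rand : Token m L → ℕ) (R : ℕ) (h : ℕ → State m L) : Prop where
  init : h 0 = initState m L
  step : ∀ r < R, h (r + 1) ∈ (oneRound rand (r + 1) (h r)).support

theorem isHistory_of_mem_support {rand : Token m L → ℕ} : ∀ {R : ℕ} {h : ℕ → State m L},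
    h ∈ (runRounds rand R).support → IsHistory rand R h
  | 0, h, hh => by
    rw [runRounds, PMF.mem_support_pure_iff] at hh
    subst hh
    exact ⟨rfl, by simp⟩
  | R + 1, h, hh => by
    rw [runRounds, PMF.mem_support_bind_iff] at hh
    obtain ⟨h', hh', hx⟩ := hh
    rw [PMF.mem_support_map_iff] at hx
    obtain ⟨x, hx, rfl⟩ := hx
    have ih := isHistory_of_mem_support hh'
    refine ⟨by simpa using ih.init, fun r hr => ?_⟩
    rcases Nat.lt_succ_iff_lt_or_eq.1 hr with hr' | rfl
    · rw [Function.update_of_ne (by omega), Function.update_of_ne (by omega)]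
      exact ih.step r hr'
    · rw [Function.update_self, Function.update_of_ne (by omega)]
      exact hx

/-- The law of the state after round `r`, given the random numbers. -/
noncomputable def stateLaw (rand : Token m L → ℕ) : ℕ → PMF (State m L)
  | 0 => PMF.pure (initState m L)
  | r + 1 => (stateLaw rand r).bind (oneRound rand (r + 1))

theorem runRounds_map (rand : Token m L → ℕ) :
    ∀ r, ((runRounds rand r).map fun h => h r) = stateLaw rand r
  | 0 => by rw [runRounds, PMF.pure_map, stateLaw]
  | r + 1 => by
    rw [runRounds, stateLaw, ← runRounds_map rand r, PMF.map_bind, PMF.bind_map]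
    congr 1
    funext h
    rw [PMF.map_comp]
    simp [Function.comp_def]
    exact PMF.map_id _

theorem sampling_map_final (m L : ℕ) :
    ((sampling m L).map fun o => o.hist (numRounds m)) =
      (iidPMF (Token m L) geomHalf).bind fun rand => stateLaw rand (numRounds m) := by
  rw [sampling, PMF.map_bind]
  congr 1
  funext rand
  rw [PMF.map_comp, ← runRounds_map]
  rfl

theorem oneRound_one (rand : Token m L → ℕ) (x : State m L) :
    oneRound rand 1 x = firstRound m L := by
  simp [oneRound]

theorem oneRound_loop (rand : Token m L → ℕ) {r : ℕ} (h1 : 1 ≤ r) (h2 : r ≤ m) (x : State m L) :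
    oneRound rand (r + 1) x = loopRound rand (r + 1) x := by
  rw [oneRound, if_neg (by omega), if_pos (by omega)]

theorem oneRound_last (rand : Token m L → ℕ) (x : State m L) :
    oneRound rand (m + 2) x = lastRound x := by
  rw [oneRound, if_neg (by omega), if_neg (by omega)]

/-- In every round of the loop, the tokens with destination `D` inherit it from distinct tokens
with the same destination. -/
theorem card_dst_applyMatchings_le {rand : Token m L → ℕ} {r : ℕ} {x : State m L}
    {M : Committee (2 ^ m) → Token m L → Option (Token m L)}
    (hM : M ∈ roundMatchings rand r x) (D : Committee (2 ^ m)) :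
    (Finset.univ.filter fun t => applyMatchings x M t = some D).card ≤
      (Finset.univ.filter fun t => x t = some D ∧ rand t + 1 = r).card := by
  classical
  have key : ∀ f, applyMatchings x M f = some D → ∃ s, ∃ C, x f = some C ∧ M C f = some s ∧
      x s = some D := by
    intro f hf
    obtain ⟨C, s, h⟩ := applyMatchings_eq_some.1 hf
    exact ⟨s, C, h⟩
  choose! g hg using key
  have hs : ∀ f C, M C f = some (g f) → (g f).src = C ∧ rand (g f) + 1 = r := fun f C h =>
    (mem_setS.1 ((mem_roundMatchings.1 hM C).1 f _ h).2).2
  refine Finset.card_le_card_of_injOn g ?_ ?_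
  · intro f hf
    obtain ⟨C, -, h2, h3⟩ := hg f (by simpa using hf)
    simp [h3, (hs f C h2).2]
  · intro f hf f' hf' hff
    obtain ⟨C, -, h2, h3⟩ := hg f (by simpa using hf)
    obtain ⟨C', -, h2', h3'⟩ := hg f' (by simpa using hf')
    have hC := (hs f C h2).1
    have hC' := (hs f' C' h2').1
    rw [hff] at hC
    obtain rfl := hC.symm.trans hC'
    exact (mem_roundMatchings.1 hM _).2.1 f f' (g f) h2 (hff ▸ h2')

theorem card_src (C : Committee (2 ^ m)) :
    (Finset.univ.filter fun t : Token m L => t.src = C).card = L := by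
  rw [show (Finset.univ.filter fun t : Token m L => t.src = C) = {C} ×ˢ Finset.univ by
    ext ⟨D, i⟩; simp [Token.src, eq_comm]]
  simp

/-- The other endpoint of the edge into `D` that is labelled by `b`. -/
def prev {k : ℕ} [NeZero k] (D : Committee k) (b : Bool) : Committee k :=
  (if b then Function.update D.1 D.2 (!(D.1 D.2)) else D.1, D.2 - 1)

theorem next_eq_iff {k : ℕ} [NeZero k] (C D : Committee k) (b : Bool) :
    next C b = D ↔ C = prev D b := by
  obtain ⟨r, c⟩ := C
  obtain ⟨r', c'⟩ := D
  cases b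
  · simp only [next, prev, Bool.false_eq_true, if_false, Prod.mk.injEq, eq_sub_iff_add_eq]
  · simp only [next, prev, if_true, Prod.mk.injEq, eq_sub_iff_add_eq]
    constructor
    · rintro ⟨rfl, rfl⟩
      simp
    · rintro ⟨rfl, rfl⟩
      simp

theorem prev_injective {k : ℕ} [NeZero k] (D : Committee k) {b b' : Bool}
    (h : prev D b = prev D b') : b = b' := by
  have := congrFun (congrArg Prod.fst h) D.2
  cases b <;> cases b' <;> simp_all [prev]

open Classical in
/-- The tokens whose source is a neighbour of `D` in the preceding column. -/
noncomputable def tokensInto (L : ℕ) (D : Committee (2 ^ m)) : Finset (Token m L) :=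
  Finset.univ.filter fun t => ∃ b, t.src = prev D b

theorem card_tokensInto (D : Committee (2 ^ m)) : (tokensInto L D).card = 2 * L := by
  classical
  have : tokensInto L D = (Finset.univ.image (prev D)) ×ˢ Finset.univ := by
    ext ⟨C, i⟩
    simp only [tokensInto, Finset.mem_filter, Finset.mem_univ, true_and, Finset.mem_product,
      Finset.mem_image, and_true, Token.src]
    exact exists_congr fun b => eq_comm
  rw [this, Finset.card_product, Finset.card_image_of_injective _ fun b b' => prev_injective D]
  simp

theorem IsHistory.card_dst_le_of_le {rand : Token m L → ℕ} {h : ℕ → State m L}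
    (hh : IsHistory rand (numRounds m) h) :
    ∀ r, r ≤ m → ∀ D, (Finset.univ.filter fun t => h (r + 1) t = some D).card ≤ 2 * L
  | 0, _, D => by
    have h1 := hh.step 0 (by simp [numRounds])
    rw [oneRound_one] at h1
    obtain ⟨b, hb⟩ := mem_support_firstRound h1
    rw [← card_tokensInto D, hb]
    refine Finset.card_le_card fun t ht => ?_
    simp only [Finset.mem_filter, Finset.mem_univ, true_and, Option.some.injEq,
      next_eq_iff] at ht
    simp only [tokensInto, Finset.mem_filter, Finset.mem_univ, true_and]
    exact ⟨_, ht⟩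
  | r + 1, hr, D => by
    have h1 := hh.step (r + 1) (by simp only [numRounds]; omega)
    rw [oneRound_loop _ (by omega) hr] at h1
    obtain ⟨M, hM, h2⟩ := mem_support_loopRound.1 h1
    rw [← h2]
    refine (card_dst_applyMatchings_le hM D).trans
      (le_trans (Finset.card_le_card fun t ht => ?_) (hh.card_dst_le_of_le r (by omega) D))
    simp only [Finset.mem_filter, Finset.mem_univ, true_and] at ht ⊢
    exact ht.1

/-- The factor `2 ^ m` is the number of columns among which the last round redistributes the
tokens. -/
theorem IsHistory.card_dst_le {rand : Token m L → ℕ} {h : ℕ → State m L}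
    (hh : IsHistory rand (numRounds m) h) {r : ℕ} (hr : r ≤ numRounds m) (D : Committee (2 ^ m)) :
    (Finset.univ.filter fun t => h r t = some D).card ≤ 2 ^ m * (2 * L) := by
  classical
  have hk : 1 ≤ 2 ^ m := Nat.one_le_two_pow
  rcases r with _ | r
  · rw [hh.init]
    simp only [initState, Option.some.injEq]
    rw [card_src]
    nlinarith
  rcases Nat.lt_or_ge m r with hmr | hrm
  · obtain rfl : r = m + 1 := by simp only [numRounds] at hr; omega
    have h1 := hh.step (m + 1) (by simp [numRounds])
    rw [oneRound_last] at h1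
    obtain ⟨c, hc⟩ := mem_support_lastRound h1
    have h2 : (Finset.univ.filter fun t => h (m + 1 + 1) t = some D) ⊆
        (Finset.univ : Finset (Fin (2 ^ m))).biUnion fun γ =>
          Finset.univ.filter fun t => h (m + 1) t = some (D.1, γ) := by
      intro t ht
      rw [hc] at ht
      simp only [Finset.mem_filter, Finset.mem_univ, true_and, Option.map_eq_some_iff] at ht
      obtain ⟨C, hC, rfl⟩ := ht
      simp only [Finset.mem_biUnion, Finset.mem_univ, true_and, Finset.mem_filter]
      exact ⟨C.2, hC⟩
    refine (Finset.card_le_card h2).trans ((Finset.card_biUnion_le_card_mul _ _ (2 * L)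
      fun γ _ => hh.card_dst_le_of_le m le_rfl _).trans (by simp))
  · refine (hh.card_dst_le_of_le r hrm D).trans ?_
    nlinarith

end Histories

/-! ### Messages -/

section Conformity

variable {m L β : ℕ} {o : Outcome m L} {mem : ℕ → Committee (2 ^ m) → Finset (Node β)}
  {view : ℕ → Node β → Committee (2 ^ m) → ℕ}

theorem mem_copies {r : ℕ} {x : Message m L β} :
    x ∈ copies o mem view r ↔ ∃ C, x.1 ∈ mem r C ∧ o.Delivers r C x.2.2.1 x.2.2.2 ∧
      x.2.1 ∈ list mem view r x.1 x.2.2.2 := by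
  simp [copies]

theorem mem_answered {r : ℕ} {x : Message m L β} :
    x ∈ answered o mem view r ↔ x ∈ copies o mem view r ∧ x.2.1 ∈ mem r x.2.2.2 := by
  simp [answered]

/-- In a round of the loop, the new destination of a token is that of its partner in the matching,
which is stored at its source, the committee that performs the matching. -/
theorem knows_of_delivers (hh : IsHistory o.rand (numRounds m) o.hist) {r : ℕ} (hr1 : 1 ≤ r)
    (hr : r ≤ numRounds m) {C : Committee (2 ^ m)} {t : Token m L} {D : Committee (2 ^ m)}
    (hd : o.Delivers r C t D) : o.Knows r C D := by
  obtain ⟨hC, E, hE, rfl | rfl⟩ := hd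
  · exact Or.inr (Or.inr (Or.inr (Or.inl ⟨t, C, hC, Or.inr rfl, Or.inl rfl⟩)))
  obtain ⟨r, rfl⟩ := Nat.exists_eq_succ_of_ne_zero (by omega : r ≠ 0)
  simp only [Nat.succ_eq_add_one, Nat.add_sub_cancel] at hC hE hr ⊢
  have h1 := hh.step r (by omega)
  rcases Nat.eq_zero_or_pos r with rfl | hr0
  · rw [oneRound_one] at h1
    obtain ⟨b, hb⟩ := mem_support_firstRound h1
    rw [hh.init] at hC
    rw [hb] at hE
    simp only [initState, Option.some.injEq] at hC hE
    exact Or.inr (Or.inl ((logicalEdge_iff _ _).2 ⟨b t, by rw [← hE, hC]⟩))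
  rcases Nat.lt_or_ge m r with hmr | hrm
  · obtain rfl : r = m + 1 := by simp only [numRounds] at hr; omega
    rw [oneRound_last] at h1
    obtain ⟨c, hc⟩ := mem_support_lastRound h1
    rw [hc] at hE
    simp only [hC, Option.map_some, Option.some.injEq] at hE
    exact Or.inr (Or.inr (Or.inr (Or.inr ⟨rfl, by rw [← hE]⟩)))
  · rw [oneRound_loop _ hr0 hrm] at h1
    obtain ⟨M, hM, h2⟩ := mem_support_loopRound.1 h1
    rw [← h2] at hE
    obtain ⟨C', s, h3, h4, h5⟩ := applyMatchings_eq_some.1 hE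
    obtain rfl : C = C' := Option.some.inj (hC.symm.trans h3)
    have h6 := (mem_setS.1 ((mem_roundMatchings.1 hM C).1 t s h4).2).2.1
    exact Or.inr (Or.inr (Or.inr (Or.inl ⟨s, D, h5, Or.inl h6, Or.inr rfl⟩)))

variable (hh : IsHistory o.rand (numRounds m) o.hist)
  (hdisj : ∀ r ≤ numRounds m, ∀ C D, C ≠ D → Disjoint (mem r C) (mem r D))
  (hview : ∀ r u D, view r u D ≤ r) {Z : ℕ} (hZ : ∀ r ≤ numRounds m, ∀ C, (mem r C).card ≤ Z)
  {r : ℕ} (hr : r ≤ numRounds m)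

include hh hdisj hview hZ hr in
/-- The node `u` is in one committee, which handles the tokens that are there before the round; each
of them is sent to two lists of members. -/
theorem card_copies_from_le (u : Node β) :
    ((copies o mem view r).filter fun x => x.1 = u).card ≤ 2 ^ m * (2 * L) * (2 * Z) := by
  classical
  by_cases hu : ∃ C, u ∈ mem r C
  · obtain ⟨C, hC⟩ := hu
    have hsub : ((copies o mem view r).filter fun x => x.1 = u) ⊆
        (Finset.univ.filter fun t => o.hist (r - 1) t = some C).biUnion fun t =>
          ({t.src} ∪ (o.hist r t).toFinset).biUnion fun D =>
            (list mem view r u D).image fun v => (u, v, t, D) := by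
      rintro ⟨u', v, t, D⟩ hx
      rw [Finset.mem_filter, mem_copies] at hx
      obtain ⟨⟨C', hC', ⟨h1, E, hE, hD⟩, hv⟩, hu'⟩ := hx
      simp only at hu' hC' h1 hE hD hv
      subst hu'
      obtain rfl : C' = C := by
        by_contra hne
        exact Finset.disjoint_left.1 (hdisj r hr C' C hne) hC' hC
      simp only [Finset.mem_biUnion, Finset.mem_filter, Finset.mem_univ, true_and,
        Finset.mem_image]
      refine ⟨t, h1, D, ?_, v, hv, rfl⟩
      rcases hD with rfl | rfl <;> simp [hE]
    refine (Finset.card_le_card hsub).trans ((Finset.card_biUnion_le_card_mul _ _ (2 * Z)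
      fun t _ => ?_).trans (Nat.mul_le_mul_right _ (hh.card_dst_le (by omega) C)))
    refine (Finset.card_biUnion_le_card_mul _ _ Z fun D _ => ?_).trans
      (Nat.mul_le_mul_right _ ?_)
    · exact Finset.card_image_le.trans (hZ _ ((hview r u D).trans hr) D)
    · refine (Finset.card_union_le _ _).trans ?_
      cases o.hist r t <;> simp
  · rw [Finset.filter_eq_empty_iff.2]
    · simp
    · rintro x hx rfl
      obtain ⟨C, hC, -⟩ := mem_copies.1 hx
      exact hu ⟨C, hC⟩

include hh hZ hr in
/-- A copy that is addressed to a member of `D` concerns a token with source or new destination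
`D`, and it is sent by the members of the committee where this token has been. -/
theorem card_copies_to_le (u : Node β) (𝒟 : Finset (Committee (2 ^ m)))
    (X : Finset (Message m L β)) (hX : X ⊆ copies o mem view r)
    (hX' : ∀ x ∈ X, x.2.1 = u ∧ x.2.2.2 ∈ 𝒟) :
    X.card ≤ 𝒟.card * (2 * (2 ^ m * (2 * L)) * Z) := by
  classical
  have hsub : X ⊆ 𝒟.biUnion fun D =>
      (Finset.univ.filter fun t : Token m L => t.src = D ∨ o.hist r t = some D).biUnion fun t =>
        ((o.hist (r - 1) t).elim ∅ (mem r)).image fun v => (v, u, t, D) := by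
    rintro ⟨v, u', t, D⟩ hx
    obtain ⟨hu, hD𝒟⟩ := hX' _ hx
    obtain ⟨C, hC, ⟨h1, E, hE, hD⟩, -⟩ := mem_copies.1 (hX hx)
    simp only at hu hD𝒟 hC h1 hE hD
    subst hu
    simp only [Finset.mem_biUnion, Finset.mem_filter, Finset.mem_univ, true_and,
      Finset.mem_image]
    refine ⟨D, hD𝒟, t, ?_, v, by simpa [h1] using hC, rfl⟩
    rcases hD with rfl | rfl <;> simp [hE]
  refine (Finset.card_le_card hsub).trans (Finset.card_biUnion_le_card_mul _ _ _ fun D _ => ?_)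
  refine (Finset.card_biUnion_le_card_mul _ _ Z fun t _ => Finset.card_image_le.trans ?_).trans
    (Nat.mul_le_mul_right _ ?_)
  · cases o.hist (r - 1) t with
    | none => simp
    | some C => exact hZ r hr C
  · rw [Finset.filter_or]
    refine (Finset.card_union_le _ _).trans ?_
    have h1 := hh.card_dst_le hr D
    rw [card_src]
    have : 1 ≤ 2 ^ m := Nat.one_le_two_pow
    nlinarith

include hdisj hr in
theorem card_committees_le_one (u : Node β) :
    (Finset.univ.filter fun D => u ∈ mem r D).card ≤ 1 := by
  refine Finset.card_le_one.2 fun C hC D hD => ?_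
  by_contra hne
  simp only [Finset.mem_filter, Finset.mem_univ, true_and] at hC hD
  exact Finset.disjoint_left.1 (hdisj r hr C D hne) hC hD

include hh hdisj hZ hr in
theorem card_answered_by_le (u : Node β) :
    ((answered o mem view r).filter fun x => x.2.1 = u).card ≤
      2 * (2 ^ m * (2 * L)) * Z := by
  refine (card_copies_to_le (view := view) hh hZ hr u
    (Finset.univ.filter fun D => u ∈ mem r D) _ ?_ ?_).trans
    ((Nat.mul_le_mul_right _ (card_committees_le_one hdisj hr u)).trans (by simp))
  · intro x hx
    rw [Finset.mem_filter, mem_answered] at hx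
    exact hx.1.1
  · intro x hx
    rw [Finset.mem_filter, mem_answered] at hx
    refine ⟨hx.2, ?_⟩
    rw [Finset.mem_filter, ← hx.2]
    exact ⟨Finset.mem_univ _, hx.1.2⟩

include hh hdisj hview hZ hr in
/-- As the lists may be out of date, `u` may be addressed as a member of all the committees that it
has been in so far, one in each round. -/
theorem card_copies_received_le (u : Node β) :
    ((copies o mem view r).filter fun x => x.2.1 = u).card ≤
      (numRounds m + 1) * (2 * (2 ^ m * (2 * L)) * Z) := by
  classical
  refine (card_copies_to_le hh hZ hr u ((Finset.range (numRounds m + 1)).biUnion fun r' =>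
    Finset.univ.filter fun D => u ∈ mem r' D) _ (Finset.filter_subset _ _) ?_).trans
    (Nat.mul_le_mul_right _ ((Finset.card_biUnion_le_card_mul _ _ 1 fun r' hr' =>
      card_committees_le_one hdisj (Nat.lt_succ_iff.1 (Finset.mem_range.1 hr')) u).trans
      (by simp)))
  intro x hx
  rw [Finset.mem_filter, mem_copies] at hx
  obtain ⟨⟨C, -, -, hv⟩, hu⟩ := hx
  rw [hu] at hv
  refine ⟨hu, ?_⟩
  simp only [Finset.mem_biUnion, Finset.mem_range, Finset.mem_filter, Finset.mem_univ, true_and]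
  exact ⟨_, Nat.lt_succ_iff.2 ((hview _ _ _).trans hr), hv⟩

omit hr in
include hh hdisj hview hZ in
/-- Deterministic bounds: at most `W = 2 ^ m * (2 * L)` tokens have the same destination, at most
`Z` nodes are in the same committee, and the random numbers have at most `R` bits. -/
theorem conforms_of_isHistory {R : ℕ} (hR : ∀ t, (o.rand t).size ≤ R) :
    Conforms o mem view
      ((4 * (m + 4) * (2 ^ m * (2 * L) * Z) +
        2 * (2 ^ m * (2 * L) * Z) * (3 * (2 ^ m + m + β * Z) + R + L) : ℕ) : ℝ) := by
  classical
  have hsub : ∀ r u, ((answered o mem view r).filter fun x => x.1 = u) ⊆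
      (copies o mem view r).filter fun x => x.1 = u := fun r u x hx => by
    rw [Finset.mem_filter, mem_answered] at hx
    rw [Finset.mem_filter]
    exact ⟨hx.1.1, hx.2⟩
  set W := 2 ^ m * (2 * L) with hW
  refine ⟨fun r h1 hr C t D hd => knows_of_delivers hh h1 hr hd, fun r h1 hr u => ?_,
    fun r h1 hr u => ?_, fun r h1 hr u v => ?_⟩
  · have h2 := card_copies_from_le hh hdisj hview hZ hr u
    have h3 := card_answered_by_le (view := view) hh hdisj hZ hr u
    rw [← hW] at h2 h3
    refine Nat.cast_le.2 (le_trans (add_le_add h2 h3) (le_trans ?_ (Nat.le_add_right _ _)))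
    nlinarith [Nat.zero_le (m * (W * Z)), Nat.zero_le (W * Z)]
  · have h2 := card_copies_received_le hh hdisj hview hZ hr u
    have h3 := (Finset.card_le_card (hsub r u)).trans (card_copies_from_le hh hdisj hview hZ hr u)
    rw [← hW] at h2 h3
    refine Nat.cast_le.2 (le_trans (add_le_add h2 h3) (le_trans ?_ (Nat.le_add_right _ _)))
    simp only [numRounds]
    nlinarith [Nat.zero_le (m * (W * Z)), Nat.zero_le (W * Z)]
  · refine Nat.cast_le.2 (le_trans ?_ (Nat.le_add_left _ _))
    have hlist : ∀ A : Finset (Node β), A.card ≤ Z → listBits (m := m) A ≤ 2 ^ m + m + β * Z :=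
      fun A hA => by
        have := Nat.mul_le_mul_left β hA
        unfold listBits
        omega
    have hL : L.size ≤ L := Nat.size_le.2 Nat.lt_two_pow_self
    have hcopy : ∀ t, copyBits o mem view r u t ≤ 2 * (2 ^ m + m + β * Z) + R + L := by
      intro t
      have h2 := hlist (list mem view r u t.src) (hZ _ ((hview r u _).trans hr) _)
      have h3 := hR t
      have h4 : (o.hist r t).elim 0 (fun E => listBits (m := m) (list mem view r u E)) ≤
          2 ^ m + m + β * Z := by
        cases o.hist r t with
        | none => simp
        | some E => exact hlist _ (hZ _ ((hview r u _).trans hr) _)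
      unfold copyBits
      omega
    have h5 : (∑ x ∈ (copies o mem view r).filter (fun x => x.1 = u ∧ x.2.1 = v),
        copyBits o mem view r u x.2.2.1) ≤
        W * (2 * Z) * (2 * (2 ^ m + m + β * Z) + R + L) := by
      refine (Finset.sum_le_card_nsmul _ _ _ fun x _ => hcopy _).trans ?_
      rw [smul_eq_mul]
      refine Nat.mul_le_mul_right _ (le_trans (Finset.card_le_card ?_)
        (card_copies_from_le hh hdisj hview hZ hr u))
      exact Finset.monotone_filter_right _ fun x _ hx => hx.1
    have h6 : (∑ x ∈ (answered o mem view r).filter (fun x => x.2.1 = u ∧ x.1 = v),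
        listBits (m := m) (mem r x.2.2.2)) ≤ 2 * W * Z * (2 ^ m + m + β * Z) := by
      refine (Finset.sum_le_card_nsmul _ _ _ fun x _ => hlist _ (hZ r hr _)).trans ?_
      rw [smul_eq_mul]
      refine Nat.mul_le_mul_right _ (le_trans (Finset.card_le_card ?_)
        (card_answered_by_le (view := view) hh hdisj hZ hr u))
      exact Finset.monotone_filter_right _ fun x _ hx => hx.1
    refine (add_le_add h5 h6).trans (le_of_eq ?_)
    ring

end Conformity

/-! ### The random numbers -/

theorem geomHalf_apply (j : ℕ) : geomHalf j = if j = 0 then 0 else (2⁻¹ : ℝ≥0∞) ^ j := rfl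

theorem geomHalf_tail (j : ℕ) : geomHalf.toOuterMeasure {i | j < i} = (2⁻¹ : ℝ≥0∞) ^ j := by
  induction j with
  | zero =>
    rw [pow_zero, PMF.toOuterMeasure_apply_eq_one_iff]
    intro i hi
    rw [PMF.mem_support_iff, geomHalf_apply] at hi
    by_contra h
    obtain rfl : i = 0 := by simpa using h
    simp at hi
  | succ j ih =>
    have h1 : geomHalf.toOuterMeasure {i | j < i} =
        geomHalf.toOuterMeasure {j + 1} + geomHalf.toOuterMeasure {i | j + 1 < i} := by
      rw [PMF.toOuterMeasure_apply, PMF.toOuterMeasure_apply, PMF.toOuterMeasure_apply,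
        ← ENNReal.tsum_add]
      refine tsum_congr fun i => ?_
      rcases lt_trichotomy i (j + 1) with h | rfl | h
      · simp [Set.indicator, h.ne, show ¬ j < i by omega, show ¬ j + 1 < i by omega]
      · simp [Set.indicator]
      · simp [Set.indicator, h.ne', show j < i by omega, h]
    rw [ih, PMF.toOuterMeasure_apply_singleton, geomHalf_apply, if_neg (Nat.succ_ne_zero j)] at h1
    have h2 : (2⁻¹ : ℝ≥0∞) ^ j = 2⁻¹ ^ (j + 1) + 2⁻¹ ^ (j + 1) := by
      rw [pow_succ, ← mul_add, ENNReal.inv_two_add_inv_two, mul_one]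
    rw [h2] at h1
    exact ((ENNReal.add_right_inj (ENNReal.pow_ne_top (by simp))).1 h1).symm

/-- The coordinates of `piPMF p` have the laws `p i`. -/
theorem piPMF_marginal {ι α : Type*} [Fintype ι] [DecidableEq ι] (p : ι → PMF α) (i : ι)
    (E : Set α) : (piPMF p).toOuterMeasure {f | f i ∈ E} = (p i).toOuterMeasure E := by
  classical
  have h := tsum_piPMF_mul_prod p fun j a => if j = i then E.indicator 1 a else 1
  rw [PMF.toOuterMeasure_apply, PMF.toOuterMeasure_apply]
  have h1 : ∀ j, (∑' a, p j a * if j = i then E.indicator 1 a else 1) =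
      if j = i then ∑' a, E.indicator (p i) a else 1 := by
    intro j
    by_cases hj : j = i
    · subst hj
      simp only [if_true]
      exact tsum_congr fun a => by by_cases ha : a ∈ E <;> simp [ha]
    · simp [hj, PMF.tsum_coe]
  simp only [h1, Finset.prod_ite_eq', Finset.mem_univ, if_true] at h
  rw [← h]
  exact tsum_congr fun f => by by_cases hf : f i ∈ E <;> simp [hf]

theorem exists_rand_gt_le (ι : Type*) [Fintype ι] (j : ℕ) :
    (iidPMF ι geomHalf).toOuterMeasure {f | ∃ i, j < f i} ≤
      Fintype.card ι * (2⁻¹ : ℝ≥0∞) ^ j := by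
  classical
  rw [Set.ofPred_exists]
  refine (MeasureTheory.measure_iUnion_fintype_le _ _).trans ?_
  rw [iidPMF_eq_piPMF]
  refine (Finset.sum_le_sum fun i _ =>
    ((piPMF_marginal (fun _ => geomHalf) i {x | j < x}).trans (geomHalf_tail j)).le).trans ?_
  simp

/-! ### Growth estimates -/

section Growth

open Filter

theorem eventually_le_log (B : ℝ) : ∀ᶠ n : ℕ in atTop, B ≤ Real.log n :=
  (Real.tendsto_log_atTop.comp tendsto_natCast_atTop_atTop).eventually_ge_atTop B

theorem natCast_pos_of_one_le_log {n : ℕ} (h : 1 ≤ Real.log n) : (0 : ℝ) < n := by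
  rcases Nat.eq_zero_or_pos n with rfl | h'
  · norm_num at h
  · exact_mod_cast h'

theorem numCommittees_le {c₂ : ℝ} {n m : ℕ} (h1 : 1 ≤ Real.log n) (h2 : c₂ ≤ Real.log n)
    (h : (numCommittees m : ℝ) ≤ c₂ * (n / Real.log n)) : (numCommittees m : ℝ) ≤ n := by
  have hn := natCast_pos_of_one_le_log h1
  have hl : 0 < Real.log n := by linarith
  refine h.trans ?_
  rw [mul_div_assoc', div_le_iff₀ hl, mul_comm]
  exact mul_le_mul_of_nonneg_left h2 hn.le

theorem two_pow_le_two_mul_log {n m : ℕ} (h1 : 1 ≤ Real.log n)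
    (h : (numCommittees m : ℝ) ≤ n) : (2 : ℝ) ^ m ≤ 2 * Real.log n := by
  have hn := natCast_pos_of_one_le_log h1
  have h2 : (2 : ℝ) ^ (2 ^ m) ≤ n := by
    refine le_trans ?_ h
    rw [numCommittees]
    push_cast
    exact le_mul_of_one_le_left (by positivity) (one_le_pow₀ (by norm_num))
  have h3 := Real.log_le_log (by positivity) h2
  rw [Real.log_pow] at h3
  push_cast at h3
  nlinarith [Real.log_two_gt_d9, pow_pos (two_pos : (0 : ℝ) < 2) m]

theorem eventually_rpow_le_two_pow (a : ℝ) : ∀ᶠ n : ℕ in atTop, (n : ℝ) ^ a ≤ 2 ^ n := by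
  have h1 := (Real.isLittleO_log_id_atTop.comp_tendsto
    (tendsto_natCast_atTop_atTop (R := ℝ))).def (c := (2 * (|a| + 1))⁻¹) (by positivity)
  filter_upwards [h1, eventually_le_log 1] with n hn hl
  have hn0 := natCast_pos_of_one_le_log hl
  simp only [Function.comp_apply, id, Real.norm_eq_abs, abs_of_pos hn0,
    abs_of_pos (by linarith : 0 < Real.log n)] at hn
  have h2 : Real.log n * (2 * (|a| + 1)) ≤ n := by
    rwa [inv_mul_eq_div, le_div_iff₀ (by positivity)] at hn
  rw [Real.rpow_def_of_pos hn0, ← Real.exp_log (two_pos : (0 : ℝ) < 2), ← Real.exp_nat_mul]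
  refine Real.exp_le_exp.2 ?_
  have h3 : Real.log n * a ≤ Real.log n * (|a| + 1) :=
    mul_le_mul_of_nonneg_left ((le_abs_self a).trans (by linarith)) (by linarith)
  nlinarith [Real.log_two_gt_d9]

theorem numRounds_le {n m : ℕ} (h1 : 1 ≤ Real.log (Real.log n)) (hl : 0 < Real.log n)
    (h : (2 : ℝ) ^ m ≤ 2 * Real.log n) : (numRounds m : ℝ) ≤ 5 * Real.log (Real.log n) := by
  have h2 := Real.log_le_log (by positivity) h
  rw [Real.log_pow, Real.log_mul two_ne_zero hl.ne'] at h2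
  have h3 := Real.log_two_gt_d9
  have h4 : ((m : ℝ) - 1) * Real.log 2 ≤ Real.log (Real.log n) := by linarith
  have h5 : (m : ℝ) - 1 ≤ 2 * Real.log (Real.log n) := by
    by_contra hc
    push Not at hc
    nlinarith
  simp only [numRounds]
  push_cast
  linarith

/-- The bound of `conforms_of_isHistory` is polylogarithmic. -/
theorem conformity_bound_le {m L β Z R q : ℕ} {a s b l : ℝ} (hl : 1 ≤ l)
    (ha : 0 < a) (hs : 0 < s) (hb : 0 < b) (hm : (2 : ℝ) ^ m ≤ 2 * l)
    (hL : (L : ℝ) ≤ a * l ^ (q + 3)) (hZ : (Z : ℝ) ≤ s * l) (hβ : (β : ℝ) ≤ b * l)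
    (hR : (R : ℝ) ≤ 3 * l) :
    ((4 * (m + 4) * (2 ^ m * (2 * L) * Z) +
      2 * (2 ^ m * (2 * L) * Z) * (3 * (2 ^ m + m + β * Z) + R + L) : ℕ) : ℝ) ≤
    (96 * a * s + 8 * a * s * (15 + 3 * b * s + a)) * l ^ (2 * q + 8) := by
  have hl0 : 0 < l := by linarith
  have hm' : (m : ℝ) ≤ 2 * l := by
    refine le_trans ?_ hm
    exact_mod_cast Nat.lt_two_pow_self.le
  push_cast
  have hW : (2 : ℝ) ^ m * (2 * L) * Z ≤ 4 * a * s * l ^ (q + 5) := by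
    calc (2 : ℝ) ^ m * (2 * L) * Z ≤ (2 * l) * (2 * (a * l ^ (q + 3))) * (s * l) := by gcongr
      _ = _ := by ring
  have h1 : 4 * ((m : ℝ) + 4) ≤ 24 * l := by linarith
  have hp : ∀ j : ℕ, 1 ≤ l ^ j := fun j => one_le_pow₀ hl
  have hl2 : l ≤ l ^ (q + 3) := le_self_pow₀ hl (by omega)
  have hl3 : l ^ 2 ≤ l ^ (q + 3) := pow_le_pow_right₀ hl (by omega)
  have hl4 : l ^ (q + 6) ≤ l ^ (2 * q + 8) := pow_le_pow_right₀ hl (by omega)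
  have h2 : 3 * ((2 : ℝ) ^ m + m + β * Z) + R + L ≤ (15 + 3 * b * s + a) * l ^ (q + 3) := by
    have h3 : (β : ℝ) * Z ≤ b * s * l ^ (q + 3) := by
      calc (β : ℝ) * Z ≤ (b * l) * (s * l) := by gcongr
        _ = b * s * l ^ 2 := by ring
        _ ≤ _ := by gcongr
    nlinarith
  calc 4 * ((m : ℝ) + 4) * (2 ^ m * (2 * L) * Z) +
        2 * (2 ^ m * (2 * L) * Z) * (3 * (2 ^ m + m + β * Z) + R + L)
      ≤ 24 * l * (4 * a * s * l ^ (q + 5)) +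
        2 * (4 * a * s * l ^ (q + 5)) * ((15 + 3 * b * s + a) * l ^ (q + 3)) := by gcongr
    _ = 96 * a * s * l ^ (q + 6) + 8 * a * s * (15 + 3 * b * s + a) * l ^ (2 * q + 8) := by ring
    _ ≤ 96 * a * s * l ^ (2 * q + 8) + 8 * a * s * (15 + 3 * b * s + a) * l ^ (2 * q + 8) := by
        gcongr
    _ = _ := by ring

theorem size_le_three_mul_log {n j : ℕ} (h1 : 1 ≤ Real.log n) (hj : j ≤ n) :
    (j.size : ℝ) ≤ 3 * Real.log n := by
  rcases Nat.eq_zero_or_pos j.size with h0 | h0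
  · rw [h0]
    push_cast
    linarith
  have h2 : 2 ^ (j.size - 1) ≤ j := Nat.lt_size.1 (by omega)
  have h3 : (2 : ℝ) ^ (j.size - 1) ≤ n := by exact_mod_cast h2.trans hj
  have h4 := Real.log_le_log (by positivity) h3
  rw [Real.log_pow, Nat.cast_sub h0] at h4
  push_cast at h4
  have h5 := Real.log_two_gt_d9
  have h6 : (j.size : ℝ) - 1 ≤ 2 * Real.log n := by
    by_contra hc
    push Not at hc
    nlinarith
  linarith

end Growth

/-! ### Conformity to the model -/

section Conformity

open Filter

/-- The bounds of `conforms_of_isHistory` hold unless one of the random numbers exceeds `n`. -/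
theorem prob_conforms_ge {m L β n : ℕ} {s₁ s₂ B : ℝ} {R : ℕ} (hR : ∀ j ≤ n, j.size ≤ R)
    (hB : ((4 * (m + 4) * (2 ^ m * (2 * L) * ⌊s₂ * Real.log n⌋₊) +
        2 * (2 ^ m * (2 * L) * ⌊s₂ * Real.log n⌋₊) *
          (3 * (2 ^ m + m + β * ⌊s₂ * Real.log n⌋₊) + R + L) : ℕ) : ℝ) ≤ B) {δ : ℝ} (hδ : 0 ≤ δ)
    (h : (numCommittees m * L : ℝ) ≤ δ * 2 ^ n) :
    1 - δ ≤ prob (sampling m L)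
      {o | ∀ (mem : ℕ → Committee (2 ^ m) → Finset (Node β))
          (view : ℕ → Node β → Committee (2 ^ m) → ℕ),
        Robust n s₁ s₂ (numRounds m) mem → (∀ r u D, view r u D ≤ r) →
        Conforms o mem view B} := by
  refine one_sub_le_prob _ _ hδ ?_
  refine (toOuterMeasure_bind_le _ _ {rand | ∀ t, rand t ≤ n} _ (δ := 0) ?_).trans ?_
  · intro rand hrand
    refine le_of_eq ((PMF.toOuterMeasure_apply_eq_zero_iff _ _).2 ?_)
    rw [Set.disjoint_left]
    intro o ho
    rw [PMF.mem_support_map_iff] at ho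
    obtain ⟨hist, hhist, rfl⟩ := ho
    simp only [Set.mem_compl_iff, not_not]
    intro mem view hrob hview
    have hc := conforms_of_isHistory (o := ⟨rand, hist⟩) (mem := mem) (view := view)
      (isHistory_of_mem_support hhist) hrob.disjoint hview (Z := ⌊s₂ * Real.log n⌋₊)
      (fun r hr C => Nat.le_floor (hrob.card_le r hr C)) (R := R) (fun t => hR _ (hrand t))
    exact ⟨hc.knows, fun r h1 hr u => (hc.sent_le r h1 hr u).trans hB,
      fun r h1 hr u => (hc.received_le r h1 hr u).trans hB,
      fun r h1 hr u v => (hc.bits_le r h1 hr u v).trans hB⟩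
  · have h1 : ({rand | ∀ t, rand t ≤ n} : Set (Token m L → ℕ))ᶜ = {rand | ∃ t, n < rand t} := by
      ext rand
      simp
    rw [add_zero, h1]
    refine (exists_rand_gt_le _ n).trans ?_
    have h2 : (Fintype.card (Token m L) : ℝ≥0∞) * 2⁻¹ ^ n =
        ENNReal.ofReal (numCommittees m * L * (2⁻¹ : ℝ) ^ n) := by
      rw [ENNReal.ofReal_mul (by positivity), ENNReal.ofReal_pow (by norm_num),
        ENNReal.ofReal_inv_of_pos two_pos, ENNReal.ofReal_ofNat, ← Nat.cast_mul,
        ENNReal.ofReal_natCast, Fintype.card_prod, card_committee, Fintype.card_fin]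
    rw [h2]
    refine ENNReal.ofReal_le_ofReal ?_
    rwa [inv_pow, ← div_eq_mul_inv, div_le_iff₀ (by positivity)]

theorem conformity (c₁ c₂ a₁ a₂ α₀ p₀ s₁ s₂ b₀ : ℝ) (q : ℕ)
    (ha₂ : 0 < a₂) (hp₀ : 0 < p₀) (hs₂ : 0 < s₂) (hb₀ : 0 < b₀) :
    ∃ K : ℝ, ∃ d : ℕ, 0 < K ∧ ∀ c : ℝ, 0 < c → ∃ n₀ : ℕ, ∀ n : ℕ, n₀ ≤ n →
      ∀ (m L β : ℕ) (α : ℝ),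
        c₁ * (n / Real.log n) ≤ (numCommittees m : ℝ) →
        (numCommittees m : ℝ) ≤ c₂ * (n / Real.log n) →
        α₀ ≤ α → α ≤ p₀ * Real.log n ^ q →
        a₁ * (α * Real.log n ^ 3) ≤ L → L ≤ a₂ * (α * Real.log n ^ 3) →
        (β : ℝ) ≤ b₀ * Real.log n →
        (numRounds m : ℝ) ≤ K * Real.log (Real.log n) ∧
        1 - (n : ℝ) ^ (-c) ≤ prob (sampling m L)
          {o | ∀ (mem : ℕ → Committee (2 ^ m) → Finset (Node β))
              (view : ℕ → Node β → Committee (2 ^ m) → ℕ),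
            Robust n s₁ s₂ (numRounds m) mem →
            (∀ r u D, view r u D ≤ r) →
            Conforms o mem view (K * Real.log n ^ d)} := by
  -- `L` is at most `a * log n ^ (q + 3)`
  set a := a₂ * p₀ with ha
  have ha0 : 0 < a := by positivity
  set K₀ := 96 * a * s₂ + 8 * a * s₂ * (15 + 3 * b₀ * s₂ + a) with hK₀
  have hK₀pos : 0 < K₀ := by positivity
  refine ⟨5 + K₀, 2 * q + 8, by positivity, fun c hc => ?_⟩
  have hloglog : ∀ᶠ n : ℕ in atTop, 1 ≤ Real.log (Real.log n) :=
    (Real.tendsto_log_atTop.comp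
      (Real.tendsto_log_atTop.comp tendsto_natCast_atTop_atTop)).eventually_ge_atTop 1
  obtain ⟨n₀, hn₀⟩ := eventually_atTop.1 ((eventually_le_log 1).and ((eventually_le_log c₂).and
    ((eventually_le_log a).and (hloglog.and (eventually_rpow_le_two_pow (q + 5 + c))))))
  refine ⟨n₀, fun n hn m L β α _ hN hα hαq _ hL hβ => ?_⟩
  obtain ⟨hl1, hlc, hla, hll, hpow⟩ := hn₀ n hn
  have hn0 := natCast_pos_of_one_le_log hl1
  have hl0 : 0 < Real.log n := by linarith
  have hNn := numCommittees_le hl1 hlc hN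
  have hk := two_pow_le_two_mul_log hl1 hNn
  have hL' : (L : ℝ) ≤ a * Real.log n ^ (q + 3) := by
    calc (L : ℝ) ≤ a₂ * (α * Real.log n ^ 3) := hL
      _ ≤ a₂ * (p₀ * Real.log n ^ q * Real.log n ^ 3) := by gcongr
      _ = _ := by rw [ha]; ring
  refine ⟨(numRounds_le hll hl0 hk).trans
    (mul_le_mul_of_nonneg_right (by linarith) (by linarith)), ?_⟩
  refine prob_conforms_ge (R := ⌊3 * Real.log n⌋₊)
    (fun j hj => Nat.le_floor (size_le_three_mul_log hl1 hj)) ?_ (by positivity) ?_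
  · refine (conformity_bound_le hl1 ha0 hs₂ hb₀ hk hL'
      (Nat.floor_le (by positivity)) hβ (Nat.floor_le (by positivity))).trans
      (mul_le_mul_of_nonneg_right (by linarith) (by positivity))
  · have hln : Real.log n ≤ n := Real.log_le_self hn0.le
    have h1 : (numCommittees m * L : ℝ) ≤ (n : ℝ) ^ ((q : ℝ) + 5) := by
      calc (numCommittees m * L : ℝ) ≤ n * (n * (n : ℝ) ^ (q + 3)) := by
            gcongr
            refine hL'.trans ?_
            gcongr
            exact hla.trans hln
        _ = (n : ℝ) ^ (q + 5) := by ring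
        _ = _ := by rw [← Real.rpow_natCast]; push_cast; rfl
    rw [Real.rpow_neg hn0.le, inv_mul_eq_div, le_div_iff₀ (by positivity)]
    calc (numCommittees m * L : ℝ) * (n : ℝ) ^ c ≤ (n : ℝ) ^ ((q : ℝ) + 5) * (n : ℝ) ^ c := by
          gcongr
      _ = (n : ℝ) ^ ((q : ℝ) + 5 + c) := (Real.rpow_add hn0 _ _).symm
      _ ≤ _ := hpow

end Conformity

/-! ### Shearing the butterfly -/

section Shear

variable {k : ℕ} [NeZero k]

/-- The committee in the same column whose row differs in exactly the bit `i`. -/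
def flipBit (i : Fin k) (C : Committee k) : Committee k :=
  (Function.update C.1 i (!(C.1 i)), C.2)

/-- The number of steps from the column `γ` to the column of `C`. -/
def offset (γ : Fin k) (C : Committee k) : ℕ := (C.2 - γ).val

/-- A walk that starts in the column `γ` decides the bit `i` in this step. -/
def bitStep (γ i : Fin k) : ℕ := (i - γ - 1).val + 1

/-- The shear at the lifted column `J`, counted from the column `γ`: it flips the bit `i` in all
columns that come after the edges that decide this bit. -/
def shearAt (γ i : Fin k) (J : ℕ) (C : Committee k) : Committee k :=
  if bitStep γ i ≤ J then flipBit i C else C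

/-- The shear on the committees; each column is lifted to the first turn of the butterfly. -/
def shear (γ i : Fin k) (C : Committee k) : Committee k := shearAt γ i (offset γ C) C

variable (γ i : Fin k)

omit [NeZero k] in
theorem flipBit_flipBit (C : Committee k) : flipBit i (flipBit i C) = C := by
  simp [flipBit]

theorem shearAt_shearAt (J : ℕ) (C : Committee k) : shearAt γ i J (shearAt γ i J C) = C := by
  unfold shearAt
  split_ifs
  · exact flipBit_flipBit i C
  · rfl

theorem shearAt_injective (J : ℕ) : Function.Injective (shearAt γ i J) :=
  Function.LeftInverse.injective (shearAt_shearAt γ i J)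

theorem snd_shearAt (J : ℕ) (C : Committee k) : (shearAt γ i J C).2 = C.2 := by
  unfold shearAt
  split_ifs <;> rfl

theorem offset_shearAt (J : ℕ) (C : Committee k) :
    offset γ (shearAt γ i J C) = offset γ C := by
  unfold offset
  rw [snd_shearAt]

theorem offset_shear (C : Committee k) : offset γ (shear γ i C) = offset γ C :=
  offset_shearAt γ i _ C

theorem shear_shear (C : Committee k) : shear γ i (shear γ i C) = C := by
  have h := offset_shear γ i C
  unfold shear at h ⊢
  rw [h, shearAt_shearAt]

/-- The shear as a permutation. -/
def shearEquiv : Committee k ≃ Committee k :=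
  ⟨shear γ i, shear γ i, shear_shear γ i, shear_shear γ i⟩

omit [NeZero k] in
theorem offset_lt (C : Committee k) : offset γ C < k := (C.2 - γ).isLt

theorem bitStep_le : bitStep γ i ≤ k := (i - γ - 1).isLt

theorem bitStep_pos : 0 < bitStep γ i := Nat.succ_pos _

theorem snd_add_one_eq_iff (C : Committee k) : C.2 + 1 = i ↔ offset γ C + 1 = bitStep γ i := by
  unfold offset bitStep
  rw [Nat.add_right_cancel_iff, Fin.val_inj, sub_right_comm, sub_left_inj, eq_sub_iff_add_eq]

theorem offset_next (C : Committee k) (b : Bool) :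
    offset γ (next C b) = (offset γ C + 1) % k := by
  unfold offset next
  simp only
  rw [add_sub_right_comm, Fin.val_add, Fin.val_one', Nat.add_mod_mod]

theorem flipBit_next (C : Committee k) (b : Bool) :
    flipBit (C.2 + 1) (next C b) = next C (!b) := by
  cases b <;> simp [flipBit, next]

theorem next_flipBit {i : Fin k} {C : Committee k} (h : C.2 + 1 ≠ i) (b : Bool) :
    next (flipBit i C) b = flipBit i (next C b) := by
  cases b
  · simp [flipBit, next]
  · simp only [flipBit, next, if_true, Function.update_of_ne h, Function.update_of_ne h.symm]
    rw [Function.update_comm h]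

/-- The shear maps edges to edges; it exchanges the two edges that start at a committee if they
decide the bit `i`. -/
theorem shearAt_next (C : Committee k) (b : Bool) :
    shearAt γ i (offset γ C + 1) (next C b) =
      next (shear γ i C) (xor b (decide (offset γ C + 1 = bitStep γ i))) := by
  by_cases h : offset γ C + 1 = bitStep γ i
  · have h1 : ¬ bitStep γ i ≤ offset γ C := by omega
    rw [shear, shearAt, shearAt, if_neg h1, if_pos h.ge]
    obtain rfl := (snd_add_one_eq_iff γ i C).2 h
    rw [flipBit_next]
    simp [h]
  · have h2 := mt (snd_add_one_eq_iff γ i C).1 h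
    by_cases h1 : bitStep γ i ≤ offset γ C
    · rw [shear, shearAt, shearAt, if_pos h1, if_pos (by omega), next_flipBit h2]
      simp [h]
    · rw [shear, shearAt, shearAt, if_neg h1, if_neg (by omega)]
      simp [h]

end Shear

section Uniformity

variable {m L : ℕ} (γ i : Fin (2 ^ m))

/-- The permutation of the tokens that is induced by the shear of their sources. -/
def shearToken : Token m L ≃ Token m L :=
  Equiv.prodCongr (shearEquiv γ i) (Equiv.refl _)

theorem src_shearToken (t : Token m L) : (shearToken γ i t).src = shear γ i t.src := rfl

theorem shearToken_shearToken (t : Token m L) : shearToken γ i (shearToken γ i t) = t :=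
  Prod.ext (shear_shear γ i t.1) rfl

theorem shearToken_symm : (shearToken γ i : Token m L ≃ Token m L).symm = shearToken γ i := rfl

/-- The state `y` is the sheared image of the state `x` of tokens that have walked `s` steps, as
far as the tokens are concerned that have not yet passed the column `γ` again. -/
structure Sheared (s : ℕ) (x y : State m L) : Prop where
  offset_left : ∀ t D, x t = some D → offset γ D = (offset γ t.src + s) % 2 ^ m
  offset_right : ∀ t D, y t = some D → offset γ D = (offset γ t.src + s) % 2 ^ m
  eq_map : ∀ t, offset γ t.src + s ≤ 2 ^ m →
    y (shearToken γ i t) = (x t).map (shearAt γ i (offset γ t.src + s))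

/-- The shear acts on the coins of the first round: it flips those of the tokens whose first step
decides the bit `i`. -/
theorem coupled_firstRound :
    Coupled (Sheared (L := L) γ i 1) (firstRound m L) (firstRound m L) := by
  let e : (Token m L → Bool) ≃ (Token m L → Bool) :=
    (Equiv.piCongrRight fun t => Equiv.ofBijective
      (fun b => xor b (decide (offset γ t.src + 1 = bitStep γ i)))
      (Function.Involutive.bijective fun b => by simp)).trans
    (Equiv.arrowCongr (shearToken γ i) (Equiv.refl _))
  refine Coupled.map ((Coupled.uniformOfFintype e).mono ?_)
  rintro b _ rfl
  have he : ∀ t, e b (shearToken γ i t) =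
      xor (b t) (decide (offset γ t.src + 1 = bitStep γ i)) := by
    intro t
    simp [e]
  refine ⟨?_, ?_, ?_⟩
  · rintro t D h
    rw [← Option.some.inj h, offset_next]
  · rintro t D h
    rw [← Option.some.inj h, offset_next]
  · intro t _
    rw [he, src_shearToken, ← shearAt_next]
    rfl

variable {γ i}

/-- At a committee that the walks reach before they pass the column `γ` again, the sets that are
matched are exchanged by the shear. -/
theorem Sheared.mem_iff {s : ℕ} {x y : State m L} (h : Sheared γ i s x y) {rand : Token m L → ℕ}
    (r : ℕ) {C : Committee (2 ^ m)} (h1 : s ≤ offset γ C) (h2 : offset γ C + s ≤ 2 ^ m)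
    (t : Token m L) :
    (shearToken γ i t ∈ setF (rand ∘ shearToken γ i) r y (shear γ i C) ↔ t ∈ setF rand r x C) ∧
    (shearToken γ i t ∈ setS (rand ∘ shearToken γ i) r y (shear γ i C) ↔
      t ∈ setS rand r x C) := by
  have hrand : (rand ∘ shearToken γ i) (shearToken γ i t) = rand t := by
    simp [shearToken_shearToken]
  have hlt := offset_lt γ t.src
  have hmod : offset γ C = (offset γ t.src + s) % 2 ^ m → offset γ C = offset γ t.src + s := by
    intro hC
    rcases Nat.lt_or_ge (offset γ t.src + s) (2 ^ m) with h' | h'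
    · rwa [Nat.mod_eq_of_lt h'] at hC
    · rw [Nat.mod_eq_sub_mod h', Nat.mod_eq_of_lt (by omega)] at hC
      omega
  constructor
  · rw [mem_setF, mem_setF, hrand]
    refine and_congr_left fun _ => ⟨fun hy => ?_, fun hx => ?_⟩
    · have h3 := h.offset_right _ _ hy
      rw [src_shearToken, offset_shear, offset_shear] at h3
      have h4 := hmod h3
      rw [h.eq_map t (by omega), ← h4, Option.map_eq_some_iff] at hy
      obtain ⟨D, hD, h5⟩ := hy
      rw [hD, shearAt_injective γ i _ h5]
    · have h4 := hmod (h.offset_left _ _ hx)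
      rw [h.eq_map t (by omega), hx, ← h4]
      rfl
  · have hinj : shear γ i t.src = shear γ i C ↔ t.src = C := (shearEquiv γ i).injective.eq_iff
    rw [mem_setS, mem_setS, hrand, src_shearToken, hinj, ← and_assoc, ← and_assoc]
    refine and_congr_left fun _ => and_congr_left fun hC => ?_
    rw [h.eq_map t (by rw [hC]; exact h2)]
    simp

/-- A round of the loop doubles the lengths of the walks. The matchings at the committees of
`Sheared.mem_iff` are transported by the shear. The other matchings may be arbitrary: after the
round, the walks of the tokens that they concern have passed the column `γ` again. -/
theorem Sheared.coupled_loopRound {s : ℕ} (hs : 1 ≤ s) {x y : State m L}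
    (h : Sheared γ i s x y) (rand : Token m L → ℕ) (r : ℕ) :
    Coupled (Sheared γ i (2 * s)) (loopRound rand r x)
      (loopRound (rand ∘ shearToken γ i) r y) := by
  rw [loopRound_eq, loopRound_eq]
  refine Coupled.map (Coupled.mono (Coupled.pi_equiv (shearEquiv γ i)
    (R := fun C A B => IsMaxMatching (setF rand r x C) (setS rand r x C) A ∧
      IsMaxMatching (setF (rand ∘ shearToken γ i) r y (shear γ i C))
        (setS (rand ∘ shearToken γ i) r y (shear γ i C)) B ∧
      (s ≤ offset γ C ∧ offset γ C + s ≤ 2 ^ m →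
        ∀ t, B (shearToken γ i t) = (A t).map (shearToken γ i))) fun C => ?_) ?_)
  · by_cases hC : s ≤ offset γ C ∧ offset γ C + s ≤ 2 ^ m
    · have hm := h.mem_iff (rand := rand) r hC.1 hC.2
      let e : (Token m L → Option (Token m L)) ≃ (Token m L → Option (Token m L)) :=
        Equiv.arrowCongr (shearToken γ i) (Equiv.optionCongr (shearToken γ i))
      have he : ∀ A t, e A t = (A (shearToken γ i t)).map (shearToken γ i) := fun A t => rfl
      refine (Coupled.uniformOfFinset (maxMatchings_nonempty _ _) (maxMatchings_nonempty _ _)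
        e fun A => ?_).and_mem_support.mono ?_
      · rw [mem_maxMatchings, mem_maxMatchings]
        constructor
        · intro hA
          have := hA.conj (shearToken γ i) (shearToken γ i)
            (F' := setF rand r x C) (S' := setS rand r x C)
            (fun t => by rw [← (hm _).1, shearToken_shearToken]; rfl)
            (fun t => by rw [← (hm _).2, shearToken_shearToken]; rfl)
          convert this using 2 with t
          rw [shearToken_symm, he, shearToken_shearToken, Option.map_map]
          have : (shearToken γ i ∘ shearToken γ i : Token m L → Token m L) = id :=
            funext fun t => shearToken_shearToken γ i t
          rw [this, Option.map_id]
          rfl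
        · intro hA
          exact hA.conj (shearToken γ i) (shearToken γ i) (fun t => (hm t).1) fun t => (hm t).2
      · rintro A B ⟨hA, hB, -, rfl⟩
        rw [PMF.mem_support_uniformOfFinset_iff, mem_maxMatchings] at hA hB
        refine ⟨hA, hB, fun _ t => ?_⟩
        rw [he, shearToken_shearToken]
    · -- only the fact that both matchings are maximum is needed at this committee
      refine (Coupled.trivial _ _).and_mem_support.mono ?_
      rintro A B ⟨hA, hB, -⟩
      rw [PMF.mem_support_uniformOfFinset_iff, mem_maxMatchings] at hA hB
      exact ⟨hA, hB, fun h => absurd h hC⟩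
  · intro A B hAB
    have hoff : ∀ (z : State m L) (M : Committee (2 ^ m) → Token m L → Option (Token m L))
        (rand' : Token m L → ℕ),
        (∀ t D, z t = some D → offset γ D = (offset γ t.src + s) % 2 ^ m) →
        (∀ C, IsMaxMatching (setF rand' r z C) (setS rand' r z C) (M C)) →
        ∀ t D, applyMatchings z M t = some D →
          offset γ D = (offset γ t.src + 2 * s) % 2 ^ m := by
      intro z M rand' hz hM t D hD
      obtain ⟨C, g, h1, h2, h3⟩ := applyMatchings_eq_some.1 hD
      have hg := (mem_setS.1 ((hM C).1 t g h2).2).2.1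
      rw [hz g D h3, hg, hz t C h1, Nat.mod_add_mod]
      congr 1
      ring
    refine ⟨hoff x A rand h.offset_left fun C => (hAB C).1,
      hoff y B (rand ∘ shearToken γ i) h.offset_right fun C => ?_, fun t ht => ?_⟩
    · have := (hAB (shear γ i C)).2.1
      simp only [shearEquiv, Equiv.coe_fn_mk, shear_shear] at this
      exact this
    · unfold applyMatchings
      rw [h.eq_map t (by omega)]
      cases hx : x t with
      | none => rfl
      | some C =>
        have hC := h.offset_left t C hx
        rw [Nat.mod_eq_of_lt (by omega)] at hC
        simp only [Option.map_some, Option.bind_some]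
        rw [← hC, show shearAt γ i (offset γ C) C = shearEquiv γ i C from rfl,
          (hAB C).2.2 ⟨by omega, by omega⟩ t]
        cases hA : A C t with
        | none => rfl
        | some g =>
          have hg := (mem_setS.1 ((hAB C).1.1 t g hA).2).2.1
          simp only [Option.map_some, Option.bind_some]
          rw [h.eq_map g (by rw [hg]; omega), hg, hC]
          congr 2
          ring

theorem coupled_stateLaw (rand : Token m L → ℕ) : ∀ r, r ≤ m →
    Coupled (Sheared γ i (2 ^ r)) (stateLaw rand (r + 1))
      (stateLaw (rand ∘ shearToken γ i) (r + 1))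
  | 0, _ => by
    simp only [stateLaw, PMF.pure_bind]
    exact coupled_firstRound γ i
  | r + 1, hr => by
    rw [stateLaw, stateLaw]
    refine (coupled_stateLaw rand r (by omega)).bind fun x y h => ?_
    rw [oneRound_loop _ (by omega) hr, oneRound_loop _ (by omega) hr, pow_succ']
    exact h.coupled_loopRound Nat.one_le_two_pow rand _

/-- The law of the states after the last round. -/
noncomputable def finalLaw (m L : ℕ) : PMF (State m L) :=
  (sampling m L).map fun o => o.hist (numRounds m)

theorem finalLaw_eq (m L : ℕ) :
    finalLaw m L = ((iidPMF (Token m L) geomHalf).bind fun rand =>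
      stateLaw rand (m + 1)).bind lastRound := by
  rw [finalLaw, sampling_map_final, PMF.bind_bind]
  congr 1
  funext rand
  rw [numRounds, stateLaw]
  congr 1
  funext x
  exact oneRound_last rand x

/-- A walk of `2 ^ m` steps decides each bit exactly once, so flipping the bit `i` of the final
destination of a token is a symmetry. -/
theorem coupled_finalLaw_row (t : Token m L) (i : Fin (2 ^ m)) :
    Coupled (fun x y => y t = (x t).map (flipBit i)) (finalLaw m L) (finalLaw m L) := by
  rw [finalLaw_eq]
  refine Coupled.bind (R := fun x y => y t = (x t).map (flipBit i)) ?_ ?_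
  · let γ := t.src.2
    let e : (Token m L → ℕ) ≃ (Token m L → ℕ) :=
      Equiv.arrowCongr (shearToken γ i) (Equiv.refl _)
    refine Coupled.bind (Coupled.of_equiv e fun f => ?_) ?_
    · simp only [iidPMF_eq_piPMF, piPMF_apply]
      exact (shearToken γ i).prod_comp fun t => geomHalf (f t)
    · rintro rand _ rfl
      refine (coupled_stateLaw (γ := γ) (i := i) rand m le_rfl).mono fun x y h => ?_
      have h0 : offset γ t.src = 0 := by simp [offset, γ]
      have h1 := h.eq_map t (by rw [h0]; simp)
      have h2 : shearToken γ i t = t := by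
        refine Prod.ext ?_ rfl
        change shear γ i t.src = t.src
        rw [shear, shearAt, h0, if_neg (by have := bitStep_pos γ i; omega)]
      rw [h0, zero_add, h2] at h1
      rw [h1]
      congr 1
      funext C
      rw [shearAt, if_pos (bitStep_le γ i)]
  · intro x y h
    refine Coupled.map ((Coupled.uniformOfFintype (Equiv.refl _)).mono ?_)
    rintro c _ rfl
    simp only [h, Option.map_map]
    rfl

/-- The columns that are chosen in the last round are exchangeable. -/
theorem coupled_finalLaw_column (t : Token m L) (e : Fin (2 ^ m) ≃ Fin (2 ^ m)) :
    Coupled (fun x y => y t = (x t).map fun C => (C.1, e C.2))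
      (finalLaw m L) (finalLaw m L) := by
  rw [finalLaw_eq]
  refine Coupled.bind (Coupled.of_equiv (Equiv.refl _) fun _ => rfl) ?_
  rintro x _ rfl
  refine Coupled.map ((Coupled.uniformOfFintype
    (Equiv.arrowCongr (Equiv.refl (Token m L)) e)).mono ?_)
  rintro c _ rfl
  simp [Option.map_map, Function.comp_def]

/-- The flips of the bits and the permutations of the columns act transitively on the committees. -/
theorem finalLaw_dst_eq (t : Token m L) (D D' : Committee (2 ^ m)) :
    (finalLaw m L).toOuterMeasure {x | x t = some D} =
      (finalLaw m L).toOuterMeasure {x | x t = some D'} := by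
  classical
  set g : Committee (2 ^ m) → ℝ≥0∞ := fun D => (finalLaw m L).toOuterMeasure {x | x t = some D}
    with hg
  have hflip : ∀ i D, g D = g (flipBit i D) := by
    intro i D
    refine (coupled_finalLaw_row t i).toOuterMeasure_eq fun x y hxy => ?_
    simp only [Set.mem_ofPred_eq, hxy, Option.map_eq_some_iff]
    refine ⟨fun h => ⟨D, h, rfl⟩, ?_⟩
    rintro ⟨C, hC, h⟩
    rw [hC, ← flipBit_flipBit i C, h, flipBit_flipBit]
  have hcol : ∀ (ρ) (c c'), g (ρ, c) = g (ρ, c') := by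
    intro ρ c c'
    refine (coupled_finalLaw_column t (Equiv.swap c c')).toOuterMeasure_eq fun x y hxy => ?_
    simp only [Set.mem_ofPred_eq, hxy, Option.map_eq_some_iff]
    refine ⟨fun h => ⟨_, h, by simp⟩, ?_⟩
    rintro ⟨⟨ρ', c''⟩, hC, h⟩
    simp only [Prod.mk.injEq] at h
    rw [hC, h.1, (Equiv.swap c c').injective (h.2.trans (Equiv.swap_apply_left c c').symm)]
  obtain ⟨ρ, c⟩ := D
  obtain ⟨ρ', c'⟩ := D'
  have hrow : ∀ s : Finset (Fin (2 ^ m)), g (ρ, c) =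
      g (fun i => if i ∈ s then ρ' i else ρ i, c) := by
    intro s
    induction s using Finset.induction_on with
    | empty => simp
    | insert i s hi ih =>
      rw [ih]
      by_cases h : ρ' i = ρ i
      · congr 2
        funext j
        by_cases hj : j = i
        · subst hj; simp [hi, h]
        · simp [hj]
      · rw [hflip i]
        congr 1
        refine Prod.ext ?_ rfl
        funext j
        by_cases hj : j = i
        · subst hj
          simp only [flipBit, hi, if_false, Function.update_self, Finset.mem_insert_self, if_true]
          revert h
          cases ρ' j <;> cases ρ j <;> simp
        · simp [flipBit, hj]
  have h1 := hrow Finset.univ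
  simp only [Finset.mem_univ, if_true] at h1
  exact h1.trans (hcol ρ' c c')

theorem uniformity (m L : ℕ) (t : Token m L)
    (h : prob (sampling m L) {o | o.finalDst t ≠ none} ≠ 0) (D : Committee (2 ^ m)) :
    prob (sampling m L) {o | o.finalDst t ≠ none ∧ o.finalDst t = some D} /
        prob (sampling m L) {o | o.finalDst t ≠ none} =
      1 / (numCommittees m : ℝ) := by
  classical
  have h1 : ∀ D, prob (sampling m L) {o | o.finalDst t ≠ none ∧ o.finalDst t = some D} =
      ((finalLaw m L).toOuterMeasure {x | x t = some D}).toReal := by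
    intro D
    rw [prob, finalLaw, PMF.toOuterMeasure_map_apply]
    congr 2
    ext o
    simp only [Set.mem_ofPred_eq, Set.mem_preimage, Outcome.finalDst]
    exact ⟨fun h => h.2, fun h => ⟨by rw [h]; simp, h⟩⟩
  have h2 : prob (sampling m L) {o | o.finalDst t ≠ none} =
      ∑ D, ((finalLaw m L).toOuterMeasure {x | x t = some D}).toReal := by
    have h3 : ∀ E, ((sampling m L).map fun o => o.finalDst t).toOuterMeasure E =
        (sampling m L).toOuterMeasure {o | o.finalDst t ∈ E} :=
      fun E => PMF.toOuterMeasure_map_apply _ _ _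
    have h4 : ∀ D, (finalLaw m L).toOuterMeasure {x | x t = some D} =
        ((sampling m L).map fun o => o.finalDst t) (some D) := by
      intro D
      rw [← PMF.toOuterMeasure_apply_singleton, h3, finalLaw, PMF.toOuterMeasure_map_apply]
      rfl
    rw [prob, ← ENNReal.toReal_sum fun D _ =>
      ne_top_of_le_ne_top ENNReal.one_ne_top (toOuterMeasure_le_one _ _)]
    congr 1
    rw [Finset.sum_congr rfl fun D _ => h4 D]
    have h5 := h3 {C | C ≠ none}
    rw [PMF.toOuterMeasure_apply_fintype, Fintype.sum_option] at h5
    simpa using h5.symm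
  rw [h1, h2]
  rw [h2] at h
  rw [Finset.sum_congr rfl fun D' _ => congrArg ENNReal.toReal (finalLaw_dst_eq t D' D)] at h ⊢
  rw [Finset.sum_const, Finset.card_univ, card_committee, nsmul_eq_mul] at h ⊢
  have h6 := right_ne_zero_of_mul h
  have h7 := left_ne_zero_of_mul h
  field_simp

end Uniformity

/-! ### Revealing the random numbers round by round -/

section Reveal

/-- The random numbers, truncated at `r + 1`: those that are at least `r` are decided by the
coins `b`. -/
def reveal {T : Type*} (r : ℕ) (ρ : T → ℕ) (b : T → Bool) (t : T) : ℕ :=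
  if ρ t < r then ρ t else if b t then r + 1 else r

/-- The law of the truncation at `r + 1` of a random number whose truncation at `r` is that of
`j`. -/
noncomputable def revealLaw (r j : ℕ) : PMF ℕ :=
  (PMF.uniformOfFintype Bool).map fun b => if j < r then j else if b then r + 1 else r

/-- The geometric law is memoryless: a random number that is at least `r` exceeds `r` with
probability `1 / 2`. -/
theorem geomHalf_reveal {r : ℕ} (hr : 1 ≤ r) :
    (geomHalf.map fun j => min j (r + 1)) =
      geomHalf.bind (revealLaw r) := by
  classical
  have hpow : (2⁻¹ : ℝ≥0∞) ^ (r - 1) * 2⁻¹ = 2⁻¹ ^ r := by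
    rw [← pow_succ, Nat.sub_add_cancel hr]
  have htail : (∑' j, {i | r - 1 < i}.indicator geomHalf j) = (2⁻¹ : ℝ≥0∞) ^ (r - 1) := by
    rw [← PMF.toOuterMeasure_apply, geomHalf_tail]
  ext v
  rw [PMF.map_apply, PMF.bind_apply]
  simp only [revealLaw, PMF.map_apply, tsum_fintype, Fintype.sum_bool, PMF.uniformOfFintype_apply,
    Fintype.card_bool, Nat.cast_ofNat, if_true, Bool.false_eq_true, if_false]
  rcases Nat.lt_or_ge v r with hv | hv
  · refine tsum_congr fun j => ?_
    by_cases hj : j < r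
    · by_cases hvj : v = j
      · simp [hj, hvj, show min j (r + 1) = j by omega, ENNReal.inv_two_add_inv_two]
      · simp [hj, hvj, show min j (r + 1) = j by omega]
    · simp [hj, show v ≠ min j (r + 1) by omega, show v ≠ r + 1 by omega, hv.ne]
  rcases hv.eq_or_lt with rfl | hv'
  · rw [tsum_eq_single r fun j hj => by rw [if_neg]; omega]
    simp only [show min r (r + 1) = r by omega, if_true, geomHalf_apply,
      show r ≠ 0 by omega, if_false]
    rw [← hpow, ← htail, ← ENNReal.tsum_mul_right]
    refine tsum_congr fun j => ?_
    by_cases hj : j < r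
    · simp [hj, hj.ne', show ¬ r - 1 < j by omega]
    · simp [hj, show r - 1 < j by omega, geomHalf_apply, show j ≠ 0 by omega]
  rcases Nat.lt_or_ge (r + 1) v with hv'' | hv''
  · rw [ENNReal.tsum_eq_zero.2 fun j => by rw [if_neg]; omega]
    symm
    rw [ENNReal.tsum_eq_zero]
    intro j
    by_cases hj : j < r
    · simp [hj, show v ≠ j by omega]
    · simp [hj, show v ≠ r + 1 by omega, show v ≠ r by omega]
  · obtain rfl : v = r + 1 := by omega
    refine (tsum_congr (g := {i | r < i}.indicator geomHalf) fun j => ?_).trans ?_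
    · by_cases hj : r < j
      · simp [hj]
      · simp [hj, show r + 1 ≠ min j (r + 1) by omega]
    rw [← PMF.toOuterMeasure_apply, geomHalf_tail, ← hpow, ← htail,
      ← ENNReal.tsum_mul_right]
    refine tsum_congr fun j => ?_
    by_cases hj : j < r
    · simp [hj, show r + 1 ≠ j by omega, show ¬ r - 1 < j by omega]
    · simp [hj, show r - 1 < j by omega]

/-- The truncations at `r + 1` arise from those at `r` by tossing a fair coin for each number. -/
theorem iidPMF_reveal {T : Type*} [Fintype T] [DecidableEq T] {r : ℕ} (hr : 1 ≤ r) :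
    ((iidPMF T geomHalf).map fun ρ t => min (ρ t) (r + 1)) =
      (iidPMF T geomHalf).bind fun ρ =>
        (PMF.uniformOfFintype (T → Bool)).map fun b => reveal r ρ b := by
  rw [uniformOfFintype_pi, iidPMF_eq_piPMF]
  have h1 : ∀ ρ : T → ℕ, ((piPMF fun _ : T => PMF.uniformOfFintype Bool).map
      fun b => reveal r ρ b) = piPMF fun t => revealLaw r (ρ t) :=
    fun ρ => piPMF_map (fun _ => PMF.uniformOfFintype Bool)
      fun t b => if ρ t < r then ρ t else if b then r + 1 else r
  simp only [h1]
  rw [piPMF_map (fun _ : T => geomHalf) fun _ j => min j (r + 1), geomHalf_reveal hr]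
  have h2 := piPMF_bind (fun _ : T => geomHalf) fun _ => revealLaw r
  exact h2.symm

variable {m L : ℕ}

theorem loopRound_congr {ρ ρ' : Token m L → ℕ} {r : ℕ}
    (h : ∀ t, min (ρ t) r = min (ρ' t) r) (x : State m L) :
    loopRound ρ r x = loopRound ρ' r x := by
  have hF : setF ρ r x = setF ρ' r x := by
    funext C
    ext t
    have := h t
    rw [mem_setF, mem_setF]
    exact and_congr_right fun _ => by omega
  have hS : setS ρ r x = setS ρ' r x := by
    funext C
    ext t
    have := h t
    rw [mem_setS, mem_setS]
    exact and_congr_right fun _ => and_congr_right fun _ => by omega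
  rw [loopRound_eq, loopRound_eq, hF, hS]

theorem oneRound_congr {ρ ρ' : Token m L → ℕ} {r : ℕ}
    (h : ∀ t, min (ρ t) r = min (ρ' t) r) (x : State m L) :
    oneRound ρ r x = oneRound ρ' r x := by
  unfold oneRound
  rw [loopRound_congr h]

/-- The first `r` rounds do not depend on the random numbers beyond their truncations at `r`. -/
theorem stateLaw_congr {ρ ρ' : Token m L → ℕ} {r : ℕ}
    (h : ∀ t, min (ρ t) r = min (ρ' t) r) : stateLaw ρ r = stateLaw ρ' r := by
  induction r with
  | zero => rfl
  | succ r ih =>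
    have ih := ih fun t => by
      have := h t
      omega
    rw [stateLaw, stateLaw, ih]
    exact congrArg _ (funext fun x => oneRound_congr h x)

/-- The joint law of the random numbers, truncated at `r`, and the state after round `r`. -/
noncomputable def jointLaw (m L r : ℕ) : PMF ((Token m L → ℕ) × State m L) :=
  (iidPMF (Token m L) geomHalf).bind fun ρ =>
    (stateLaw ρ r).map fun x => (fun t => min (ρ t) r, x)

/-- A transition of the Markov chain `jointLaw`: fresh coins decide which of the remaining random
numbers exceed `r`, and then round `r + 1` is executed. -/
noncomputable def jointStep (r : ℕ) (z : (Token m L → ℕ) × State m L) :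
    PMF ((Token m L → ℕ) × State m L) :=
  (PMF.uniformOfFintype (Token m L → Bool)).bind fun b =>
    (oneRound (reveal r z.1 b) (r + 1) z.2).map fun x => (reveal r z.1 b, x)

theorem jointLaw_succ {r : ℕ} (hr : 1 ≤ r) :
    jointLaw m L (r + 1) = (jointLaw m L r).bind (jointStep r) := by
  have htr : ∀ (ρ : Token m L → ℕ) b t, min (reveal r ρ b t) (r + 1) = reveal r ρ b t := by
    intro ρ b t
    unfold reveal
    split_ifs <;> omega
  have h1 : ∀ ρ : Token m L → ℕ, ((stateLaw ρ (r + 1)).map fun x =>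
      ((fun t => min (ρ t) (r + 1)), x)) = (fun ρ' : Token m L → ℕ =>
        (stateLaw ρ' (r + 1)).map fun x => (ρ', x)) (fun t => min (ρ t) (r + 1)) := by
    intro ρ
    simp only
    rw [stateLaw_congr (ρ := ρ) (ρ' := fun t => min (ρ t) (r + 1)) fun t => by omega]
  rw [jointLaw]
  simp only [h1]
  have h2 := congrArg (fun p => p.bind fun ρ' : Token m L → ℕ =>
        (stateLaw ρ' (r + 1)).map fun x => (ρ', x)) (iidPMF_reveal (T := Token m L) hr)
  simp only [PMF.bind_map, PMF.bind_bind] at h2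
  refine Eq.trans h2 ?_
  rw [jointLaw, PMF.bind_bind]
  congr 1
  funext ρ
  simp only [PMF.bind_map, Function.comp_def, jointStep]
  have h3 : ∀ b, reveal r (fun t => min (ρ t) r) b = reveal r ρ b := by
    intro b
    funext t
    simp only [reveal]
    split_ifs <;> omega
  simp only [h3]
  rw [PMF.bind_comm]
  congr 1
  funext b
  rw [stateLaw, PMF.map_bind]
  rw [stateLaw_congr (ρ := reveal r ρ b) (ρ' := ρ) fun t => by
    unfold reveal
    split_ifs <;> omega]

theorem jointLaw_map_snd (m L r : ℕ) : (jointLaw m L r).map Prod.snd =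
    (iidPMF (Token m L) geomHalf).bind fun ρ => stateLaw ρ r := by
  rw [jointLaw, PMF.map_bind]
  congr 1
  funext ρ
  rw [PMF.map_comp]
  exact PMF.map_id _

end Reveal

/-! ### Balanced states and the halving of the tokens -/

section Halving

variable {m L : ℕ}

/-- The remaining tokens with source `C`. -/
def tokensFrom (x : State m L) (C : Committee (2 ^ m)) : Finset (Token m L) :=
  Finset.univ.filter fun t => x t ≠ none ∧ t.src = C

/-- The remaining tokens with destination `C`. -/
def tokensTo (x : State m L) (C : Committee (2 ^ m)) : Finset (Token m L) :=
  Finset.univ.filter fun t => x t = some C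

theorem mem_tokensFrom {x : State m L} {C : Committee (2 ^ m)} {t : Token m L} :
    t ∈ tokensFrom x C ↔ x t ≠ none ∧ t.src = C := by
  simp [tokensFrom]

theorem mem_tokensTo {x : State m L} {C : Committee (2 ^ m)} {t : Token m L} :
    t ∈ tokensTo x C ↔ x t = some C := by
  simp [tokensTo]

/-- All sets of the families `A` and `B` have between `l` and `u` elements. The sets `A C` and `B C`
will consist of tokens with source `C` and with destination `C`, respectively. -/
def Balanced {T : Type*} (l u : ℝ) (A B : Committee (2 ^ m) → Finset T) : Prop :=
  ∀ C, (l ≤ (A C).card ∧ ((A C).card : ℝ) ≤ u) ∧ (l ≤ (B C).card ∧ ((B C).card : ℝ) ≤ u)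

/-- The good states after round `r`, with the random numbers truncated at `r`: they are balanced,
and the random numbers of all remaining tokens are still undecided. -/
def goodStates (m L r : ℕ) (l u : ℝ) : Set ((Token m L → ℕ) × State m L) :=
  {z | (∀ t, z.2 t ≠ none → r ≤ z.1 t) ∧ Balanced l u (tokensFrom z.2) (tokensTo z.2)}

/-- The coins that split all the sets of two families into parts of sizes between `V` and `U`. -/
def evenSplits {T : Type*} (V U : ℝ) (A B : Committee (2 ^ m) → Finset T) : Set (T → Bool) :=
  {b | ∀ β : Bool, Balanced V U (fun C => (A C).filter fun t => b t = β)
    (fun C => (B C).filter fun t => b t = β)}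

/-- Fair coins split every set of a balanced family into two halves of almost equal size. The factor
`8` counts the two families, the two halves, and the two sides of the bounds. -/
theorem split_balanced {T : Type*} [Fintype T] [DecidableEq T]
    {A B : Committee (2 ^ m) → Finset T} {l u ε Λ : ℝ} (h : Balanced l u A B) (hl : 0 ≤ l)
    (hε : 0 ≤ ε) (hε1 : ε ≤ 1) (hΛ : Λ ≤ ε ^ 2 * l / 8) :
    (PMF.uniformOfFintype (T → Bool)).toOuterMeasure
      (evenSplits ((1 - ε) * (l / 2)) ((1 + ε) * (u / 2)) A B)ᶜ ≤
      8 * numCommittees m * ENNReal.ofReal (Real.exp (-Λ)) := by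
  have hlow : ∀ (S : Finset T) (β : Bool), l ≤ S.card →
      (PMF.uniformOfFintype (T → Bool)).toOuterMeasure
        {b | ((S.filter fun t => b t = β).card : ℝ) < (1 - ε) * (l / 2)} ≤
      ENNReal.ofReal (Real.exp (-Λ)) := by
    intro S β hS
    refine (coins_lower_tail S (fun _ => β) hε (by linarith) (by simpa using hS)).trans
      (ENNReal.ofReal_le_ofReal (Real.exp_le_exp.2 ?_))
    nlinarith [sq_nonneg ε, mul_nonneg (sq_nonneg ε) hl]
  have hupp : ∀ (S : Finset T) (β : Bool), (S.card : ℝ) ≤ u → l ≤ u →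
      (PMF.uniformOfFintype (T → Bool)).toOuterMeasure
        {b | (1 + ε) * (u / 2) < ((S.filter fun t => b t = β).card : ℝ)} ≤
      ENNReal.ofReal (Real.exp (-Λ)) := by
    intro S β hS hlu
    refine (coins_upper_tail S (fun _ => β) hε (by linarith) (by linarith)
      (by simpa using hS)).trans
      (ENNReal.ofReal_le_ofReal (Real.exp_le_exp.2 ?_))
    nlinarith [sq_nonneg ε, mul_le_mul_of_nonneg_left hlu (sq_nonneg ε)]
  have key : ∀ S : Committee (2 ^ m) → Finset T, (∀ C, l ≤ (S C).card ∧ ((S C).card : ℝ) ≤ u) →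
      (PMF.uniformOfFintype (T → Bool)).toOuterMeasure
        {b | ∃ i : Committee (2 ^ m) × Bool,
          ((((S i.1).filter fun t => b t = i.2).card : ℝ) < (1 - ε) * (l / 2) ∨
          (1 + ε) * (u / 2) < (((S i.1).filter fun t => b t = i.2).card : ℝ))} ≤
      4 * numCommittees m * ENNReal.ofReal (Real.exp (-Λ)) := by
    intro S hS
    have h1 := fun i : Committee (2 ^ m) × Bool => hlow (S i.1) i.2 (hS i.1).1
    have h2 := fun i : Committee (2 ^ m) × Bool =>
      hupp (S i.1) i.2 (hS i.1).2 ((hS i.1).1.trans (hS i.1).2)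
    refine (measure_exists_le (PMF.uniformOfFintype (T → Bool))
      (fun (i : Committee (2 ^ m) × Bool) (b : T → Bool) =>
        (((S i.1).filter fun t => b t = i.2).card : ℝ) < (1 - ε) * (l / 2) ∨
        (1 + ε) * (u / 2) < (((S i.1).filter fun t => b t = i.2).card : ℝ))
      (δ := ENNReal.ofReal (Real.exp (-Λ)) + ENNReal.ofReal (Real.exp (-Λ)))
      fun i => ?_).trans (le_of_eq ?_)
    · exact toOuterMeasure_union_le _ (fun b hb => hb) (h1 i) (h2 i)
    rw [Fintype.card_prod, card_committee, Fintype.card_bool]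
    push_cast
    ring
  refine (toOuterMeasure_union_le _ ?_ (key A fun C => (h C).1) (key B fun C => (h C).2)).trans
    (le_of_eq (by ring))
  intro b hb
  by_contra hcon
  simp only [Set.mem_union, Set.mem_ofPred_eq, not_or, not_exists, not_lt] at hcon
  exact hb fun β C => ⟨⟨(hcon.1 (C, β)).1, (hcon.1 (C, β)).2⟩,
    ⟨(hcon.2 (C, β)).1, (hcon.2 (C, β)).2⟩⟩

end Halving

/-! ### Survival in a round -/

section Survival

variable {m L : ℕ}

/-- The tokens with source `C` that survive a round are counted at the committees that match
them. -/
theorem card_tokensFrom_applyMatchings {ρ : Token m L → ℕ} {r : ℕ} {x : State m L}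
    {M : Committee (2 ^ m) → Token m L → Option (Token m L)}
    (hM : M ∈ roundMatchings ρ r x) {A : Finset (Token m L)} {C : Committee (2 ^ m)}
    (hA : ∀ t ∈ A, t.src = C) :
    ∑ D, ((A ∩ setF ρ r x D) ∩ matchedF (M D)).card ≤ (tokensFrom (applyMatchings x M) C).card := by
  classical
  rw [← Finset.card_biUnion]
  · refine Finset.card_le_card fun f hf => ?_
    simp only [Finset.mem_biUnion, Finset.mem_univ, true_and, Finset.mem_inter, mem_setF, matchedF,
      Finset.mem_filter] at hf
    obtain ⟨D, ⟨h1, h2, -⟩, h3⟩ := hf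
    obtain ⟨s, hs⟩ := Option.isSome_iff_exists.1 h3
    exact mem_tokensFrom.2 ⟨(applyMatchings_ne_none hM).2 ⟨D, s, h2, hs⟩, hA f h1⟩
  · intro D _ D' _ hne
    rw [Function.onFun, Finset.disjoint_left]
    intro f hf hf'
    simp only [Finset.mem_inter, mem_setF] at hf hf'
    exact hne (Option.some.inj (hf.1.2.1.symm.trans hf'.1.2.1))

/-- The tokens that inherit the destination `C` are counted at the committees that match them. -/
theorem card_tokensTo_applyMatchings {ρ : Token m L → ℕ} {r : ℕ} {x : State m L}
    {M : Committee (2 ^ m) → Token m L → Option (Token m L)}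
    (hM : M ∈ roundMatchings ρ r x) {B : Finset (Token m L)} {C : Committee (2 ^ m)}
    (hB : ∀ t ∈ B, x t = some C) :
    ∑ D, ((B ∩ setS ρ r x D) ∩ matchedS (M D)).card ≤ (tokensTo (applyMatchings x M) C).card := by
  classical
  rw [← Finset.card_biUnion]
  · have key : ∀ s, (∃ D, s ∈ (B ∩ setS ρ r x D) ∩ matchedS (M D)) →
        ∃ f, x f = some s.src ∧ M s.src f = some s ∧ x s = some C := by
      rintro s ⟨D, hs⟩
      simp only [Finset.mem_inter, mem_setS, matchedS, Finset.mem_filter, Finset.mem_univ,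
        true_and] at hs
      obtain ⟨⟨h1, -, rfl, -⟩, f, hf⟩ := hs
      exact ⟨f, (mem_setF.1 ((mem_roundMatchings.1 hM s.src).1 f s hf).1).1, hf, hB s h1⟩
    choose! g hg using key
    refine Finset.card_le_card_of_injOn g ?_ ?_
    · intro s hs
      simp only [Finset.coe_biUnion, Set.mem_iUnion, Finset.mem_coe, Finset.mem_univ,
        exists_prop, true_and] at hs
      obtain ⟨h1, h2, h3⟩ := hg s hs
      exact mem_tokensTo.2 (applyMatchings_eq_some.2 ⟨_, _, h1, h2, h3⟩)
    · intro s hs s' hs' hss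
      simp only [Finset.coe_biUnion, Set.mem_iUnion, Finset.mem_coe, Finset.mem_univ,
        exists_prop, true_and] at hs hs'
      obtain ⟨h1, h2, -⟩ := hg s hs
      obtain ⟨h1', h2', -⟩ := hg s' hs'
      rw [hss] at h1 h2
      have h3 : s.src = s'.src := Option.some.inj (h1.symm.trans h1')
      rw [h3, h2'] at h2
      exact (Option.some.inj h2).symm
  · intro D _ D' _ hne
    rw [Function.onFun, Finset.disjoint_left]
    intro s hs hs'
    simp only [Finset.mem_inter, mem_setS] at hs hs'
    exact hne (hs.1.2.2.1.symm.trans hs'.1.2.2.1)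

theorem card_tokensFrom_applyMatchings_le {ρ : Token m L → ℕ} {r : ℕ} {x : State m L}
    {M : Committee (2 ^ m) → Token m L → Option (Token m L)}
    (hM : M ∈ roundMatchings ρ r x) (C : Committee (2 ^ m)) :
    (tokensFrom (applyMatchings x M) C).card ≤
      ((tokensFrom x C).filter fun t => r ≤ ρ t).card := by
  refine Finset.card_le_card fun f hf => ?_
  obtain ⟨h1, h2⟩ := mem_tokensFrom.1 hf
  obtain ⟨D, s, h3, h4⟩ := (applyMatchings_ne_none hM).1 h1
  refine Finset.mem_filter.2 ⟨mem_tokensFrom.2 ⟨by rw [h3]; simp, h2⟩, ?_⟩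
  exact (mem_setF.1 ((mem_roundMatchings.1 hM D).1 f s h4).1).2

/-- If a family of sets partitions `A`, then its intersections with `A` have the right sizes. -/
theorem sum_card_inter_eq {T ι : Type*} [DecidableEq T] [Fintype ι] (A : Finset T)
    (F : ι → Finset T) (h : ∀ t ∈ A, ∃! i, t ∈ F i) : ∑ i, (A ∩ F i).card = A.card := by
  classical
  simp_rw [← Finset.filter_mem_eq_inter, Finset.card_filter]
  rw [Finset.sum_comm, Finset.card_eq_sum_ones]
  refine Finset.sum_congr rfl fun t ht => ?_
  obtain ⟨i, hi, hu⟩ := h t ht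
  rw [Finset.sum_eq_single i (fun j _ hj => if_neg fun hj' => hj (hu j hj')) (by simp), if_pos hi]

/-- Round `r` of the loop, if the sets that are matched have sizes between `V` and `U`: a token
survives with probability at least `V / U`. -/
theorem loopRound_lower {ρ : Token m L → ℕ} {r : ℕ} {x : State m L} {V U ε Λ : ℝ}
    (hV : 0 ≤ V) (hVU : V ≤ U) (hU : 0 < U) (hε : 0 ≤ ε) (hΛ : Λ ≤ ε ^ 2 * (V / U * V) / 2)
    (hF : ∀ C, V ≤ (setF ρ r x C).card ∧ ((setF ρ r x C).card : ℝ) ≤ U)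
    (hS : ∀ C, V ≤ (setS ρ r x C).card ∧ ((setS ρ r x C).card : ℝ) ≤ U)
    (hFsrc : ∀ C, V ≤ ((tokensFrom x C).filter fun t => r ≤ ρ t).card)
    (hSdst : ∀ C, V ≤ ((tokensTo x C).filter fun t => ρ t + 1 = r).card) :
    (loopRound ρ r x).toOuterMeasure
      {y | ∃ C, ((tokensFrom y C).card : ℝ) < (1 - ε) * (V / U * V) ∨
        ((tokensTo y C).card : ℝ) < (1 - ε) * (V / U * V)} ≤
      2 * numCommittees m * ENNReal.ofReal (Real.exp (-Λ)) := by
  classical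
  have hq0 : 0 ≤ V / U := div_nonneg hV hU.le
  have hq1 : V / U ≤ 1 := (div_le_one hU).2 hVU
  have hmin : ∀ C, V ≤ (min (setF ρ r x C).card (setS ρ r x C).card : ℕ) := by
    intro C
    rw [Nat.cast_min]
    exact le_min (hF C).1 (hS C).1
  have hqF : ∀ C, V / U * (setF ρ r x C).card ≤
      (min (setF ρ r x C).card (setS ρ r x C).card : ℕ) := by
    intro C
    refine le_trans ?_ (hmin C)
    rw [div_mul_eq_mul_div, div_le_iff₀ hU]
    exact mul_le_mul_of_nonneg_left (hF C).2 hV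
  have hqS : ∀ C, V / U * (setS ρ r x C).card ≤
      (min (setF ρ r x C).card (setS ρ r x C).card : ℕ) := by
    intro C
    refine le_trans ?_ (hmin C)
    rw [div_mul_eq_mul_div, div_le_iff₀ hU]
    exact mul_le_mul_of_nonneg_left (hS C).2 hV
  set p := piPMF fun C => PMF.uniformOfFinset (maxMatchings (setF ρ r x C) (setS ρ r x C))
    (maxMatchings_nonempty _ _) with hp
  have hsupp : ∀ M ∈ p.support, M ∈ roundMatchings ρ r x := by
    intro M hM
    rw [mem_roundMatchings]
    intro C
    have := (mem_support_piPMF _ M).1 hM C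
    rwa [PMF.mem_support_uniformOfFinset_iff, mem_maxMatchings] at this
  have hexp : ENNReal.ofReal (Real.exp (-(ε ^ 2 * (V / U * V) / 2))) ≤
      ENNReal.ofReal (Real.exp (-Λ)) :=
    ENNReal.ofReal_le_ofReal (Real.exp_le_exp.2 (by linarith))
  have hfrom : ∀ C, p.toOuterMeasure {M | ((tokensFrom (applyMatchings x M) C).card : ℝ) <
      (1 - ε) * (V / U * V)} ≤ ENNReal.ofReal (Real.exp (-Λ)) := by
    intro C
    set A := (tokensFrom x C).filter fun t => r ≤ ρ t with hA
    have h1 := SubPoisson.pi fun D => subPoisson_matchedF (S := setS ρ r x D)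
      (Finset.inter_subset_right (s₁ := A)) hq0 hq1 (hqF D) hε
    have h2 : ∑ D, (A ∩ setF ρ r x D).card = A.card := by
      refine sum_card_inter_eq A _ fun t ht => ?_
      rw [hA, Finset.mem_filter, mem_tokensFrom] at ht
      obtain ⟨D, hD⟩ := Option.ne_none_iff_exists'.1 ht.1.1
      refine ⟨D, mem_setF.2 ⟨hD, ht.2⟩, fun D' hD' => ?_⟩
      exact Option.some.inj ((mem_setF.1 hD').1.symm.trans hD)
    rw [← Finset.mul_sum, ← Nat.cast_sum, h2] at h1
    refine (PMF.toOuterMeasure_mono _ ?_).trans ((h1.lower_tail hε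
      (mul_nonneg hq0 hV) (mul_le_mul_of_nonneg_left (hFsrc C) hq0)).trans hexp)
    rintro M ⟨hM, hMs⟩
    rw [Set.mem_ofPred_eq] at hM ⊢
    refine lt_of_le_of_lt ?_ hM
    have h3 := card_tokensFrom_applyMatchings (hsupp M hMs) (A := A) (C := C) fun t ht =>
      (mem_tokensFrom.1 (Finset.mem_filter.1 ht).1).2
    exact_mod_cast h3
  have hto : ∀ C, p.toOuterMeasure {M | ((tokensTo (applyMatchings x M) C).card : ℝ) <
      (1 - ε) * (V / U * V)} ≤ ENNReal.ofReal (Real.exp (-Λ)) := by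
    intro C
    set B := (tokensTo x C).filter fun t => ρ t + 1 = r with hB
    have h1 := SubPoisson.pi fun D => subPoisson_matchedS (F := setF ρ r x D)
      (Finset.inter_subset_right (s₁ := B)) hq0 hq1 (hqS D) hε
    have h2 : ∑ D, (B ∩ setS ρ r x D).card = B.card := by
      refine sum_card_inter_eq B _ fun t ht => ?_
      rw [hB, Finset.mem_filter, mem_tokensTo] at ht
      refine ⟨t.src, mem_setS.2 ⟨by rw [ht.1]; simp, rfl, ht.2⟩, fun D' hD' => ?_⟩
      exact (mem_setS.1 hD').2.1.symm
    rw [← Finset.mul_sum, ← Nat.cast_sum, h2] at h1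
    refine (PMF.toOuterMeasure_mono _ ?_).trans ((h1.lower_tail hε
      (mul_nonneg hq0 hV) (mul_le_mul_of_nonneg_left (hSdst C) hq0)).trans hexp)
    rintro M ⟨hM, hMs⟩
    rw [Set.mem_ofPred_eq] at hM ⊢
    refine lt_of_le_of_lt ?_ hM
    have h3 := card_tokensTo_applyMatchings (hsupp M hMs) (B := B) (C := C) fun t ht =>
      mem_tokensTo.1 (Finset.mem_filter.1 ht).1
    exact_mod_cast h3
  rw [loopRound_eq, PMF.toOuterMeasure_map_apply]
  refine (measure_exists_le p (fun C M => ((tokensFrom (applyMatchings x M) C).card : ℝ) <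
      (1 - ε) * (V / U * V) ∨ ((tokensTo (applyMatchings x M) C).card : ℝ) <
      (1 - ε) * (V / U * V)) fun C => toOuterMeasure_union_le p (fun _ h => h) (hfrom C)
      (hto C)).trans (le_of_eq ?_)
  rw [card_committee]
  ring

/-- A round of the loop after the coins have halved all the sets of tokens almost evenly. -/
theorem loopRound_good_of_split {r : ℕ} {ρ : Token m L → ℕ} {x : State m L}
    {b : Token m L → Bool} {V U ε Λ l' : ℝ} (hV : 0 ≤ V) (hVU : V ≤ U) (hU : 0 < U) (hε : 0 ≤ ε)
    (hΛ : Λ ≤ ε ^ 2 * (V / U * V) / 2) (hl' : l' ≤ (1 - ε) * (V / U * V))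
    (halive : ∀ t, x t ≠ none → r ≤ ρ t)
    (hb : b ∈ evenSplits V U (tokensFrom x) (tokensTo x)) :
    (loopRound (reveal r ρ b) (r + 1) x).toOuterMeasure
      {y | (reveal r ρ b, y) ∉ goodStates m L (r + 1) l' U} ≤
      2 * numCommittees m * ENNReal.ofReal (Real.exp (-Λ)) := by
  classical
  have hrev : ∀ t, x t ≠ none →
      (r + 1 ≤ reveal r ρ b t ↔ b t = true) ∧ (reveal r ρ b t + 1 = r + 1 ↔ b t = false) := by
    intro t ht
    have := halive t ht
    rw [reveal, if_neg (by omega)]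
    cases b t <;> simp
  generalize reveal r ρ b = ρ' at hrev ⊢
  have hF1 : ∀ C, setF ρ' (r + 1) x C = (tokensTo x C).filter fun t => b t = true := by
    intro C
    ext t
    rw [mem_setF, Finset.mem_filter, mem_tokensTo]
    exact and_congr_right fun h => (hrev t (by rw [h]; simp)).1
  have hF2 : ∀ C, ((tokensFrom x C).filter fun t => r + 1 ≤ ρ' t) =
      (tokensFrom x C).filter fun t => b t = true :=
    fun C => Finset.filter_congr fun t ht => (hrev t (mem_tokensFrom.1 ht).1).1
  have hS1 : ∀ C, setS ρ' (r + 1) x C = (tokensFrom x C).filter fun t => b t = false := by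
    intro C
    ext t
    rw [mem_setS, Finset.mem_filter, mem_tokensFrom, and_assoc]
    exact and_congr_right fun h => and_congr_right fun _ => (hrev t h).2
  have hS2 : ∀ C, ((tokensTo x C).filter fun t => ρ' t + 1 = r + 1) =
      (tokensTo x C).filter fun t => b t = false :=
    fun C => Finset.filter_congr fun t ht =>
      (hrev t (by rw [mem_tokensTo.1 ht]; simp)).2
  have hlow := loopRound_lower (ρ := ρ') (r := r + 1) (x := x) hV hVU hU hε hΛ
    (fun C => by rw [hF1]; exact (hb true C).2) (fun C => by rw [hS1]; exact (hb false C).1)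
    (fun C => by rw [hF2]; exact (hb true C).1.1) (fun C => by rw [hS2]; exact (hb false C).2.1)
  refine (PMF.toOuterMeasure_mono _ ?_).trans hlow
  rintro y ⟨hy, hys⟩
  obtain ⟨M, hM, rfl⟩ := mem_support_loopRound.1 hys
  by_contra hcon
  simp only [Set.mem_ofPred_eq, not_exists, not_or, not_lt] at hcon hy
  refine hy ⟨fun t ht => ?_, fun C => ⟨⟨hl'.trans (hcon C).1, ?_⟩, ⟨hl'.trans (hcon C).2, ?_⟩⟩⟩
  · obtain ⟨C, s, -, h2⟩ := (applyMatchings_ne_none hM).1 ht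
    exact (mem_setF.1 ((mem_roundMatchings.1 hM C).1 t s h2).1).2
  · refine le_trans (Nat.cast_le.2 (card_tokensFrom_applyMatchings_le hM C)) ?_
    rw [hF2]
    exact (hb true C).1.2
  · refine le_trans (Nat.cast_le.2 (card_dst_applyMatchings_le hM C)) ?_
    have h1 : (Finset.univ.filter fun t => x t = some C ∧ ρ' t + 1 = r + 1) =
        (tokensTo x C).filter fun t => b t = false := by
      rw [← hS2, tokensTo, Finset.filter_filter]
    rw [h1]
    exact (hb false C).2.2

/-- One transition of the chain: halving by the coins, then matching. -/
theorem jointStep_good {r : ℕ} (hr : 1 ≤ r) (hrm : r ≤ m) {l u ε Λ l' : ℝ} (hl : 0 ≤ l)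
    (hlu : l ≤ u) (hu : 0 < u) (hε : 0 ≤ ε) (hε1 : ε ≤ 1) (hΛ : Λ ≤ ε ^ 2 * l / 8)
    (hΛ' : Λ ≤ ε ^ 2 * ((1 - ε) * (l / 2) / ((1 + ε) * (u / 2)) * ((1 - ε) * (l / 2))) / 2)
    (hl' : l' ≤ (1 - ε) * ((1 - ε) * (l / 2) / ((1 + ε) * (u / 2)) * ((1 - ε) * (l / 2))))
    {z : (Token m L → ℕ) × State m L} (hz : z ∈ goodStates m L r l u) :
    (jointStep r z).toOuterMeasure (goodStates m L (r + 1) l' ((1 + ε) * (u / 2)))ᶜ ≤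
      10 * numCommittees m * ENNReal.ofReal (Real.exp (-Λ)) := by
  classical
  have hsplit := split_balanced hz.2 hl hε hε1 hΛ
  have hV : 0 ≤ (1 - ε) * (l / 2) := mul_nonneg (by linarith) (by linarith)
  have hU : 0 < (1 + ε) * (u / 2) := mul_pos (by linarith) (by linarith)
  have hVU : (1 - ε) * (l / 2) ≤ (1 + ε) * (u / 2) :=
    mul_le_mul (by linarith) (by linarith) (by linarith) (by linarith)
  refine (toOuterMeasure_bind_le _ _
    (evenSplits ((1 - ε) * (l / 2)) ((1 + ε) * (u / 2)) (tokensFrom z.2) (tokensTo z.2)) _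
    (δ := 2 * numCommittees m * ENNReal.ofReal (Real.exp (-Λ))) ?_).trans
    ((add_le_add_left hsplit _).trans (le_of_eq ?_))
  · intro b hb
    rw [oneRound_loop _ hr hrm, PMF.toOuterMeasure_map_apply]
    exact loopRound_good_of_split hV hVU hU hε hΛ' hl' hz.1 hb
  · rw [← add_mul, ← add_mul]
    norm_num

/-- After the first round, every committee is the source of exactly `L` tokens and the destination
of about `L` tokens. -/
theorem jointLaw_one_good {ε Λ l : ℝ} (hε : 0 ≤ ε) (hε1 : ε ≤ 1) (hl : l ≤ (1 - ε) * L)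
    (hΛ : Λ ≤ ε ^ 2 * L / 4) :
    (jointLaw m L 1).toOuterMeasure (goodStates m L 1 l ((1 + ε) * L))ᶜ ≤
      2 * numCommittees m * ENNReal.ofReal (Real.exp (-Λ)) := by
  classical
  have hpos : (iidPMF (Token m L) geomHalf).toOuterMeasure {ρ | ∀ t, 1 ≤ ρ t}ᶜ = 0 := by
    rw [PMF.toOuterMeasure_apply_eq_zero_iff, Set.disjoint_compl_right_iff_subset]
    intro ρ hρ t
    have h1 := (mem_support_piPMF _ ρ).1 hρ t
    rw [PMF.mem_support_iff, geomHalf_apply] at h1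
    by_contra h2
    exact h1 (if_pos (by omega))
  rw [jointLaw, ← zero_add (2 * _ * _), ← hpos]
  refine toOuterMeasure_bind_le _ _ _ _ fun ρ hρ => ?_
  rw [PMF.toOuterMeasure_map_apply]
  simp only [stateLaw, PMF.pure_bind]
  rw [zero_add, oneRound_one, firstRound, PMF.toOuterMeasure_map_apply]
  -- a token moves to `C` if and only if its coin picks the edge from its source to `C`
  have h1 : ∀ (b : Token m L → Bool) (C : Committee (2 ^ m)),
      tokensTo (fun t => some (next t.src (b t))) C =
        (tokensInto L C).filter fun t => b t = decide (t.src = prev C true) := by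
    intro b C
    ext t
    simp only [mem_tokensTo, Option.some.injEq, next_eq_iff, tokensInto, Finset.mem_filter,
      Finset.mem_univ, true_and]
    constructor
    · intro h
      refine ⟨⟨_, h⟩, ?_⟩
      cases hb : b t
      · rw [hb] at h
        rw [h]
        symm
        exact decide_eq_false fun h' => Bool.noConfusion (prev_injective C h')
      · rw [hb] at h
        symm
        exact decide_eq_true h
    · rintro ⟨⟨β, hβ⟩, hb⟩
      rw [hb]
      cases β
      · rw [hβ, decide_eq_false fun h' => Bool.noConfusion (prev_injective C h')]
      · rw [decide_eq_true hβ, hβ]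
  have hc : ∀ C : Committee (2 ^ m), ((tokensInto L C).card : ℝ) = L * Fintype.card Bool := by
    intro C
    rw [card_tokensInto, Fintype.card_bool]
    push_cast
    ring
  have hL0 : (0 : ℝ) ≤ L := Nat.cast_nonneg L
  have hεL : 0 ≤ ε ^ 2 * L := mul_nonneg (sq_nonneg _) hL0
  have hlow := fun C : Committee (2 ^ m) =>
    (coins_lower_tail (tokensInto L C) (fun t => decide (t.src = prev C true)) hε hL0
      (hc C).ge).trans (ENNReal.ofReal_le_ofReal (Real.exp_le_exp.2
        (show -(ε ^ 2 * L / 2) ≤ -Λ by linarith)))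
  have hupp := fun C : Committee (2 ^ m) =>
    (coins_upper_tail (tokensInto L C) (fun t => decide (t.src = prev C true)) hε
      (by linarith : ε ≤ 2) hL0
      (hc C).le).trans (ENNReal.ofReal_le_ofReal (Real.exp_le_exp.2
        (show -(ε ^ 2 * L / 4) ≤ -Λ by linarith)))
  refine le_trans (MeasureTheory.measure_mono ?_) ((measure_exists_le
    (PMF.uniformOfFintype (Token m L → Bool)) (fun C b =>
      (((tokensInto L C).filter fun t => b t = decide (t.src = prev C true)).card : ℝ) <
        (1 - ε) * L ∨
      (1 + ε) * L < (((tokensInto L C).filter fun t =>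
        b t = decide (t.src = prev C true)).card : ℝ)) fun C =>
      toOuterMeasure_union_le _ (fun _ h => h) (hlow C) (hupp C)).trans (le_of_eq ?_))
  · intro b hb
    by_contra hcon
    simp only [Set.mem_ofPred_eq, not_exists, not_or, not_lt] at hcon
    refine hb ⟨fun t _ => ?_, fun C => ⟨?_, ?_⟩⟩
    · have : 1 ≤ ρ t := hρ t
      change 1 ≤ min (ρ t) 1
      omega
    · have h2 : (tokensFrom (fun t : Token m L => some (next t.src (b t))) C).card = L := by
        rw [show tokensFrom (fun t : Token m L => some (next t.src (b t))) C =
          Finset.univ.filter fun t : Token m L => t.src = C by ext t; simp [mem_tokensFrom]]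
        exact card_src C
      change l ≤ ((tokensFrom (fun t : Token m L => some (next t.src (b t))) C).card : ℝ) ∧ _
      rw [h2]
      exact ⟨hl.trans (mul_le_of_le_one_left hL0 (by linarith)),
        le_mul_of_one_le_left hL0 (by linarith)⟩
    · change l ≤ ((tokensTo (fun t : Token m L => some (next t.src (b t))) C).card : ℝ) ∧ _
      rw [h1]
      exact ⟨hl.trans (hcon C).1, (hcon C).2⟩
  · rw [card_committee]
    ring

/-- The last round spreads the tokens with destinations in a row evenly over the row. -/
theorem lastRound_good {x : State m L} {l Λ : ℝ} (hl : 0 ≤ l) (hΛ : Λ ≤ l / 8)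
    (hfrom : ∀ C, l ≤ (tokensFrom x C).card) (hto : ∀ C, l ≤ (tokensTo x C).card) :
    (lastRound x).toOuterMeasure
      {y | ¬ ∀ C, l / 2 ≤ (tokensFrom y C).card ∧ l / 2 ≤ (tokensTo y C).card} ≤
      numCommittees m * ENNReal.ofReal (Real.exp (-Λ)) := by
  classical
  rw [lastRound, PMF.toOuterMeasure_map_apply]
  -- the tokens with destination in the row of `D`
  let A : Committee (2 ^ m) → Finset (Token m L) := fun D =>
    Finset.univ.biUnion fun γ => tokensTo x (D.1, γ)
  have hA : ∀ D, l * Fintype.card (Fin (2 ^ m)) ≤ (A D).card := by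
    intro D
    rw [Finset.card_biUnion]
    · push_cast
      refine le_trans ?_ (Finset.card_nsmul_le_sum Finset.univ _ l fun γ _ => hto (D.1, γ))
      rw [nsmul_eq_mul, mul_comm]
      rfl
    · intro γ _ γ' _ hne
      rw [Function.onFun, Finset.disjoint_left]
      intro t ht ht'
      have h1 := (mem_tokensTo.1 ht).symm.trans (mem_tokensTo.1 ht')
      simp only [Option.some.injEq, Prod.mk.injEq, true_and] at h1
      exact hne h1
  have hlow := fun D : Committee (2 ^ m) =>
    (coins_lower_tail (A D) (fun _ => D.2) (ε := 1 / 2) (by norm_num) hl (hA D)).trans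
      (ENNReal.ofReal_le_ofReal (Real.exp_le_exp.2
        (show -((1 / 2) ^ 2 * l / 2) ≤ -Λ by linarith)))
  refine le_trans (MeasureTheory.measure_mono ?_) ((measure_exists_le
    (PMF.uniformOfFintype (Token m L → Fin (2 ^ m))) (fun D c =>
      (((A D).filter fun t => c t = D.2).card : ℝ) < (1 - 1 / 2) * l) hlow).trans (le_of_eq ?_))
  · intro c hc
    by_contra hcon
    simp only [Set.mem_ofPred_eq, not_exists, not_lt] at hcon
    refine hc fun C => ⟨?_, ?_⟩
    · have h1 : tokensFrom (fun t => (x t).map fun C => (C.1, c t)) C = tokensFrom x C := by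
        ext t
        simp [mem_tokensFrom]
      rw [h1]
      linarith [hfrom C]
    · refine le_trans (by linarith [hcon C]) (Nat.cast_le.2 (Finset.card_le_card
        (s := (A C).filter fun t => c t = C.2) fun t ht => ?_))
      simp only [A, Finset.mem_filter, Finset.mem_biUnion, Finset.mem_univ, true_and,
        mem_tokensTo] at ht ⊢
      obtain ⟨⟨γ, h1⟩, h2⟩ := ht
      rw [h1, Option.map_some, h2]
  · rw [card_committee]

end Survival

/-! ### The schedule of errors -/

section Schedule

/-- The relative deviation that is allowed in the transition from round `r` to round `r + 1`. It
is so small in the early rounds because their errors are doubled in each of the later rounds. -/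
noncomputable def dev (A : ℝ) (m r : ℕ) : ℝ := A / 16 * (2 ^ r / 2 ^ m) * (3 / 4) ^ r

/-- The logarithm of the ratio between the upper and the lower bounds after round `r`. -/
noncomputable def logRatio (A : ℝ) (m r : ℕ) : ℝ := A * (2 ^ r / 2 ^ m) * (1 - (3 / 4) ^ r)

/-- The upper bound for the numbers of tokens after round `r`. -/
noncomputable def upperBd (A : ℝ) (m L : ℕ) : ℕ → ℝ
  | 0 => 2 * L
  | r + 1 => (1 + dev A m r) * (upperBd A m L r / 2)

/-- The lower bound for the numbers of tokens after round `r`. -/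
noncomputable def lowerBd (A : ℝ) (m L r : ℕ) : ℝ :=
  Real.exp (-logRatio A m r) * upperBd A m L r

variable {A : ℝ} {m L : ℕ}

theorem dev_nonneg (hA : 0 ≤ A) (r : ℕ) : 0 ≤ dev A m r := by
  unfold dev
  positivity

theorem logRatio_nonneg (hA : 0 ≤ A) (r : ℕ) : 0 ≤ logRatio A m r := by
  have : (3 / 4 : ℝ) ^ r ≤ 1 := pow_le_one₀ (by norm_num) (by norm_num)
  exact mul_nonneg (by positivity) (by linarith)

theorem logRatio_le (hA : 0 ≤ A) (r : ℕ) : logRatio A m r ≤ A * (2 ^ r / 2 ^ m) := by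
  have : (0 : ℝ) < (3 / 4 : ℝ) ^ r := by positivity
  exact mul_le_of_le_one_right (by positivity) (by linarith)

theorem logRatio_succ (r : ℕ) :
    logRatio A m (r + 1) = 2 * logRatio A m r + 8 * dev A m r := by
  unfold logRatio dev
  rw [pow_succ, pow_succ]
  ring

theorem le_upperBd (hA : 0 ≤ A) (r : ℕ) : 2 * L / 2 ^ r ≤ upperBd A m L r := by
  induction r with
  | zero => simp [upperBd]
  | succ r ih =>
    have h1 := dev_nonneg (m := m) hA r
    have h2 : (0 : ℝ) ≤ 2 * L / 2 ^ r := by positivity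
    rw [upperBd, pow_succ]
    calc (2 * L / (2 ^ r * 2) : ℝ) = 1 * ((2 * L / 2 ^ r) / 2) := by field_simp
      _ ≤ _ := by gcongr; linarith

theorem upperBd_pos (hA : 0 ≤ A) (hL : 0 < L) (r : ℕ) : 0 < upperBd A m L r :=
  lt_of_lt_of_le (by positivity) (le_upperBd hA r)

theorem lowerBd_le (hA : 0 ≤ A) (r : ℕ) : lowerBd A m L r ≤ upperBd A m L r :=
  mul_le_of_le_one_left ((by positivity : (0 : ℝ) ≤ 2 * L / 2 ^ r).trans (le_upperBd hA r))
    (Real.exp_le_one_iff.2 (by have := logRatio_nonneg (m := m) hA r; linarith))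

theorem exp_neg_two_mul_le {x : ℝ} (h0 : 0 ≤ x) (h1 : x ≤ 1 / 2) :
    Real.exp (-(2 * x)) ≤ 1 - x := by
  have := exp_neg_le_quadratic (x := 2 * x) (by linarith)
  nlinarith

theorem exp_neg_eight_mul_le {x : ℝ} (h0 : 0 ≤ x) (h1 : x ≤ 1 / 2) :
    Real.exp (-(8 * x)) * (1 + x) ^ 2 ≤ (1 - x) ^ 3 := by
  have h2 := exp_neg_two_mul_le h0 h1
  have h3 : 1 + x ≤ Real.exp x := by linarith [Real.add_one_le_exp x]
  calc Real.exp (-(8 * x)) * (1 + x) ^ 2 ≤ Real.exp (-(8 * x)) * Real.exp x ^ 2 := by gcongr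
    _ = Real.exp (-(2 * x)) ^ 3 := by
        rw [← Real.exp_nat_mul, ← Real.exp_nat_mul, ← Real.exp_add]
        congr 1
        push_cast
        ring
    _ ≤ _ := by gcongr

/-- The lower bounds are compatible with `jointStep_good`: a transition squares the ratio of the
bounds and costs a further factor `exp (-8 ε)`. -/
theorem lowerBd_succ_le (hA : 0 ≤ A) (hL : 0 < L) {r : ℕ} (hε : dev A m r ≤ 1 / 2) :
    lowerBd A m L (r + 1) ≤ (1 - dev A m r) *
      ((1 - dev A m r) * (lowerBd A m L r / 2) / ((1 + dev A m r) * (upperBd A m L r / 2)) *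
        ((1 - dev A m r) * (lowerBd A m L r / 2))) := by
  have hε0 := dev_nonneg (m := m) hA r
  have hu := upperBd_pos (m := m) hA hL r
  have h1 := exp_neg_eight_mul_le hε0 hε
  rw [lowerBd, lowerBd, logRatio_succ, upperBd]
  set ε := dev A m r
  set u := upperBd A m L r
  have h2 : Real.exp (-(2 * logRatio A m r + 8 * ε)) =
      Real.exp (-logRatio A m r) ^ 2 * Real.exp (-(8 * ε)) := by
    rw [← Real.exp_nat_mul, ← Real.exp_add]
    congr 1
    push_cast
    ring
  rw [h2]
  set e := Real.exp (-logRatio A m r)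
  have h3 : (1 - ε) * ((1 - ε) * (e * u / 2) / ((1 + ε) * (u / 2)) * ((1 - ε) * (e * u / 2))) =
      (1 - ε) ^ 3 * (e ^ 2 * u / 2) / (1 + ε) := by
    field_simp
  rw [h3, le_div_iff₀ (by linarith)]
  calc e ^ 2 * Real.exp (-(8 * ε)) * ((1 + ε) * (u / 2)) * (1 + ε)
      = Real.exp (-(8 * ε)) * (1 + ε) ^ 2 * (e ^ 2 * u / 2) := by ring
    _ ≤ _ := by gcongr

/-- Both exponents in the hypotheses of `jointStep_good` are at least a multiple of
`ε ^ 2 * L / 2 ^ r`, up to the square of the ratio of the bounds. -/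
theorem exponent_le (hA : 0 ≤ A) (hL : 0 < L) {r : ℕ} (hε : dev A m r ≤ 1 / 2) {Λ : ℝ}
    (hΛ : Λ ≤ dev A m r ^ 2 * Real.exp (-logRatio A m r) ^ 2 * (L / (12 * 2 ^ r))) :
    Λ ≤ dev A m r ^ 2 * lowerBd A m L r / 8 ∧
    Λ ≤ dev A m r ^ 2 * ((1 - dev A m r) * (lowerBd A m L r / 2) /
      ((1 + dev A m r) * (upperBd A m L r / 2)) *
        ((1 - dev A m r) * (lowerBd A m L r / 2))) / 2 := by
  have hε0 := dev_nonneg (m := m) hA r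
  have hu := upperBd_pos (m := m) hA hL r
  have hu2 := le_upperBd (L := L) (m := m) hA r
  have he1 : Real.exp (-logRatio A m r) ≤ 1 :=
    Real.exp_le_one_iff.2 (by have := logRatio_nonneg (m := m) hA r; linarith)
  have he0 := Real.exp_pos (-logRatio A m r)
  have hu3 : (L : ℝ) / (12 * 2 ^ r) ≤ upperBd A m L r / 24 := by
    refine le_trans (le_of_eq ?_) (div_le_div_of_nonneg_right hu2 (by norm_num))
    field_simp
    norm_num
  rw [lowerBd]
  set ε := dev A m r
  set u := upperBd A m L r
  set e := Real.exp (-logRatio A m r)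
  have h0 : Λ ≤ ε ^ 2 * e ^ 2 * (u / 24) := hΛ.trans (by gcongr)
  constructor
  · refine h0.trans ?_
    have h4 : e ^ 2 ≤ e := by nlinarith
    have h5 : e ^ 2 * u ≤ e * u := mul_le_mul_of_nonneg_right h4 hu.le
    have h6 : 0 ≤ e ^ 2 * u := by positivity
    calc ε ^ 2 * e ^ 2 * (u / 24) = ε ^ 2 * (e ^ 2 * u) / 24 := by ring
      _ ≤ ε ^ 2 * (e * u) / 8 := by
        have := mul_le_mul_of_nonneg_left h5 (sq_nonneg ε)
        have := mul_nonneg (sq_nonneg ε) h6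
        linarith
  · refine h0.trans ?_
    have h3 : ε ^ 2 * ((1 - ε) * (e * u / 2) / ((1 + ε) * (u / 2)) * ((1 - ε) * (e * u / 2))) / 2 =
        (ε ^ 2 * e ^ 2 * u / 4) * ((1 - ε) ^ 2 / (1 + ε)) := by
      field_simp
      ring
    -- equality holds for the largest deviation `ε = 1 / 2`
    have h4 : (1 : ℝ) / 6 ≤ (1 - ε) ^ 2 / (1 + ε) := by
      rw [le_div_iff₀ (by linarith)]
      nlinarith
    rw [h3]
    calc ε ^ 2 * e ^ 2 * (u / 24) = (ε ^ 2 * e ^ 2 * u / 4) * (1 / 6) := by ring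
      _ ≤ _ := by gcongr

/-- The bounds of the schedule hold after each round with high probability. -/
theorem jointLaw_good (hA : 0 ≤ A) (hL : 0 < L) {Λ : ℝ}
    (hdev : ∀ r ≤ m, dev A m r ≤ 1 / 2)
    (hΛ : ∀ r ≤ m, Λ ≤ dev A m r ^ 2 * Real.exp (-logRatio A m r) ^ 2 * (L / (12 * 2 ^ r)))
    (r : ℕ) (hr : r ≤ m) :
    (jointLaw m L (r + 1)).toOuterMeasure
      (goodStates m L (r + 1) (lowerBd A m L (r + 1)) (upperBd A m L (r + 1)))ᶜ ≤
      (10 * (r + 1) : ℕ) * (numCommittees m * ENNReal.ofReal (Real.exp (-Λ))) := by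
  induction r with
  | zero =>
    have hε0 := dev_nonneg (m := m) hA 0
    have hε := hdev 0 hr
    have hu : upperBd A m L (0 + 1) = (1 + dev A m 0) * L := by
      simp [upperBd]
    rw [hu]
    refine (jointLaw_one_good hε0 (by linarith) ?_ ?_ (Λ := Λ)).trans ?_
    · rw [lowerBd, hu, logRatio_succ, show logRatio A m 0 = 0 by simp [logRatio]]
      have h1 := exp_neg_eight_mul_le hε0 hε
      rw [mul_zero, zero_add]
      set ε := dev A m 0
      have h2 : Real.exp (-(8 * ε)) * (1 + ε) ≤ 1 - ε := by
        have h3 := mul_le_mul_of_nonneg_left (by nlinarith : 1 + ε ≤ (1 + ε) ^ 2)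
          (Real.exp_pos (-(8 * ε))).le
        nlinarith [pow_nonneg hε0 2, mul_nonneg hε0 (by linarith : 0 ≤ 1 - ε)]
      calc Real.exp (-(8 * ε)) * ((1 + ε) * L) = Real.exp (-(8 * ε)) * (1 + ε) * L := by ring
        _ ≤ _ := by gcongr
    · refine (hΛ 0 hr).trans ?_
      have h1 : (0 : ℝ) ≤ dev A m 0 ^ 2 * L := by positivity
      simp only [logRatio, pow_zero, sub_self, mul_zero, neg_zero, Real.exp_zero, one_pow, mul_one]
      linarith
    · rw [mul_assoc]
      gcongr
      norm_num
  | succ r ih =>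
    have ih := ih (by omega)
    rw [jointLaw_succ (by omega)]
    have hexp := exponent_le hA hL (hdev (r + 1) hr) (hΛ (r + 1) hr)
    have hpos := upperBd_pos (m := m) hA hL (r + 1)
    refine (toOuterMeasure_bind_le _ _ _ _ fun z hz => jointStep_good (by omega) hr
      (mul_nonneg (Real.exp_pos _).le hpos.le) (lowerBd_le hA _) hpos (dev_nonneg hA _)
      (by linarith [hdev (r + 1) hr]) hexp.1 hexp.2
      (lowerBd_succ_le hA hL (hdev (r + 1) hr)) hz).trans ?_
    refine (add_le_add_left ih _).trans (le_of_eq ?_)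
    push_cast
    ring

theorem prob_samples_ge (hA : 0 ≤ A) (hL : 0 < L) {Λ l κ : ℝ}
    (hdev : ∀ r ≤ m, dev A m r ≤ 1 / 2)
    (hΛ : ∀ r ≤ m, Λ ≤ dev A m r ^ 2 * Real.exp (-logRatio A m r) ^ 2 * (L / (12 * 2 ^ r)))
    (hl0 : 0 ≤ l) (hl : l ≤ lowerBd A m L (m + 1)) (hΛl : Λ ≤ l / 8) (hκ : κ ≤ l / 2) :
    1 - (10 * m + 11) * numCommittees m * Real.exp (-Λ) ≤ prob (sampling m L)
      {o | ∀ C, κ ≤ (o.numFrom C : ℝ) ∧ κ ≤ (o.numTo C : ℝ)} := by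
  refine one_sub_le_prob _ _ (by positivity) ?_
  have h1 : (sampling m L).toOuterMeasure
      {o | ∀ C, κ ≤ (o.numFrom C : ℝ) ∧ κ ≤ (o.numTo C : ℝ)}ᶜ =
      (finalLaw m L).toOuterMeasure {y | ¬ ∀ C, κ ≤ ((tokensFrom y C).card : ℝ) ∧
        κ ≤ ((tokensTo y C).card : ℝ)} := by
    rw [finalLaw, PMF.toOuterMeasure_map_apply]
    rfl
  rw [h1, finalLaw_eq, ← jointLaw_map_snd]
  refine (toOuterMeasure_bind_le _ _
    {x | ∀ C, l ≤ ((tokensFrom x C).card : ℝ) ∧ l ≤ ((tokensTo x C).card : ℝ)} _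
    (δ := numCommittees m * ENNReal.ofReal (Real.exp (-Λ))) fun x hx => ?_).trans ?_
  · rw [Set.mem_ofPred_eq] at hx
    refine le_trans (MeasureTheory.measure_mono ?_)
      (lastRound_good hl0 hΛl (fun C => (hx C).1) fun C => (hx C).2)
    intro y hy hcon
    exact hy fun C => ⟨hκ.trans (hcon C).1, hκ.trans (hcon C).2⟩
  · rw [PMF.toOuterMeasure_map_apply]
    have h2 : (jointLaw m L (m + 1)).toOuterMeasure (Prod.snd ⁻¹'
        {x | ∀ C, l ≤ ((tokensFrom x C).card : ℝ) ∧ l ≤ ((tokensTo x C).card : ℝ)}ᶜ) ≤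
        (10 * (m + 1) : ℕ) * (numCommittees m * ENNReal.ofReal (Real.exp (-Λ))) := by
      refine le_trans (MeasureTheory.measure_mono ?_) (jointLaw_good hA hL hdev hΛ m le_rfl)
      intro z hz hcon
      exact hz fun C => ⟨hl.trans (hcon.2 C).1.1, hl.trans (hcon.2 C).2.1⟩
    refine (add_le_add_left h2 _).trans (le_of_eq ?_)
    have h3 : ((10 * m + 11) * numCommittees m * Real.exp (-Λ) : ℝ) =
        ((10 * m + 11 : ℕ) : ℝ) * ((numCommittees m : ℝ) * Real.exp (-Λ)) := by
      push_cast
      ring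
    rw [h3, ENNReal.ofReal_mul (Nat.cast_nonneg _), ENNReal.ofReal_mul (Nat.cast_nonneg _),
      ENNReal.ofReal_natCast, ENNReal.ofReal_natCast]
    push_cast
    ring

end Schedule

/-! ### The number of samples -/

section Samples

open Filter

/-- For large `m`, every round of the schedule with the parameter `A` has a sufficient exponent:
in early rounds the ratio of the bounds is still bounded, and in late rounds the factor `9 / 8`
per round outweighs it. -/
theorem exists_schedule {Γ : ℝ} (hΓ : 0 < Γ) : ∃ A : ℝ, 0 ≤ A ∧ ∃ m₁ : ℕ, ∀ m ≥ m₁, ∀ r ≤ m,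
    dev A m r ≤ 1 / 2 ∧ Γ ≤ A ^ 2 * (9 / 8) ^ r * Real.exp (-logRatio A m r) ^ 2 := by
  -- `A ^ 2` outweighs `Γ` and the factor `exp (-2)` of the rounds with `logRatio A m r ≤ 1`
  set A := 1 + Γ * Real.exp 2 with hAdef
  have hA1 : 1 ≤ A := by
    have := mul_pos hΓ (Real.exp_pos 2)
    linarith
  have hA : 0 ≤ A := by linarith
  -- `logRatio A m r` can exceed `1` only in the last `J` rounds
  set J := ⌈A⌉₊ with hJ
  have hlim1 : Tendsto (fun m : ℕ => A / 16 * (3 / 4 : ℝ) ^ m) atTop (nhds (A / 16 * 0)) :=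
    (tendsto_pow_atTop_nhds_zero_of_lt_one (by norm_num) (by norm_num)).const_mul _
  rw [mul_zero] at hlim1
  have hlim2 : Tendsto (fun m : ℕ => (9 / 8 : ℝ) ^ (m - J)) atTop atTop :=
    (tendsto_pow_atTop_atTop_of_one_lt (by norm_num)).comp (tendsto_sub_atTop_nat J)
  obtain ⟨m₁, hm₁⟩ := eventually_atTop.1 ((hlim1.eventually_le_const
    (show (0 : ℝ) < 1 / 2 by norm_num)).and
    (hlim2.eventually_ge_atTop (Γ * Real.exp (2 * A))))
  refine ⟨A, hA, m₁, fun m hm r hr => ⟨?_, ?_⟩⟩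
  · refine le_trans ?_ (hm₁ m hm).1
    have h1 : (2 : ℝ) ^ r / 2 ^ m * (3 / 4) ^ r ≤ (3 / 4) ^ m := by
      rw [div_mul_eq_mul_div, div_le_iff₀ (by positivity), ← mul_pow, ← mul_pow]
      norm_num
      exact pow_le_pow_right₀ (by norm_num) hr
    rw [dev, mul_assoc]
    gcongr
  · have hratio := logRatio_le (m := m) hA r
    have hexp : Real.exp (-logRatio A m r) ^ 2 = Real.exp (-(2 * logRatio A m r)) := by
      rw [← Real.exp_nat_mul]
      congr 1
      push_cast
      ring
    rw [hexp]
    have h98 : (1 : ℝ) ≤ (9 / 8) ^ r := one_le_pow₀ (by norm_num)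
    obtain ⟨j, rfl⟩ := Nat.exists_eq_add_of_le hr
    have hpow : (2 : ℝ) ^ r / 2 ^ (r + j) = 1 / 2 ^ j := by
      rw [pow_add]
      field_simp
    rw [hpow, mul_one_div] at hratio
    rcases le_or_gt A (2 ^ j) with h | h
    · have h1 : logRatio A (r + j) r ≤ 1 := hratio.trans ((div_le_one (by positivity)).2 h)
      have h2 : Real.exp (-2) ≤ Real.exp (-(2 * logRatio A (r + j) r)) :=
        Real.exp_le_exp.2 (by linarith)
      have h3 : Γ * Real.exp 2 ≤ A ^ 2 := by nlinarith
      calc Γ = Γ * Real.exp 2 * 1 * Real.exp (-2) := by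
            rw [mul_one, mul_assoc, ← Real.exp_add]
            norm_num
        _ ≤ _ := by gcongr
    · have hjA : (j : ℝ) < A := lt_of_lt_of_le (by exact_mod_cast Nat.lt_two_pow_self) h.le
      have hjJ : j ≤ J := by exact_mod_cast hjA.le.trans (Nat.le_ceil A)
      have h1 : logRatio A (r + j) r ≤ A :=
        hratio.trans (div_le_self hA (one_le_pow₀ (by norm_num)))
      have h2 : Real.exp (-(2 * A)) ≤ Real.exp (-(2 * logRatio A (r + j) r)) :=
        Real.exp_le_exp.2 (by linarith)
      have h3 : Γ * Real.exp (2 * A) ≤ (9 / 8) ^ r :=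
        (hm₁ _ hm).2.trans (pow_le_pow_right₀ (by norm_num) (by omega))
      calc Γ = 1 * (Γ * Real.exp (2 * A)) * Real.exp (-(2 * A)) := by
            rw [one_mul, mul_assoc, ← Real.exp_add]
            simp
        _ ≤ _ := by
            gcongr
            nlinarith

theorem eventually_le_of_numCommittees {c₁ : ℝ} (hc₁ : 0 < c₁) (m₁ : ℕ) :
    ∀ᶠ n : ℕ in atTop, ∀ m, c₁ * (n / Real.log n) ≤ (numCommittees m : ℝ) → m₁ ≤ m := by
  have h1 := (Real.isLittleO_log_id_atTop.comp_tendsto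
    (tendsto_natCast_atTop_atTop (R := ℝ))).def
    (c := c₁ / (numCommittees m₁ + 1)) (by positivity)
  filter_upwards [h1, eventually_le_log 1] with n hn hl m hm
  have hn0 := natCast_pos_of_one_le_log hl
  have hl0 : 0 < Real.log n := by linarith
  simp only [Function.comp_apply, id, Real.norm_eq_abs, abs_of_pos hn0, abs_of_pos hl0] at hn
  by_contra hlt
  push Not at hlt
  have h2 : numCommittees m ≤ numCommittees m₁ := by
    unfold numCommittees
    have h3 : 2 ^ m ≤ 2 ^ m₁ := Nat.pow_le_pow_right two_pos hlt.le
    exact Nat.mul_le_mul h3 (Nat.pow_le_pow_right two_pos h3)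
  have h4 : (numCommittees m : ℝ) ≤ numCommittees m₁ := by exact_mod_cast h2
  rw [mul_div_assoc', div_le_iff₀ hl0] at hm
  rw [div_mul_eq_mul_div, le_div_iff₀ (by positivity)] at hn
  nlinarith

theorem number_of_samples (c₁ c₂ a₁ a₂ α₀ : ℝ) (hc₁ : 0 < c₁) (ha₁ : 0 < a₁) (hα₀ : 0 < α₀) :
    ∃ κ : ℝ, 0 < κ ∧ ∀ c : ℝ, 0 < c → ∃ n₀ : ℕ, ∀ n : ℕ, n₀ ≤ n →
      ∀ (m L : ℕ) (α : ℝ),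
        c₁ * (n / Real.log n) ≤ (numCommittees m : ℝ) →
        (numCommittees m : ℝ) ≤ c₂ * (n / Real.log n) →
        α₀ ≤ α →
        a₁ * (α * Real.log n ^ 3) ≤ L → L ≤ a₂ * (α * Real.log n ^ 3) →
        1 - (n : ℝ) ^ (-c) ≤ prob (sampling m L)
          {o | ∀ C, κ * (α * Real.log n) ≤ (o.numFrom C : ℝ) ∧
            κ * (α * Real.log n) ≤ (o.numTo C : ℝ)} := by
  -- `κ = 1` will do, since the loop leaves of the order of `α * log n ^ 2` tokens per committee
  refine ⟨1, one_pos, fun c hc => ?_⟩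
  -- `L` is at least `g * log n * 4 ^ m`, as `2 ^ m ≤ 2 * log n`
  set g := a₁ * α₀ / 4 with hg
  have hg0 : 0 < g := by positivity
  -- the exponent `(c + 3) * log n` beats `n ^ 3` bad events; `3072 = 16 ^ 2 * 12` collects the
  -- factors `1 / 16` in `dev` and `1 / 12` in `exponent_le`
  obtain ⟨A, hA, m₁, hm₁⟩ := exists_schedule (Γ := 3072 * (c + 3) / g) (by positivity)
  -- the final ratio of the lower bound to the upper bound is at least `e`
  set e := Real.exp (-(2 * A)) with he
  have he0 : 0 < e := Real.exp_pos _
  obtain ⟨n₀, hn₀⟩ := eventually_atTop.1 ((eventually_le_log 1).and ((eventually_le_log c₂).and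
    ((eventually_le_log 22).and ((eventually_le_of_numCommittees hc₁ m₁).and
    ((eventually_le_log (4 / (e * a₁))).and
      (eventually_le_log (16 * (c + 3) / (e * a₁ * α₀))))))))
  refine ⟨n₀, fun n hn m L α hNlow hN hα hLlow _ => ?_⟩
  obtain ⟨hl1, hlc, hl22, hm, hle, hle'⟩ := hn₀ n hn
  have hmm := hm₁ m (hm m hNlow)
  have hn0 := natCast_pos_of_one_le_log hl1
  have hl0 : 0 < Real.log n := by linarith
  have hNn := numCommittees_le hl1 hlc hN
  have hk := two_pow_le_two_mul_log hl1 hNn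
  have hα' : 0 < α := by linarith
  set l := Real.log n with hldef
  have hLpos' : (0 : ℝ) < L := lt_of_lt_of_le (by positivity) hLlow
  have hLpos : 0 < L := by exact_mod_cast hLpos'
  have hLg : g * l * 4 ^ m ≤ L := by
    calc g * l * 4 ^ m = g * l * (2 ^ m) ^ 2 := by rw [← pow_mul, mul_comm m, pow_mul]; norm_num
      _ ≤ g * l * (2 * l) ^ 2 := by gcongr
      _ = a₁ * (α₀ * l ^ 3) := by rw [hg]; ring
      _ ≤ a₁ * (α * l ^ 3) := by gcongr
      _ ≤ L := hLlow
  -- the lower bound after the loop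
  have hlast : e * (a₁ * (α * l ^ 2) / 2) ≤ lowerBd A m L (m + 1) := by
    have h1 : logRatio A m (m + 1) ≤ 2 * A := by
      refine (logRatio_le hA _).trans (le_of_eq ?_)
      rw [pow_succ]
      field_simp
    have h2 := le_upperBd (L := L) (m := m) hA (m + 1)
    have h3 : a₁ * (α * l ^ 2) / 2 ≤ upperBd A m L (m + 1) := by
      refine le_trans ?_ h2
      rw [le_div_iff₀ (by positivity), pow_succ]
      calc a₁ * (α * l ^ 2) / 2 * (2 ^ m * 2) ≤ a₁ * (α * l ^ 2) / 2 * (2 * l * 2) := by gcongr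
        _ = 2 * (a₁ * (α * l ^ 3)) := by ring
        _ ≤ _ := by gcongr
    exact mul_le_mul (Real.exp_le_exp.2 (by linarith)) h3 (by positivity) (Real.exp_pos _).le
  refine le_trans ?_ (prob_samples_ge (Λ := (c + 3) * l) hA hLpos (fun r hr => (hmm r hr).1)
    (fun r hr => ?_) (by positivity) hlast ?_ ?_)
  · -- there are at most `n ^ 3` bad events
    refine sub_le_sub_left ?_ 1
    have hln : l ≤ n := Real.log_le_self hn0.le
    have hm2 : (m : ℝ) + 1 ≤ 2 * l := by
      refine le_trans ?_ hk
      exact_mod_cast Nat.lt_two_pow_self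
    have h1 : (10 * m + 11 : ℝ) ≤ n ^ 2 := by nlinarith
    have h2 : Real.exp (-((c + 3) * l)) = (n : ℝ) ^ (-c) * ((n : ℝ) ^ 3)⁻¹ := by
      rw [← Real.rpow_natCast, ← Real.rpow_neg hn0.le, ← Real.rpow_add hn0,
        Real.rpow_def_of_pos hn0, ← hldef]
      congr 1
      push_cast
      ring
    rw [h2]
    calc (10 * m + 11) * numCommittees m * ((n : ℝ) ^ (-c) * ((n : ℝ) ^ 3)⁻¹)
        ≤ (n : ℝ) ^ 2 * n * ((n : ℝ) ^ (-c) * ((n : ℝ) ^ 3)⁻¹) := by gcongr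
      _ = (n : ℝ) ^ (-c) := by field_simp
  · -- the tail bounds of the round `r + 1`
    have h1 := (hmm r hr).2
    rw [div_le_iff₀ hg0] at h1
    have h2 : dev A m r ^ 2 * (4 ^ m / 2 ^ r) = A ^ 2 / 256 * (9 / 8) ^ r := by
      have h3 : ((2 : ℝ) ^ r * (3 / 4) ^ r) ^ 2 / 2 ^ r = (9 / 8) ^ r := by
        rw [← mul_pow, ← pow_mul, mul_comm r, pow_mul, ← div_pow]
        norm_num
      have h4 : (4 : ℝ) ^ m = (2 ^ m) ^ 2 := by
        rw [← pow_mul, mul_comm m, pow_mul]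
        norm_num
      rw [← h3, h4, dev]
      field_simp
      norm_num
    calc (c + 3) * l = 3072 * (c + 3) * (l / 3072) := by ring
      _ ≤ A ^ 2 * (9 / 8) ^ r * Real.exp (-logRatio A m r) ^ 2 * g * (l / 3072) := by gcongr
      _ = A ^ 2 / 256 * (9 / 8) ^ r * Real.exp (-logRatio A m r) ^ 2 * (g * l / 12) := by ring
      _ = dev A m r ^ 2 * Real.exp (-logRatio A m r) ^ 2 * (g * l * 4 ^ m / (12 * 2 ^ r)) := by
          rw [← h2]
          field_simp
      _ ≤ _ := by gcongr
  · rw [div_le_iff₀ (by positivity)] at hle'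
    calc (c + 3) * l = 16 * (c + 3) * l / 16 := by ring
      _ ≤ l * (e * a₁ * α₀) * l / 16 := by gcongr
      _ = e * (a₁ * (α₀ * l ^ 2) / 2) / 8 := by ring
      _ ≤ _ := by gcongr
  · rw [div_le_iff₀ (by positivity)] at hle
    calc 1 * (α * l) = 4 * (α * l) / 4 := by ring
      _ ≤ l * (e * a₁) * (α * l) / 4 := by gcongr
      _ = _ := by ring

end Samples

end Spartan

theorem mainTheorem2 (c₁ c₂ a₁ a₂ α₀ p₀ s₁ s₂ b₀ : ℝ) (q : ℕ)
    (hc₁ : 0 < c₁) (hc₂ : 0 < c₂) (ha₁ : 0 < a₁) (ha₂ : 0 < a₂) (hα₀ : 0 < α₀) (hp₀ : 0 < p₀)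
    (hs₁ : 0 < s₁) (hs₂ : 0 < s₂) (hb₀ : 0 < b₀) :
    -- the procedure conforms to the model and takes `O(log log n)` rounds
    (∃ K : ℝ, ∃ d : ℕ, 0 < K ∧ ∀ c : ℝ, 0 < c → ∃ n₀ : ℕ, ∀ n : ℕ, n₀ ≤ n →
      ∀ (m L β : ℕ) (α : ℝ),
        c₁ * (n / Real.log n) ≤ (Spartan.numCommittees m : ℝ) →
        (Spartan.numCommittees m : ℝ) ≤ c₂ * (n / Real.log n) →
        α₀ ≤ α → α ≤ p₀ * Real.log n ^ q →
        a₁ * (α * Real.log n ^ 3) ≤ L → L ≤ a₂ * (α * Real.log n ^ 3) →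
        (β : ℝ) ≤ b₀ * Real.log n →
        (Spartan.numRounds m : ℝ) ≤ K * Real.log (Real.log n) ∧
        1 - (n : ℝ) ^ (-c) ≤ Spartan.prob (Spartan.sampling m L)
          {o | ∀ (mem : ℕ → Spartan.Committee (2 ^ m) → Finset (Spartan.Node β))
              (view : ℕ → Spartan.Node β → Spartan.Committee (2 ^ m) → ℕ),
            Spartan.Robust n s₁ s₂ (Spartan.numRounds m) mem →
            (∀ r u D, view r u D ≤ r) →
            Spartan.Conforms o mem view (K * Real.log n ^ d)}) ∧
    -- the final destination of a surviving token is uniform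
    (∀ (m L : ℕ) (t : Spartan.Token m L),
      Spartan.prob (Spartan.sampling m L) {o | o.finalDst t ≠ none} ≠ 0 →
      ∀ D : Spartan.Committee (2 ^ m),
        Spartan.prob (Spartan.sampling m L) {o | o.finalDst t ≠ none ∧ o.finalDst t = some D} /
          Spartan.prob (Spartan.sampling m L) {o | o.finalDst t ≠ none} =
        1 / (Spartan.numCommittees m : ℝ)) ∧
    -- every committee is the source and the destination of many surviving tokens
    (∃ κ : ℝ, 0 < κ ∧ ∀ c : ℝ, 0 < c → ∃ n₀ : ℕ, ∀ n : ℕ, n₀ ≤ n →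
      ∀ (m L : ℕ) (α : ℝ),
        c₁ * (n / Real.log n) ≤ (Spartan.numCommittees m : ℝ) →
        (Spartan.numCommittees m : ℝ) ≤ c₂ * (n / Real.log n) →
        α₀ ≤ α →
        a₁ * (α * Real.log n ^ 3) ≤ L → L ≤ a₂ * (α * Real.log n ^ 3) →
        1 - (n : ℝ) ^ (-c) ≤ Spartan.prob (Spartan.sampling m L)
          {o | ∀ C, κ * (α * Real.log n) ≤ (o.numFrom C : ℝ) ∧
            κ * (α * Real.log n) ≤ (o.numTo C : ℝ)}) :=
  ⟨Spartan.conformity c₁ c₂ a₁ a₂ α₀ p₀ s₁ s₂ b₀ q ha₂ hp₀ hs₂ hb₀, Spartan.uniformity,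
    Spartan.number_of_samples c₁ c₂ a₁ a₂ α₀ hc₁ ha₁ hα₀⟩
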